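/- \textbf{Setup.} Let $n\ge 0$. A set of rank conditions is a collection of non-negative integers $r=\{r_{ij}\}_{0\le i\le j\le n}$ with $r_{ij}\le\min(r_{i,j-1},r_{i+1,j})$ for $0\le i<j\le n$ and $r_{ij}+r_{i-1,j+1}\ge r_{i-1,j}+r_{i,j+1}$ for $0<i\le j<n$. For $m\ge 0$ let $r+m=\{r_{ij}+m\}_{i\le j}$. Put $e_i=r_{ii}$, $N=e_0+\dots+e_n$, and set $r_{ij}=e_j+e_{j+1}+\dots+e_i$ for $j\le i$. For $0\le i<n$ and $0<j\le n$ let $W_{ij}$ be the permutation with $W_{ij}(p)=p+r_{i,j-1}-r_{ij}$ if $r_{ij}<p\le r_{i+1,j}$, $W_{ij}(p)=p-r_{i+1,j}+r_{ij}$ if $r_{i+1,j}<p\le r_{i+1,j}+r_{i,j-1}-r_{ij}$, and $W_{ij}(p)=p$ otherwise. Let $z(r)=\prod_{j=1}^{n}\prod_{i=0}^{n-1}W_{ij}\in S_N$ (the rightmost factor acts first) and $\widehat z(r)=w_0z(r)^{-1}w_0$, where $w_0$ is the longest permutation in $S_N$. Let $\widehat z(e)=\widehat z(r^e)$, where $r^e_{ij}=\min\{e_i,\dots,e_j\}$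 for $i\le j$. For $w\in S_N$ let $\mathfrak G_w(a;b)\in\mathbb Z[a_1^{-1},\dots,a_N^{-1},b_1,\dots,b_N]$ be the double Grothendieck polynomial, given by $\mathfrak G_{w_0}(a;b)=\prod_{p+q\le N}(1-b_p/a_q)$ and $(a_i-a_{i+1})\,\mathfrak G_w(a;b)=a_i\,\mathfrak G_{ws_i}(a;b)-a_{i+1}\,\mathfrak G_{ws_i}(a_{s_i};b)$ whenever $w(i)<w(i+1)$, where $s_i$ is the transposition of $i$ and $i+1$, and $a_{s_i}$ is $a$ with $a_i$ and $a_{i+1}$ exchanged. For $0\le i\le n$ let $a^i=(a^i_1,\dots,a^i_{e_i})$ and $b^i=(b^i_1,\dots,b^i_{e_i})$ be variables, and let $a=(a^0,\dots,a^n)$, $b=(b^0,\dots,b^n)$, $\breve a=(a^n,a^{n-1},\dots,a^0)$. The double quiver polynomial is \[K_r(a;b)=\frac{\mathfrak G_{\widehat z(r)}(\breve a;b)}{\mathfrak G_{\widehat z(e)}(\breve a;b)}\,.\] \textbf{Theorem (rank stability).} For any rank conditions $r$, the denominator $\mathfrak G_{\widehat z(e)}(\breve a;b)$ is non-zero and divides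 $\mathfrak G_{\widehat z(r)}(\breve a;b)$, so $K_r(a;b)$ is a polynomial in the variables $(a^i_j)^{-1}$ and $b^i_j$. For any rank conditions $r$ and any integer $m\ge 0$, \[K_{r+m}(a^0,1^m,\dots,a^n,1^m\,;\,b^0,1^m,\dots,b^n,1^m)=K_r(a^0,\dots,a^n\,;\,b^0,\dots,b^n)\,,\] where $1^m$ stands for $m$ variables set equal to $1$. -/

import Mathlib

/-! Permutations `w ∈ S_N` are permutations of `{0, 1, 2, …}` fixing every `p ≥ N`
(all positions are counted from `0`).  The product of permutations is composition, so the
rightmost factor acts first. -/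

/-- The quotient `f / g` when `g` divides `f` (unique in a domain if `g ≠ 0`), and `0` otherwise. -/
noncomputable def exactQuot {R : Type*} [CommRing R] (f g : R) : R :=
  open Classical in if h : g ∣ f then h.choose else 0

theorem exactQuot_spec {R : Type*} [CommRing R] {f g : R} (h : g ∣ f) :
    g * exactQuot f g = f := by
  unfold exactQuot
  rw [dif_pos h]
  exact h.choose_spec.symm

/-! ### Double Grothendieck polynomials -/

/-- The ring `ℤ[a_σ⁻¹, b_τ]`.  The polynomial variable `X (Sum.inl q)` is `a_q⁻¹` and the
polynomial variable `X (Sum.inr p)` is `b_p`. -/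
abbrev GRing (σ τ : Type) : Type := MvPolynomial (σ ⊕ τ) ℤ

/-- The element `a_q⁻¹`. -/
noncomputable def aInv {σ τ : Type} (q : σ) : GRing σ τ := MvPolynomial.X (Sum.inl q)

/-- The element `b_p`. -/
noncomputable def bVar {σ τ : Type} (p : τ) : GRing σ τ := MvPolynomial.X (Sum.inr p)

/-- Exchange the variables `a_i` and `a_j`. -/
noncomputable def swapA {σ τ : Type} [DecidableEq σ] (i j : σ) : GRing σ τ →ₐ[ℤ] GRing σ τ :=
  MvPolynomial.rename (Sum.map (Equiv.swap i j) id)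

/-- The operator `f ↦ (a_i f - a_j f(a_{s}; b)) / (a_i - a_j)`, where `s` exchanges `a_i` and
`a_j`.  Numerator and denominator have been multiplied by `a_i⁻¹ a_j⁻¹`. -/
noncomputable def isobaric {σ τ : Type} [DecidableEq σ] (i j : σ) (f : GRing σ τ) : GRing σ τ :=
  exactQuot (aInv j * f - aInv i * swapA i j f) (aInv j - aInv i)

theorem sub_dvd_sub_swapA {σ τ : Type} [DecidableEq σ] (i j : σ) (f : GRing σ τ) :
    (aInv j - aInv i : GRing σ τ) ∣ f - swapA i j f := by
  induction f using MvPolynomial.induction_on with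
  | C c => simp [swapA]
  | add p q hp hq =>
    have h := dvd_add hp hq
    rw [map_add]
    convert h using 1
    ring
  | mul_X p v hp =>
    have hv : (aInv j - aInv i : GRing σ τ) ∣
        MvPolynomial.X v - swapA i j (MvPolynomial.X v) := by
      rcases v with q | t
      · simp only [swapA, MvPolynomial.rename_X, Sum.map_inl, aInv]
        rcases eq_or_ne q i with rfl | hi
        · rw [Equiv.swap_apply_left]
          exact ⟨-1, by ring⟩
        · rcases eq_or_ne q j with rfl | hj
          · rw [Equiv.swap_apply_right]
          · rw [Equiv.swap_apply_of_ne_of_ne hi hj, sub_self]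
            exact dvd_zero _
      · simp [swapA]
    have h := dvd_add (hp.mul_right (MvPolynomial.X v)) (hv.mul_left (swapA i j p))
    rw [map_mul]
    convert h using 1
    ring

/-- The division in the definition of `isobaric` is always exact. -/
theorem isobaric_spec {σ τ : Type} [DecidableEq σ] (i j : σ) (f : GRing σ τ) :
    (aInv j - aInv i) * isobaric i j f = aInv j * f - aInv i * swapA i j f := by
  apply exactQuot_spec
  have h := dvd_add (Dvd.intro f rfl : (aInv j - aInv i : GRing σ τ) ∣ (aInv j - aInv i) * f)
    ((sub_dvd_sub_swapA i j f).mul_left (aInv i))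
  convert h using 1
  ring

theorem ascent_measure_lt (N : ℕ) (w : Equiv.Perm ℕ) (i : ℕ) (hi : i + 1 < N)
    (hw : w i < w (i + 1)) :
    ∑ p ∈ Finset.range N, p * (w * Equiv.swap i (i + 1)) p < ∑ p ∈ Finset.range N, p * w p := by
  have key : ∀ f : ℕ → ℕ, ∑ p ∈ Finset.range N, f p =
      f i + f (i + 1) + ∑ p ∈ ((Finset.range N).erase i).erase (i + 1), f p := by
    intro f
    rw [← Finset.add_sum_erase _ f (Finset.mem_range.2 (show i < N by omega)),
      ← Finset.add_sum_erase _ f (show i + 1 ∈ (Finset.range N).erase i by simp [hi]), add_assoc]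
  rw [key, key (fun p => p * w p)]
  have hrest : ∑ p ∈ ((Finset.range N).erase i).erase (i + 1),
        p * (w * Equiv.swap i (i + 1)) p =
      ∑ p ∈ ((Finset.range N).erase i).erase (i + 1), p * w p := by
    refine Finset.sum_congr rfl fun p hp => ?_
    simp only [Finset.mem_erase] at hp
    rw [Equiv.Perm.mul_apply, Equiv.swap_apply_of_ne_of_ne hp.2.1 hp.1]
  rw [hrest]
  simp only [Equiv.Perm.mul_apply, Equiv.swap_apply_left, Equiv.swap_apply_right]
  nlinarith

/-- The double Grothendieck polynomial `𝔊_w(a; b)` of `w ∈ S_N`, after Lascoux and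
Schützenberger.  If `w` has an ascent `w(i) < w(i+1)`, then (for the first such `i`)
`(a_i - a_{i+1}) 𝔊_w(a; b) = a_i 𝔊_{w s_i}(a; b) - a_{i+1} 𝔊_{w s_i}(a_{s_i}; b)`.
Otherwise `w` is the longest permutation of `S_N`, and `𝔊_w(a; b) = ∏ (1 - b_p / a_q)` over the
positions `p`, `q` with `p + q ≤ N` if they are counted from `1`. -/
noncomputable def grothendieck (N : ℕ) (w : Equiv.Perm ℕ) : GRing (Fin N) (Fin N) :=
  if h : ∃ i : ℕ, i < N - 1 ∧ w i < w (i + 1) then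
    have hi : Nat.find h + 1 < N := Nat.add_lt_of_lt_sub (Nat.find_spec h).1
    isobaric ⟨Nat.find h, Nat.lt_of_succ_lt hi⟩ ⟨Nat.find h + 1, hi⟩
      (grothendieck N (w * Equiv.swap (Nat.find h) (Nat.find h + 1)))
  else
    ∏ p : Fin N, ∏ q : Fin N,
      if (p : ℕ) + (q : ℕ) + 1 < N then 1 - bVar p * aInv q else 1
termination_by ∑ p ∈ Finset.range N, p * w p
decreasing_by exact ascent_measure_lt N w _ hi (Nat.find_spec h).2

/-! ### Rank conditions and the Zelevinsky permutation -/

/-- `r = {r_{ij}}`, `0 ≤ i ≤ j ≤ n`, is a set of rank conditions that can occur, where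
`r_{ii} = e_i` is the rank of the `i`-th bundle.  Only the values `r i j` with `i ≤ j ≤ n`
matter. -/
structure IsRankConditions (n : ℕ) (r : ℕ → ℕ → ℕ) : Prop where
  le_left : ∀ i j, i < j → j ≤ n → r i j ≤ r i (j - 1)
  le_right : ∀ i j, i < j → j ≤ n → r i j ≤ r (i + 1) j
  convex : ∀ i j, 0 < i → i ≤ j → j < n →
    r (i - 1) j + r i (j + 1) ≤ r i j + r (i - 1) (j + 1)

/-- The rank conditions `r + m`. -/
def addRank (r : ℕ → ℕ → ℕ) (m : ℕ) : ℕ → ℕ → ℕ := fun i j => r i j + m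

/-- The maximal rank conditions `r^e_{ij} = min {e_i, …, e_j}` with the same dimension vector
`e_i = r_{ii}` as `r`. -/
noncomputable def maxRank (r : ℕ → ℕ → ℕ) : ℕ → ℕ → ℕ :=
  fun i j => sInf ((fun k => r k k) '' Set.Icc i j)

/-- Extension of `r` to all `0 ≤ i, j ≤ n` by `r_{ij} = e_j + e_{j+1} + ⋯ + e_i` for `j ≤ i`. -/
def extRank (r : ℕ → ℕ → ℕ) (i j : ℕ) : ℕ :=
  if i < j then r i j else ∑ k ∈ Finset.Icc j i, r k k

/-- `N = e_0 + ⋯ + e_n`. -/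
def totalDim (n : ℕ) (r : ℕ → ℕ → ℕ) : ℕ := ∑ i : Fin (n + 1), r i i

/-- The permutation which fixes the first `c` positions, moves the next `u` positions up by `v`,
moves the next `v` positions down by `u`, and fixes the rest. -/
def blockSwap (c u v : ℕ) : Equiv.Perm ℕ where
  toFun p := if c ≤ p ∧ p < c + u then p + v
    else if c + u ≤ p ∧ p < c + u + v then p - u else p
  invFun p := if c ≤ p ∧ p < c + v then p + u
    else if c + v ≤ p ∧ p < c + v + u then p - v else p
  left_inv p := by grind
  right_inv p := by grind

/-- The permutation `W_{ij}`: it adds `r_{i,j-1} - r_{ij}` to `p` if `r_{ij} < p ≤ r_{i+1,j}`,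
subtracts `r_{i+1,j} - r_{ij}` from `p` if `r_{i+1,j} < p ≤ r_{i+1,j} + r_{i,j-1} - r_{ij}`, and
fixes all other `p` (with `p` counted from `1`). -/
def gridPerm (r : ℕ → ℕ → ℕ) (i j : ℕ) : Equiv.Perm ℕ :=
  blockSwap (extRank r i j) (extRank r (i + 1) j - extRank r i j)
    (extRank r i (j - 1) - extRank r i j)

/-- The conjugate Zelevinsky permutation `z(r) = ∏_{j=1}^n ∏_{i=0}^{n-1} W_{ij}` in `S_N`. -/
def conjZelevinsky (n : ℕ) (r : ℕ → ℕ → ℕ) : Equiv.Perm ℕ :=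
  ((List.range n).map fun j => ((List.range n).map fun i => gridPerm r i (j + 1)).prod).prod

/-- The longest permutation `w_0^{(N)}` of `S_N`. -/
def longestPerm (N : ℕ) : Equiv.Perm ℕ where
  toFun p := if p < N then N - 1 - p else p
  invFun p := if p < N then N - 1 - p else p
  left_inv p := by grind
  right_inv p := by grind

/-- The Zelevinsky permutation `ẑ(r) = w_0^{(N)} z(r)⁻¹ w_0^{(N)}`. -/
def zelevinsky (n : ℕ) (r : ℕ → ℕ → ℕ) : Equiv.Perm ℕ :=
  longestPerm (totalDim n r) * (conjZelevinsky n r)⁻¹ * longestPerm (totalDim n r)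

/-! ### Double quiver polynomials -/

/-- Index type for the variables `a^i_j` (or `b^i_j`), `0 ≤ i ≤ n`, `1 ≤ j ≤ e_i`. -/
abbrev BlockVar (n : ℕ) (r : ℕ → ℕ → ℕ) : Type := Σ i : Fin (n + 1), Fin (r i i)

/-- The sequence `(x^0, x^1, …, x^n)` of block variables, as a list of `N` variables. -/
def blockSeq (n : ℕ) (r : ℕ → ℕ → ℕ) (p : Fin (totalDim n r)) : BlockVar n r :=
  finSigmaFinEquiv.symm p

theorem totalDim_rev (n : ℕ) (r : ℕ → ℕ → ℕ) :
    totalDim n r = ∑ i : Fin (n + 1), r i.rev i.rev :=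
  (Equiv.sum_comp Fin.revPerm (fun i : Fin (n + 1) => r i i)).symm

/-- The sequence `(x^n, x^{n-1}, …, x^0)` of block variables, as a list of `N` variables; the
variables of each block keep their order `x^i_1, x^i_2, …`. -/
def blockSeqRev (n : ℕ) (r : ℕ → ℕ → ℕ) (q : Fin (totalDim n r)) : BlockVar n r :=
  let s : Σ i : Fin (n + 1), Fin (r i.rev i.rev) :=
    finSigmaFinEquiv.symm (Fin.cast (totalDim_rev n r) q)
  ⟨s.1.rev, s.2⟩

/-- `𝔊_w(ă; b)` for `w ∈ S_N`, where `ă = (a^n, a^{n-1}, …, a^0)` and `b = (b^0, b^1, …, b^n)`. -/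
noncomputable def blockGrothendieck (n : ℕ) (r : ℕ → ℕ → ℕ) (w : Equiv.Perm ℕ) :
    GRing (BlockVar n r) (BlockVar n r) :=
  MvPolynomial.rename (Sum.map (blockSeqRev n r) (blockSeq n r)) (grothendieck (totalDim n r) w)

/-- The numerator `𝔊_{ẑ(r)}(ă; b)` of the double ratio formula. -/
noncomputable def ratioNum (n : ℕ) (r : ℕ → ℕ → ℕ) : GRing (BlockVar n r) (BlockVar n r) :=
  blockGrothendieck n r (zelevinsky n r)

/-- The denominator `𝔊_{ẑ(e)}(ă; b)` of the double ratio formula, where `ẑ(e) = ẑ(r^e)`. -/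
noncomputable def ratioDen (n : ℕ) (r : ℕ → ℕ → ℕ) : GRing (BlockVar n r) (BlockVar n r) :=
  blockGrothendieck n r (zelevinsky n (maxRank r))

/-- The double quiver polynomial `K_r(a; b) = 𝔊_{ẑ(r)}(ă; b) / 𝔊_{ẑ(e)}(ă; b)`. -/
noncomputable def doubleQuiver (n : ℕ) (r : ℕ → ℕ → ℕ) : GRing (BlockVar n r) (BlockVar n r) :=
  exactQuot (ratioNum n r) (ratioDen n r)

/-- The list `x_1, …, x_k, 1, …, 1` with `m` ones at the end. -/
def padOnes {R : Type*} [One R] {k : ℕ} (m : ℕ) (x : Fin k → R) : Fin (k + m) → R :=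
  Fin.append x (fun _ => 1)

/-- The substitution
`f(a; b) ↦ f(a^0, 1^m, …, a^n, 1^m; b^0, 1^m, …, b^n, 1^m)`
for polynomials in the block variables of the rank conditions `r + m`. -/
noncomputable def specOnes (n : ℕ) (r : ℕ → ℕ → ℕ) (m : ℕ) :
    GRing (BlockVar n (addRank r m)) (BlockVar n (addRank r m)) →ₐ[ℤ]
      GRing (BlockVar n r) (BlockVar n r) :=
  MvPolynomial.aeval (Sum.elim
    (fun s : BlockVar n (addRank r m) => padOnes m (fun j : Fin (r s.1 s.1) => aInv ⟨s.1, j⟩) s.2)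
    (fun s : BlockVar n (addRank r m) => padOnes m (fun j : Fin (r s.1 s.1) => bVar ⟨s.1, j⟩) s.2))

/-! ### Demazure operators on functions on permutations -/

/-! Double Grothendieck polynomials are coefficients of a Fomin–Kirillov product in the 0-Hecke
algebra. The algebra acts here on functions on permutations: `T_k` evaluates `f` at the smaller of
`w` and `s_k w`, and the coefficient of an operator `X` at `w` is the value at `w` of `X` applied to
the indicator of the identity. By `grothendieck_eq_fkProd`, `𝔊_w(a; b)` is the coefficient of the
triangular product `fkProd` at `w₀ w⁻¹ w₀`, so numerator and denominator of the ratio are the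
coefficients at `z(r)` and `z(r^e)`. The Yang–Baxter equation yields exchange relations in both sets
of variables and the Cauchy identity `fkProd_cauchy`, which separates them.

Divisibility: the triangle is cut along the blocks of variables (`fkProd_flatten`), in parallel with
the recursion `conjZelevinsky_succ`, which writes `z(r)` as a head permutation times a block
transposition times `z` of the sequence without its first bundle. The rectangle of factors pairing
`b^0` with the `a^j`, `j ≥ 2`, can produce the block transposition only through its leading term
(`HasLead`, a count of inversions), and this term has coefficient `∏ (1 - b^0_p / a^j_q)`.
Collecting these coefficients gives `homFactor`, which depends on the dimension vector only. What
remains is `quiverFun`, whose recursion involves two consecutive bundles at a time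
(`coreProd_apply`). For `r^e` all head permutations are trivial and `quiverFun` is `1` at the
identity; hence the denominator is `homFactor`, and `K_r` is the value of `quiverFun` at the
identity.

Stability: passing to `r + m` replaces each head permutation `π` by `1^m × π`. On the permutations
`1^m × σ` the factors of index below `m` are invisible and the others act as their shifts down by
`m`. If the extra ones stand at the end of each block of `x = a⁻¹` and at the start of each block of
`b`, the recursion for `r + m` therefore collapses to the one for `r` (`quiverFun_addRank`). The
substitution in the theorem puts the ones at the opposite ends, because the order inside the
`x`-blocks is reversed. This is harmless: `z(r)` and its inverse increase on the relevant blocks, so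
the polynomials are symmetric in each block (`quiverFun_blockSwap`). -/

section Demazure

open Equiv

variable {R : Type*} [CommRing R]

/-- The left Demazure operator: `f ↦ (w ↦ f (min (w, s_k w)))`. -/
def dem (k : ℕ) : Module.End R (Perm ℕ → R) where
  toFun f w := if w⁻¹ k < w⁻¹ (k + 1) then f w else f (swap k (k + 1) * w)
  map_add' f g := by ext w; simp only [Pi.add_apply]; split_ifs <;> rfl
  map_smul' c f := by ext w; simp only [Pi.smul_apply, RingHom.id_apply]; split_ifs <;> rfl

/-- The right Demazure operator: `f ↦ (w ↦ f (min (w, w s_k)))`. -/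
def rdem (k : ℕ) : Module.End R (Perm ℕ → R) where
  toFun f w := if w k < w (k + 1) then f w else f (w * swap k (k + 1))
  map_add' f g := by ext w; simp only [Pi.add_apply]; split_ifs <;> rfl
  map_smul' c f := by ext w; simp only [Pi.smul_apply, RingHom.id_apply]; split_ifs <;> rfl

theorem dem_apply (k : ℕ) (f : Perm ℕ → R) (w : Perm ℕ) :
    dem k f w = if w⁻¹ k < w⁻¹ (k + 1) then f w else f (swap k (k + 1) * w) := rfl

theorem rdem_apply (k : ℕ) (f : Perm ℕ → R) (w : Perm ℕ) :
    rdem k f w = if w k < w (k + 1) then f w else f (w * swap k (k + 1)) := rfl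

theorem swap_mul_inv_left (k : ℕ) (w : Perm ℕ) : (swap k (k + 1) * w)⁻¹ k = w⁻¹ (k + 1) := by
  simp [mul_inv_rev]

theorem swap_mul_inv_right (k : ℕ) (w : Perm ℕ) : (swap k (k + 1) * w)⁻¹ (k + 1) = w⁻¹ k := by
  simp [mul_inv_rev]

theorem swap_mul_inv_of_ne (k l : ℕ) (w : Perm ℕ) (h₁ : l ≠ k) (h₂ : l ≠ k + 1) :
    (swap k (k + 1) * w)⁻¹ l = w⁻¹ l := by
  simp [mul_inv_rev, swap_apply_of_ne_of_ne h₁ h₂]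

theorem inv_ne_inv (w : Perm ℕ) {k l : ℕ} (h : k ≠ l) : w⁻¹ k ≠ w⁻¹ l :=
  fun h' => h (w⁻¹.injective h')

theorem dem_mul_self (k : ℕ) : (dem k : Module.End R (Perm ℕ → R)) * dem k = dem k := by
  ext f w
  simp only [Module.End.mul_apply, dem_apply, swap_mul_inv_left, swap_mul_inv_right]
  have := inv_ne_inv w (show k ≠ k + 1 by omega)
  split_ifs <;> first | rfl | omega

theorem swap_mul_swap_cancel (k l : ℕ) (w : Perm ℕ) : swap k l * (swap k l * w) = w := by
  rw [← mul_assoc, swap_mul_self, one_mul]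

theorem swap_braid (k : ℕ) (w : Perm ℕ) :
    swap k (k + 1) * (swap (k + 1) (k + 1 + 1) * (swap k (k + 1) * w)) =
      swap (k + 1) (k + 1 + 1) * (swap k (k + 1) * (swap (k + 1) (k + 1 + 1) * w)) := by
  simp only [← mul_assoc]
  congr 1
  ext p
  simp only [Perm.mul_apply, swap_apply_def]
  grind

/-- Both sides evaluate `f` at the minimal element of the coset `⟨s_k, s_{k+1}⟩ w`. The proof runs
through the relative orders of the positions of the values `k`, `k + 1`, `k + 2` in `w`. -/
theorem dem_braid (k : ℕ) : (dem k : Module.End R (Perm ℕ → R)) * dem (k + 1) * dem k =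
    dem (k + 1) * dem k * dem (k + 1) := by
  ext f w
  have e1 : ∀ w : Perm ℕ, (swap k (k + 1) * w)⁻¹ (k + 1 + 1) = w⁻¹ (k + 1 + 1) := fun w =>
    swap_mul_inv_of_ne _ _ _ (by omega) (by omega)
  have e2 : ∀ w : Perm ℕ, (swap (k + 1) (k + 1 + 1) * w)⁻¹ k = w⁻¹ k := fun w =>
    swap_mul_inv_of_ne _ _ _ (by omega) (by omega)
  have h1 := inv_ne_inv w (show k ≠ k + 1 by omega)
  have h2 := inv_ne_inv w (show k ≠ k + 1 + 1 by omega)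
  have h3 := inv_ne_inv w (show k + 1 ≠ k + 1 + 1 by omega)
  simp only [Module.End.mul_apply, dem_apply, swap_mul_inv_left, swap_mul_inv_right, e1, e2,
    swap_braid]
  split_ifs <;> first | rfl | omega

theorem swap_comm_of_lt {k l : ℕ} (h : k + 2 ≤ l) :
    swap k (k + 1) * swap l (l + 1) = swap l (l + 1) * swap k (k + 1) := by
  ext p
  simp only [Perm.mul_apply, swap_apply_def]
  grind

theorem dem_comm_of_lt {k l : ℕ} (h : k + 2 ≤ l) :
    Commute (dem k : Module.End R (Perm ℕ → R)) (dem l) := by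
  ext f w
  have e1 : ∀ w : Perm ℕ, (swap k (k + 1) * w)⁻¹ l = w⁻¹ l := fun w =>
    swap_mul_inv_of_ne _ _ _ (by omega) (by omega)
  have e2 : ∀ w : Perm ℕ, (swap k (k + 1) * w)⁻¹ (l + 1) = w⁻¹ (l + 1) := fun w =>
    swap_mul_inv_of_ne _ _ _ (by omega) (by omega)
  have e3 : ∀ w : Perm ℕ, (swap l (l + 1) * w)⁻¹ k = w⁻¹ k := fun w =>
    swap_mul_inv_of_ne _ _ _ (by omega) (by omega)
  have e4 : ∀ w : Perm ℕ, (swap l (l + 1) * w)⁻¹ (k + 1) = w⁻¹ (k + 1) := fun w =>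
    swap_mul_inv_of_ne _ _ _ (by omega) (by omega)
  have e5 : swap k (k + 1) * (swap l (l + 1) * w) = swap l (l + 1) * (swap k (k + 1) * w) := by
    rw [← mul_assoc, ← mul_assoc, swap_comm_of_lt h]
  simp only [Module.End.mul_apply, dem_apply, e1, e2, e3, e4, e5]
  split_ifs <;> rfl

theorem swap_mul_eq_mul_swap (w : Perm ℕ) (p q : ℕ) : swap (w p) (w q) * w = w * swap p q := by
  rw [Equiv.mul_swap_eq_swap_mul]

/-- Multiplication on one side changes the ascent tested on the other side only if `s_k w = w s_l`,
and then the two operators move `w` to the same permutation. -/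
theorem dem_rdem_comm (k l : ℕ) :
    Commute (dem k : Module.End R (Perm ℕ → R)) (rdem l) := by
  ext f w
  have hr1 : (w * swap l (l + 1))⁻¹ k = swap l (l + 1) (w⁻¹ k) := by simp [mul_inv_rev]
  have hr2 : (w * swap l (l + 1))⁻¹ (k + 1) = swap l (l + 1) (w⁻¹ (k + 1)) := by
    simp [mul_inv_rev]
  simp only [Module.End.mul_apply, dem_apply, rdem_apply, hr1, hr2, Perm.mul_apply, mul_assoc]
  obtain ⟨p, hp⟩ : ∃ p, w p = k := w.surjective k
  obtain ⟨q, hq⟩ : ∃ q, w q = k + 1 := w.surjective (k + 1)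
  have ip : w⁻¹ k = p := by rw [← hp]; simp
  have iq : w⁻¹ (k + 1) = q := by rw [← hq]; simp
  rw [ip, iq]
  have hpq : p ≠ q := by rintro rfl; omega
  have inj : ∀ a b, w a = w b → a = b := fun a b h => w.injective h
  -- The two exceptional cases, in which the positions of the values `k`, `k + 1` are exactly `l`,
  -- `l + 1` in some order.
  by_cases hc : p = l ∧ q = l + 1
  · obtain ⟨rfl, rfl⟩ := hc
    rw [hp, hq]
    simp
  by_cases hc' : q = l ∧ p = l + 1
  · obtain ⟨rfl, rfl⟩ := hc'
    have hs : swap k (k + 1) * w = w * swap q (q + 1) := by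
      rw [← swap_mul_eq_mul_swap, hp, hq, swap_comm]
    rw [hp, hq]
    simp [hs]
  have hA : (swap k (k + 1) (w l) < swap k (k + 1) (w (l + 1))) ↔ w l < w (l + 1) := by
    have := inj l (l + 1)
    have := inj l p
    have := inj l q
    have := inj (l + 1) p
    have := inj (l + 1) q
    simp only [swap_apply_def]
    grind
  have hB : (swap l (l + 1) p < swap l (l + 1) q) ↔ p < q := by
    simp only [swap_apply_def]
    grind
  rw [if_congr hA rfl rfl, if_congr hB rfl rfl]
  split_ifs <;> rfl

/-! ### 0-Hecke factors and the Yang–Baxter equation -/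

/-- The element `s + (c - s) T_k`. -/
def hecke₂ (k : ℕ) (s c : R) : Module.End R (Perm ℕ → R) := s • 1 + (c - s) • dem k

/-- The factor `t + (1 - t) T_k = 1 + (1 - t) u_k` of Fomin and Kirillov. -/
def hecke (k : ℕ) (t : R) : Module.End R (Perm ℕ → R) := t • 1 + (1 - t) • dem k

theorem hecke₂_one (k : ℕ) (t : R) : hecke₂ k t 1 = hecke k t := rfl

theorem hecke_apply (k : ℕ) (t : R) (f : Perm ℕ → R) (w : Perm ℕ) :
    hecke k t f w = if w⁻¹ k < w⁻¹ (k + 1) then f w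
      else t * f w + (1 - t) * f (swap k (k + 1) * w) := by
  simp only [hecke, LinearMap.add_apply, LinearMap.smul_apply, Module.End.one_apply, Pi.add_apply,
    Pi.smul_apply, smul_eq_mul, dem_apply]
  split_ifs
  · ring
  · rfl

theorem hecke₂_apply (k : ℕ) (s c : R) (f : Perm ℕ → R) (w : Perm ℕ) :
    hecke₂ k s c f w = if w⁻¹ k < w⁻¹ (k + 1) then c * f w
      else s * f w + (c - s) * f (swap k (k + 1) * w) := by
  simp only [hecke₂, LinearMap.add_apply, LinearMap.smul_apply, Module.End.one_apply, Pi.add_apply,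
    Pi.smul_apply, smul_eq_mul, dem_apply]
  split_ifs
  · ring
  · rfl

theorem hecke_one (k : ℕ) : hecke k (1 : R) = 1 := by simp [hecke]

/-- `hecke₂ k s c` is `c` times `hecke k (s / c)` with the denominator cleared. The relation is
multiplicativity in the parameter, which follows from `T_k² = T_k`, in a form that needs no
division. -/
theorem hecke₂_mul_hecke (k : ℕ) (s c d : R) :
    hecke₂ k s c * hecke k (c * d) = c • hecke k (s * d) := by
  simp only [hecke₂, hecke, add_mul, mul_add, smul_mul_assoc, mul_smul_comm, one_mul, mul_one,
    dem_mul_self]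
  module

theorem hecke_mul_hecke₂ (k : ℕ) (s c d : R) :
    hecke k (c * d) * hecke₂ k s c = c • hecke k (s * d) := by
  simp only [hecke₂, hecke, add_mul, mul_add, smul_mul_assoc, mul_smul_comm, one_mul, mul_one,
    dem_mul_self]
  module

theorem hecke_mul_hecke (k : ℕ) (s t : R) : hecke k s * hecke k t = hecke k (s * t) := by
  have := hecke₂_mul_hecke k s 1 t
  rwa [one_mul, one_smul, hecke₂_one] at this

/-- The Yang–Baxter equation with multiplicative spectral parameters `s / c` and `c d`: the middle
parameter is their product `s d`. -/
theorem hecke₂_braid (k : ℕ) (s c d : R) :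
    hecke₂ (k + 1) s c * hecke k (s * d) * hecke (k + 1) (c * d) =
      hecke k (c * d) * hecke (k + 1) (s * d) * hecke₂ k s c := by
  have h := dem_braid (R := R) k
  have h1 := dem_mul_self (R := R) k
  have h2 := dem_mul_self (R := R) (k + 1)
  simp only [hecke₂, hecke, add_mul, mul_add, smul_mul_assoc, mul_smul_comm, one_mul, mul_one,
    h1, h2, h]
  module

theorem hecke₂_braid' (k : ℕ) (s c d : R) :
    hecke (k + 1) (c * d) * hecke k (s * d) * hecke₂ (k + 1) s c =
      hecke₂ k s c * hecke (k + 1) (s * d) * hecke k (c * d) := by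
  have h := dem_braid (R := R) k
  have h1 := dem_mul_self (R := R) k
  have h2 := dem_mul_self (R := R) (k + 1)
  simp only [hecke₂, hecke, add_mul, mul_add, smul_mul_assoc, mul_smul_comm, one_mul, mul_one,
    h1, h2, h]
  module

theorem hecke_braid (k : ℕ) (s d : R) :
    hecke (k + 1) s * hecke k (s * d) * hecke (k + 1) d =
      hecke k d * hecke (k + 1) (s * d) * hecke k s := by
  have := hecke₂_braid k s 1 d
  rwa [one_mul, hecke₂_one, hecke₂_one] at this

theorem hecke₂_comm {k l : ℕ} (h : k + 2 ≤ l ∨ l + 2 ≤ k) (s c t : R) :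
    Commute (hecke₂ k s c) (hecke l t) := by
  have hd : Commute (dem k : Module.End R (Perm ℕ → R)) (dem l) := by
    rcases h with h | h
    · exact dem_comm_of_lt h
    · exact (dem_comm_of_lt h).symm
  unfold hecke₂ hecke
  refine Commute.add_left ?_ ?_
  · exact (Commute.one_left _).smul_left _
  · exact Commute.smul_left (Commute.add_right ((Commute.one_right _).smul_right _)
      (hd.smul_right _)) _

/-! ### Products of factors with restricted indices -/

/-- The monoid generated by the factors `hecke k t` with `k ∈ S`. -/
def heckeMon (R : Type*) [CommRing R] (S : Set ℕ) : Submonoid (Module.End R (Perm ℕ → R)) :=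
  Submonoid.closure {X | ∃ k ∈ S, ∃ t, X = hecke k t}

theorem hecke_mem {S : Set ℕ} {k : ℕ} (hk : k ∈ S) (t : R) : hecke k t ∈ heckeMon R S :=
  Submonoid.subset_closure ⟨k, hk, t, rfl⟩

theorem heckeMon_mono {S T : Set ℕ} (h : S ⊆ T) : heckeMon R S ≤ heckeMon R T := by
  refine Submonoid.closure_mono ?_
  rintro X ⟨k, hk, t, rfl⟩
  exact ⟨k, h hk, t, rfl⟩

@[elab_as_elim]
theorem heckeMon_induction {S : Set ℕ}
    {p : (X : Module.End R (Perm ℕ → R)) → X ∈ heckeMon R S → Prop} (h1 : p 1 (one_mem _))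
    (hmul : ∀ k (hk : k ∈ S) t X (hX : X ∈ heckeMon R S), p X hX →
      p (hecke k t * X) (mul_mem (hecke_mem hk t) hX))
    {X : Module.End R (Perm ℕ → R)} (hX : X ∈ heckeMon R S) : p X hX := by
  induction hX using Submonoid.closure_induction_left with
  | one => exact h1
  | mul_left x hx y hy ih =>
    obtain ⟨k, hk, t, rfl⟩ := hx
    exact hmul k hk t y hy ih

theorem hecke₂_comm_heckeMon {S : Set ℕ} {k : ℕ} (h : ∀ l ∈ S, k + 2 ≤ l ∨ l + 2 ≤ k) (s c : R)
    {X : Module.End R (Perm ℕ → R)} (hX : X ∈ heckeMon R S) : Commute (hecke₂ k s c) X := by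
  induction hX using heckeMon_induction with
  | h1 => exact Commute.one_right _
  | hmul l hl t X _ hX => exact (hecke₂_comm (h l hl) s c t).mul_right hX

theorem hecke_comm_heckeMon {S : Set ℕ} {k : ℕ} (h : ∀ l ∈ S, k + 2 ≤ l ∨ l + 2 ≤ k) (t : R)
    {X : Module.End R (Perm ℕ → R)} (hX : X ∈ heckeMon R S) : Commute (hecke k t) X :=
  hecke₂_comm_heckeMon h t 1 hX

theorem heckeMon_comm {S T : Set ℕ} (h : ∀ k ∈ S, ∀ l ∈ T, k + 2 ≤ l ∨ l + 2 ≤ k)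
    {X Y : Module.End R (Perm ℕ → R)} (hX : X ∈ heckeMon R S) (hY : Y ∈ heckeMon R T) :
    Commute X Y := by
  induction hX using heckeMon_induction with
  | h1 => exact Commute.one_left _
  | hmul k hk t X _ hX => exact (hecke₂_comm_heckeMon (h k hk) t 1 hY).mul_left hX

theorem heckeMon_rdem_comm {S : Set ℕ} {X : Module.End R (Perm ℕ → R)} (hX : X ∈ heckeMon R S)
    (l : ℕ) : Commute X (rdem l) := by
  induction hX using heckeMon_induction with
  | h1 => exact Commute.one_left _
  | hmul k hk t X _ hX =>
    refine Commute.mul_left ?_ hX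
    unfold hecke
    exact ((Commute.one_left _).smul_left _).add_left ((dem_rdem_comm k l).smul_left _)

/-! ### Coefficients of products, and factors invisible at an ascent -/

/-- The indicator function of the identity. -/
noncomputable def deltaOne (R : Type*) [CommRing R] : Perm ℕ → R :=
  open Classical in fun w => if w = 1 then 1 else 0

/-- The left and right Demazure operators agree on the indicator of the identity: both give the
indicator of `{1, s_k}`. This lets the last factor of a product be moved to the right action, which
commutes with everything else. -/
theorem hecke₂_deltaOne (k : ℕ) (s c : R) :
    hecke₂ k s c (deltaOne R) = (s • 1 + (c - s) • rdem k : Module.End R _) (deltaOne R) := by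
  have key : (dem k) (deltaOne R) = (rdem k) (deltaOne R) := by
    ext w
    simp only [dem_apply, rdem_apply, deltaOne]
    by_cases h1 : w = 1
    · subst h1; simp
    by_cases h2 : w = swap k (k + 1)
    · subst h2; simp
    have e1 : swap k (k + 1) * w ≠ 1 := fun h => h2 (by
      rw [← swap_mul_swap_cancel k (k + 1) w, h, mul_one])
    have e2 : w * swap k (k + 1) ≠ 1 := fun h => h2 (by
      rw [← mul_one (swap k (k + 1)), ← mul_one w, ← swap_mul_self k (k + 1), ← mul_assoc, h]; simp)
    simp [h1, e1, e2]
  simp only [hecke₂, LinearMap.add_apply, LinearMap.smul_apply, key]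

/-- Right multiplication by a factor with index `k` has no effect at a `z` which ascends at `k`. -/
theorem mul_hecke₂_deltaOne_apply {S : Set ℕ} {X : Module.End R (Perm ℕ → R)}
    (hX : X ∈ heckeMon R S) (k : ℕ) (s c : R) {z : Perm ℕ} (hz : z k < z (k + 1)) :
    (X * hecke₂ k s c) (deltaOne R) z = c * X (deltaOne R) z := by
  have hcomm := (heckeMon_rdem_comm hX k).eq
  have : (X * hecke₂ k s c) (deltaOne R) =
      s • X (deltaOne R) + (c - s) • (rdem k) (X (deltaOne R)) := by
    rw [Module.End.mul_apply, hecke₂_deltaOne, ← Module.End.mul_apply (rdem k), ← hcomm]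
    simp
  rw [this]
  simp only [Pi.add_apply, Pi.smul_apply, rdem_apply, hz, if_true, smul_eq_mul]
  ring

theorem mul_heckeMon_deltaOne_apply {S T : Set ℕ} {X Y : Module.End R (Perm ℕ → R)}
    (hX : X ∈ heckeMon R T) (hY : Y ∈ heckeMon R S) {z : Perm ℕ}
    (hz : ∀ k ∈ S, z k < z (k + 1)) :
    (X * Y) (deltaOne R) z = X (deltaOne R) z := by
  induction hY using Submonoid.closure_induction_right with
  | one => rw [mul_one]
  | mul_right y hy x hx ih =>
    obtain ⟨k, hk, t, rfl⟩ := hx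
    rw [← mul_assoc, ← hecke₂_one, mul_hecke₂_deltaOne_apply (S := Set.univ) _ _ _ _ (hz k hk), ih,
      one_mul]
    exact mul_mem (heckeMon_mono (Set.subset_univ _) hX) (heckeMon_mono (Set.subset_univ _) hy)

/-- The counterpart on the left: at an ascent of `z⁻¹` the operator `T_k` does not move `z`, so the
two coefficients of `hecke k t` add up to `1`. -/
theorem heckeMon_mul_apply {S : Set ℕ} {X : Module.End R (Perm ℕ → R)}
    (hX : X ∈ heckeMon R S) (f : Perm ℕ → R) {z : Perm ℕ}
    (hz : ∀ k ∈ S, z⁻¹ k < z⁻¹ (k + 1)) : X f z = f z := by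
  induction hX using heckeMon_induction with
  | h1 => rfl
  | hmul k hk t X _ hX => rw [Module.End.mul_apply, hecke_apply, if_pos (hz k hk), hX]

/-! ### Parabolic subgroups -/

/-- The permutations of `ℕ` which fix every `p ≥ J`. -/
def permBelow (J : ℕ) : Subgroup (Perm ℕ) where
  carrier := {w | ∀ p, J ≤ p → w p = p}
  mul_mem' {v w} hv hw p hp := by rw [Perm.mul_apply, hw p hp, hv p hp]
  one_mem' p _ := rfl
  inv_mem' {w} hw p hp := by rw [Perm.inv_eq_iff_eq, hw p hp]

theorem mem_permBelow {J : ℕ} {w : Perm ℕ} : w ∈ permBelow J ↔ ∀ p, J ≤ p → w p = p := Iff.rfl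

theorem permBelow_lt {J : ℕ} {w : Perm ℕ} (hw : w ∈ permBelow J) {p : ℕ} (hp : p < J) :
    w p < J := by
  by_contra h
  push Not at h
  have := hw _ h
  exact absurd (w.injective this) (by omega)

theorem permBelow_mono {J K : ℕ} (h : J ≤ K) : permBelow J ≤ permBelow K :=
  fun _ hw p hp => hw p (h.trans hp)

theorem swap_mem_permBelow {J k : ℕ} (h : k + 1 < J) : swap k (k + 1) ∈ permBelow J := fun p hp =>
  swap_apply_of_ne_of_ne (by omega) (by omega)

/-- Factors with indices in the range of `permBelow J` act on the restrictions to a coset of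
`permBelow J`, if the coset is represented by its minimal element `v`. -/
theorem heckeMon_apply_coset {J : ℕ} {X : Module.End R (Perm ℕ → R)}
    (hX : X ∈ heckeMon R {k | k + 1 < J}) {v : Perm ℕ} (hv : StrictMonoOn (v⁻¹ : Perm ℕ) (Set.Iio J))
    {f g : Perm ℕ → R} (hfg : ∀ x ∈ permBelow J, f (x * v) = g x) :
    ∀ x ∈ permBelow J, X f (x * v) = X g x := by
  induction hX using heckeMon_induction with
  | h1 => exact hfg
  | hmul k hk t X _ hX =>
    intro x hx
    have hk : k + 1 < J := hk
    have hcond : ((x * v)⁻¹ k < (x * v)⁻¹ (k + 1)) ↔ x⁻¹ k < x⁻¹ (k + 1) := by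
      rw [mul_inv_rev, Perm.mul_apply, Perm.mul_apply]
      exact hv.lt_iff_lt (permBelow_lt (inv_mem hx) (by omega)) (permBelow_lt (inv_mem hx) hk)
    simp only [Module.End.mul_apply, hecke_apply, hcond, ← mul_assoc]
    rw [hX x hx, hX _ (mul_mem (swap_mem_permBelow hk) hx)]

theorem heckeMon_support {J : ℕ} {X : Module.End R (Perm ℕ → R)}
    (hX : X ∈ heckeMon R {k | k + 1 < J}) {f : Perm ℕ → R}
    (hf : ∀ x ∉ permBelow J, f x = 0) : ∀ x ∉ permBelow J, X f x = 0 := by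
  induction hX using heckeMon_induction with
  | h1 => exact hf
  | hmul k hk t X _ hX =>
    intro x hx
    have h2 : swap k (k + 1) * x ∉ permBelow J := fun h => hx (by
      have := mul_mem (swap_mem_permBelow (J := J) hk) h
      rwa [swap_mul_swap_cancel] at this)
    simp [Module.End.mul_apply, hecke_apply, hX x hx, hX _ h2]

theorem deltaOne_support (J : ℕ) : ∀ x ∉ permBelow J, deltaOne R x = 0 := by
  intro x hx
  rw [deltaOne, if_neg]
  rintro rfl
  exact hx (one_mem _)

end Demazure

/-! ### Triangular and rectangular products -/

section Products

open Equiv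

variable {R : Type*} [CommRing R]

/-- The product of the factors with indices `c, c + 1, …, c + N - 1`. -/
def heckeRow (c : ℕ) : ℕ → (ℕ → R) → Module.End R (Perm ℕ → R)
  | 0, _ => 1
  | N + 1, τ => heckeRow c N τ * hecke (c + N) (τ N)

/-- The product of `e` rows of lengths `e + M - 1, …, M`, each of which starts with the index
`0`. -/
def heckeTrap : ℕ → ℕ → (ℕ → ℕ → R) → Module.End R (Perm ℕ → R)
  | 0, _, _ => 1
  | e + 1, M, τ => heckeRow 0 (e + M) (τ 0) * heckeTrap e M fun l => τ (l + 1)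

/-- The product of `e` rows of length `M'`, which start with the indices `e + M - 1, …, M`. -/
def heckeRect : ℕ → ℕ → ℕ → (ℕ → ℕ → R) → Module.End R (Perm ℕ → R)
  | 0, _, _, _ => 1
  | e + 1, M, M', τ =>
    heckeRow (e + M) M' (fun k => τ 0 (e + M + k)) * heckeRect e M M' fun l => τ (l + 1)

theorem heckeRow_succ (c N : ℕ) (τ : ℕ → R) :
    heckeRow c (N + 1) τ = heckeRow c N τ * hecke (c + N) (τ N) := rfl

theorem heckeRow_mem (c N : ℕ) (τ : ℕ → R) :
    heckeRow c N τ ∈ heckeMon R {k | c ≤ k ∧ k < c + N} := by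
  induction N with
  | zero => exact one_mem _
  | succ N ih =>
    refine mul_mem (heckeMon_mono ?_ ih) (hecke_mem ?_ _)
    · rintro k ⟨h1, h2⟩
      exact ⟨h1, by omega⟩
    · exact ⟨by omega, by omega⟩

theorem heckeRow_mem_of (c N : ℕ) (τ : ℕ → R) {S : Set ℕ} (h : ∀ k, c ≤ k → k < c + N → k ∈ S) :
    heckeRow c N τ ∈ heckeMon R S :=
  heckeMon_mono (fun k hk => h k hk.1 hk.2) (heckeRow_mem c N τ)

theorem heckeRow_congr (c N : ℕ) {τ τ' : ℕ → R} (h : ∀ k < N, τ k = τ' k) :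
    heckeRow c N τ = heckeRow c N τ' := by
  induction N with
  | zero => rfl
  | succ N ih => rw [heckeRow, heckeRow, ih fun k hk => h k (by omega), h N (by omega)]

theorem heckeRow_eq_one (c N : ℕ) {τ : ℕ → R} (h : ∀ k < N, τ k = 1) : heckeRow c N τ = 1 := by
  induction N with
  | zero => rfl
  | succ N ih => rw [heckeRow, ih fun k hk => h k (by omega), h N (by omega), hecke_one, one_mul]

theorem heckeRow_add (c N M : ℕ) (τ : ℕ → R) :
    heckeRow c (N + M) τ = heckeRow c N τ * heckeRow (c + N) M fun k => τ (N + k) := by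
  induction M with
  | zero => simp [heckeRow]
  | succ M ih => rw [← add_assoc, heckeRow, ih, heckeRow, mul_assoc, add_assoc]

theorem heckeRow_succ' (c N : ℕ) (τ : ℕ → R) :
    heckeRow c (N + 1) τ = hecke c (τ 0) * heckeRow (c + 1) N fun k => τ (k + 1) := by
  rw [add_comm, heckeRow_add]
  simp [heckeRow, add_comm]

theorem heckeTrap_mem (e M : ℕ) (τ : ℕ → ℕ → R) :
    heckeTrap e M τ ∈ heckeMon R {k | k + 1 < e + M} := by
  induction e generalizing τ with
  | zero => exact one_mem _
  | succ e ih =>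
    refine mul_mem (heckeRow_mem_of _ _ _ fun k _ hk => ?_) (heckeMon_mono (fun k hk => ?_) (ih _))
    · simp only [Set.mem_ofPred_eq]; omega
    · simp only [Set.mem_ofPred_eq] at hk ⊢; omega

theorem heckeTrap_congr (e M : ℕ) {τ τ' : ℕ → ℕ → R}
    (h : ∀ l k, l < e → l + k + 1 < e + M → τ l k = τ' l k) :
    heckeTrap e M τ = heckeTrap e M τ' := by
  induction e generalizing τ τ' with
  | zero => rfl
  | succ e ih =>
    rw [heckeTrap, heckeTrap, heckeRow_congr _ _ (fun k hk => h 0 k (by omega) (by omega)),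
      ih fun l k hl hk => h (l + 1) k (by omega) (by omega)]

theorem heckeTrap_eq_one (e M : ℕ) {τ : ℕ → ℕ → R}
    (h : ∀ l k, l < e → l + k + 1 < e + M → τ l k = 1) : heckeTrap e M τ = 1 := by
  induction e generalizing τ with
  | zero => rfl
  | succ e ih =>
    rw [heckeTrap, heckeRow_eq_one _ _ (fun k hk => h 0 k (by omega) (by omega)),
      ih fun l k hl hk => h (l + 1) k (by omega) (by omega), one_mul]

theorem heckeRect_mem (e M M' : ℕ) (τ : ℕ → ℕ → R) :
    heckeRect e M M' τ ∈ heckeMon R {k | M ≤ k ∧ k + 1 < e + M + M'} := by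
  induction e generalizing τ with
  | zero => exact one_mem _
  | succ e ih =>
    refine mul_mem (heckeRow_mem_of _ _ _ fun k h1 h2 => ?_)
      (heckeMon_mono (fun k hk => ?_) (ih _))
    · simp only [Set.mem_ofPred_eq]; omega
    · simp only [Set.mem_ofPred_eq] at hk ⊢; omega

theorem heckeRect_congr (e M M' : ℕ) {τ τ' : ℕ → ℕ → R}
    (h : ∀ l k, l < e → e + M ≤ l + k + 1 → l + k + 1 < e + M + M' → τ l k = τ' l k) :
    heckeRect e M M' τ = heckeRect e M M' τ' := by
  induction e generalizing τ τ' with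
  | zero => rfl
  | succ e ih =>
    rw [heckeRect, heckeRect,
      heckeRow_congr _ _ (fun k hk => h 0 (e + M + k) (by omega) (by omega) (by omega)),
      ih fun l k hl hk hk' => h (l + 1) k (by omega) (by omega) (by omega)]

/-- Each row is cut after its part in the smaller trapezoid. The cut-off tail has indices at least
two larger than those of all later trapezoid rows, so it commutes past them. -/
theorem heckeTrap_split (e M M' : ℕ) (τ : ℕ → ℕ → R) :
    heckeTrap e (M + M') τ = heckeTrap e M τ * heckeRect e M M' τ := by
  induction e generalizing τ with
  | zero => simp [heckeTrap, heckeRect]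
  | succ e ih =>
    have hc := (heckeMon_comm (by
      rintro k hk l ⟨hl, -⟩
      simp only [Set.mem_ofPred_eq] at hk
      left; omega) (heckeTrap_mem e M fun l => τ (l + 1))
        (heckeRow_mem (0 + (e + M)) M' fun k => τ 0 (e + M + k))).eq
    rw [heckeTrap, heckeTrap, heckeRect, ih, ← add_assoc, heckeRow_add, mul_assoc, mul_assoc,
      ← mul_assoc _ (heckeTrap _ _ _), ← hc, zero_add]
    simp only [mul_assoc]

theorem heckeTrap_add (e M : ℕ) (τ : ℕ → ℕ → R) :
    heckeTrap (e + M) 0 τ = heckeTrap e M τ * heckeTrap M 0 fun l => τ (e + l) := by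
  induction e generalizing τ with
  | zero => simp [heckeTrap]
  | succ e ih =>
    rw [show e + 1 + M = e + M + 1 by omega, heckeTrap, heckeTrap, ih, mul_assoc, add_zero]
    congr 2
    refine heckeTrap_congr _ _ fun l k _ _ => ?_
    rw [show e + 1 + l = e + l + 1 by omega]

/-- Peels off the last diagonal `l + k + 1 = N`. In `fkProd` this diagonal carries the single
variable `x_N`. -/
theorem heckeTrap_succ_zero (N : ℕ) (τ : ℕ → ℕ → R) :
    heckeTrap (N + 1) 0 τ = heckeTrap N 0 τ * heckeRect N 0 1 τ := by
  rw [heckeTrap_add N 1, heckeTrap, heckeTrap, ← heckeTrap_split]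
  simp [heckeRow]

/-! ### The generating function of double Grothendieck polynomials -/

/-- The product of Fomin and Kirillov, in variables `x_k = a_k⁻¹` and `b_l`. -/
def fkProd (N : ℕ) (x b : ℕ → R) : Module.End R (Perm ℕ → R) :=
  heckeTrap N 0 fun l k => b l * x (l + k + 1)

theorem fkProd_mem (N : ℕ) (x b : ℕ → R) : fkProd N x b ∈ heckeMon R {k | k + 1 < N} :=
  heckeTrap_mem N 0 _

theorem fkProd_congr (N : ℕ) {x x' b b' : ℕ → R} (hx : ∀ k, 0 < k → k < N → x k = x' k)
    (hb : ∀ l, l + 1 < N → b l = b' l) : fkProd N x b = fkProd N x' b' :=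
  heckeTrap_congr _ _ fun l k _ hk => by rw [hx _ (by omega) (by omega), hb _ (by omega)]

theorem fkProd_succ (N : ℕ) (x b : ℕ → R) :
    fkProd (N + 1) x b = heckeRow 0 N (fun k => b 0 * x (k + 1)) *
      fkProd N (fun k => x (k + 1)) fun l => b (l + 1) := by
  rw [fkProd, heckeTrap, fkProd]
  congr 1
  · exact heckeRow_congr _ _ fun k _ => by rw [zero_add]
  · exact heckeTrap_congr _ _ fun l k _ _ => by rw [show l + 1 + k + 1 = l + k + 1 + 1 by omega]

/-- A factor crosses a row by one Yang–Baxter move at the indices `k`, `k + 1`: its own index drops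
by one and two neighbouring variables of the row are exchanged. -/
theorem hecke₂_mul_heckeRow {N k : ℕ} (hk : k + 1 < N) (c : R) (y : ℕ → R) :
    hecke₂ (k + 1) (y k) (y (k + 1)) * heckeRow 0 N (fun i => c * y i) =
      heckeRow 0 N (fun i => c * y (swap k (k + 1) i)) * hecke₂ k (y k) (y (k + 1)) := by
  obtain ⟨M, rfl⟩ : ∃ M, N = k + 1 + 1 + M := ⟨N - (k + 1 + 1), by omega⟩
  rw [heckeRow_add 0 (k + 1 + 1), heckeRow_add 0 (k + 1 + 1), heckeRow_succ, heckeRow_succ,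
    heckeRow_succ 0 (k + 1), heckeRow_succ]
  simp only [zero_add, swap_apply_left, swap_apply_right]
  have h1 := (hecke₂_comm_heckeMon (S := {i | i < k}) (k := k + 1) (by
    intro l hl; simp only [Set.mem_ofPred_eq] at hl; right; omega) (y k) (y (k + 1))
    (heckeRow_mem_of 0 k (fun i => c * y i) (by
      intro i _ hi; simp only [Set.mem_ofPred_eq]; omega))).eq
  have h2 := (hecke₂_comm_heckeMon (S := {i | k + 2 ≤ i}) (k := k) (by
    intro l hl; simp only [Set.mem_ofPred_eq] at hl; left; omega) (y k) (y (k + 1))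
    (heckeRow_mem_of (k + 1 + 1) M (fun i => c * y (k + 1 + 1 + i)) (by
      intro i hi _; simp only [Set.mem_ofPred_eq]; omega))).eq
  have h3 := hecke₂_braid k (y k) (y (k + 1)) c
  rw [mul_comm c (y k), mul_comm c (y (k + 1))]
  have e1 : heckeRow 0 k (fun i => c * y (swap k (k + 1) i)) = heckeRow 0 k (fun i => c * y i) :=
    heckeRow_congr _ _ fun i hi => by rw [swap_apply_of_ne_of_ne (by omega) (by omega)]
  have e2 : heckeRow (k + 1 + 1) M (fun i => c * y (swap k (k + 1) (k + 1 + 1 + i))) =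
      heckeRow (k + 1 + 1) M (fun i => c * y (k + 1 + 1 + i)) :=
    heckeRow_congr _ _ fun i hi => by rw [swap_apply_of_ne_of_ne (by omega) (by omega)]
  rw [e1, e2]
  set A := heckeRow 0 k fun i => c * y i
  set B := heckeRow (k + 1 + 1) M fun i => c * y (k + 1 + 1 + i)
  calc _ = (hecke₂ (k + 1) (y k) (y (k + 1)) * A) * hecke k (y k * c) *
        hecke (k + 1) (y (k + 1) * c) * B := by simp only [mul_assoc]
    _ = A * (hecke₂ (k + 1) (y k) (y (k + 1)) * hecke k (y k * c) *
        hecke (k + 1) (y (k + 1) * c)) * B := by rw [h1]; simp only [mul_assoc]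
    _ = A * hecke k (y (k + 1) * c) * hecke (k + 1) (y k * c) *
        (hecke₂ k (y k) (y (k + 1)) * B) := by rw [h3]; simp only [mul_assoc]
    _ = _ := by rw [h2]; simp only [mul_assoc]

/-- The exchange relation in `x`, from which the divided difference recursion comes. The factor
crosses `k` rows, its index dropping each time, and at index `0` it is absorbed into the first
factor of the next row. -/
theorem hecke₂_mul_fkProd {N k : ℕ} (hk : k + 1 < N) (x b : ℕ → R) :
    hecke₂ k (x k) (x (k + 1)) * fkProd N x b =
      x (k + 1) • fkProd N (fun i => x (swap k (k + 1) i)) b := by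
  induction N generalizing k x b with
  | zero => omega
  | succ N ih =>
    rw [fkProd_succ, fkProd_succ]
    cases k with
    | zero =>
      obtain ⟨N, rfl⟩ : ∃ M, N = M + 1 := ⟨N - 1, by omega⟩
      rw [heckeRow_succ', heckeRow_succ', ← mul_assoc, ← mul_assoc, mul_comm (b 0) (x (0 + 1)),
        hecke₂_mul_hecke, smul_mul_assoc, smul_mul_assoc]
      simp only [zero_add, swap_apply_right, mul_comm (b 0) (x 0)]
      congr 2
    | succ k =>
      have hs : ∀ i, swap (k + 1) (k + 1 + 1) (i + 1) = swap k (k + 1) i + 1 := by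
        intro i; simp only [swap_apply_def]; split_ifs <;> omega
      have h1 := hecke₂_mul_heckeRow (N := N) (k := k) (by omega) (b 0) fun i => x (i + 1)
      have h2 := ih (k := k) (by omega) (fun i => x (i + 1)) fun l => b (l + 1)
      beta_reduce at h1 h2
      rw [← mul_assoc, h1, mul_assoc, h2, mul_smul_comm]
      simp only [hs]

/-- Two adjacent rows exchange their variables `c` and `d`: the extra factor travels leftwards
through the columns by Yang–Baxter moves and is absorbed at index `0`. -/
theorem heckeRow_mul_heckeRow_mul_hecke₂ (M : ℕ) (c d : R) (y : ℕ → R) :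
    heckeRow 0 (M + 1) (fun i => c * y i) * heckeRow 0 M (fun i => d * y (i + 1)) *
      hecke₂ M d c = c • (heckeRow 0 (M + 1) (fun i => d * y i) *
        heckeRow 0 M (fun i => c * y (i + 1))) := by
  induction M with
  | zero => simpa [heckeRow] using hecke_mul_hecke₂ 0 d c (y 0)
  | succ M ih =>
    have hc : ∀ s t, hecke (M + 1) s * heckeRow 0 M (fun i => t * y (i + 1)) =
        heckeRow 0 M (fun i => t * y (i + 1)) * hecke (M + 1) s := fun s t =>
      (hecke₂_comm_heckeMon (S := {i | i < M}) (k := M + 1) (by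
        intro l hl; simp only [Set.mem_ofPred_eq] at hl; right; omega) s 1
        (heckeRow_mem_of 0 M _ (by
          intro i _ hi; simp only [Set.mem_ofPred_eq]; omega))).eq
    rw [heckeRow_succ 0 (M + 1), heckeRow_succ 0 (M + 1), heckeRow_succ 0 M fun i => d * y (i + 1),
      heckeRow_succ 0 M fun i => c * y (i + 1)]
    simp only [zero_add]
    calc _ = heckeRow 0 (M + 1) (fun i => c * y i) * (hecke (M + 1) (c * y (M + 1)) *
          heckeRow 0 M (fun i => d * y (i + 1))) * hecke M (d * y (M + 1)) *
          hecke₂ (M + 1) d c := by simp only [mul_assoc]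
      _ = heckeRow 0 (M + 1) (fun i => c * y i) * heckeRow 0 M (fun i => d * y (i + 1)) *
          (hecke (M + 1) (c * y (M + 1)) * hecke M (d * y (M + 1)) * hecke₂ (M + 1) d c) := by
        rw [hc]; simp only [mul_assoc]
      _ = (heckeRow 0 (M + 1) (fun i => c * y i) * heckeRow 0 M (fun i => d * y (i + 1)) *
          hecke₂ M d c) * hecke (M + 1) (d * y (M + 1)) * hecke M (c * y (M + 1)) := by
        rw [hecke₂_braid']; simp only [mul_assoc]
      _ = _ := by
        rw [ih]
        simp only [smul_mul_assoc, mul_assoc]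
        rw [← mul_assoc (hecke (M + 1) _), hc, mul_assoc]

/-- The exchange relation in `b`. The index `N - 2 - p` is that of the last factor of row `p`; it
exceeds the indices of all rows after row `p + 1` by at least two, so the extra factor commutes up
to the two rows in question. -/
theorem fkProd_mul_hecke₂ {N p : ℕ} (hp : p + 1 < N) (x b : ℕ → R) :
    fkProd N x b * hecke₂ (N - 2 - p) (b (p + 1)) (b p) =
      b p • fkProd N x fun i => b (swap p (p + 1) i) := by
  induction N generalizing p x b with
  | zero => omega
  | succ N ih =>
    cases p with
    | zero =>
      obtain ⟨N, rfl⟩ : ∃ M, N = M + 1 := ⟨N - 1, by omega⟩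
      rw [fkProd_succ, fkProd_succ, fkProd_succ, fkProd_succ]
      simp only [zero_add, swap_apply_left, swap_apply_right, Nat.sub_zero,
        show N + 1 + 1 - 2 = N by omega]
      have hc := (hecke₂_comm_heckeMon (S := {i | i + 1 < N}) (k := N) (by
        intro l hl; simp only [Set.mem_ofPred_eq] at hl; right; omega) (b 1) (b 0)
        (fkProd_mem N (fun k => x (k + 1 + 1)) fun l => b (l + 1 + 1))).eq
      have h := heckeRow_mul_heckeRow_mul_hecke₂ N (b 0) (b 1) fun i => x (i + 1)
      have e : fkProd N (fun k => x (k + 1 + 1)) (fun l => b (swap 0 1 (l + 1 + 1))) =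
          fkProd N (fun k => x (k + 1 + 1)) fun l => b (l + 1 + 1) :=
        fkProd_congr _ (fun _ _ _ => rfl) fun l _ => by
          rw [swap_apply_of_ne_of_ne (by omega) (by omega)]
      beta_reduce at h
      rw [e, mul_assoc, mul_assoc, ← hc, ← mul_assoc, ← mul_assoc, h, smul_mul_assoc, mul_assoc]
    | succ p =>
      have hs : ∀ i, swap (p + 1) (p + 1 + 1) (i + 1) = swap p (p + 1) i + 1 := by
        intro i; simp only [swap_apply_def]; split_ifs <;> omega
      have h2 := ih (p := p) (by omega) (fun i => x (i + 1)) fun l => b (l + 1)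
      beta_reduce at h2
      rw [fkProd_succ, fkProd_succ, mul_assoc, show N + 1 - 2 - (p + 1) = N - 2 - p by omega, h2,
        mul_smul_comm]
      simp only [hs]
      rw [swap_apply_of_ne_of_ne (by omega) (by omega)]

/-! ### The Cauchy identity -/

theorem heckeRect_const {N : ℕ} {τ : ℕ → ℕ → R} {t : R} (h : ∀ l k, l + k + 1 = N → τ l k = t) :
    heckeRect N 0 1 τ = heckeRect N 0 1 fun _ _ => t :=
  heckeRect_congr _ _ _ fun l k _ _ _ => h l k (by omega)

theorem heckeRect_one_succ (N : ℕ) (t : R) : heckeRect (N + 1) 0 1 (fun _ _ => t) =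
    hecke N t * heckeRect N 0 1 fun _ _ => t := by
  simp [heckeRect, heckeRow]

/-- A descending product in `t` and an ascending product in `c` pass through each other by repeated
Yang–Baxter moves, leaving one factor with the merged parameter `c t`. -/
theorem heckeRect_mul_heckeRow (N : ℕ) (t c : R) :
    heckeRect (N + 1) 0 1 (fun _ _ => t) * heckeRow 0 (N + 1) (fun _ => c) =
      heckeRow 0 N (fun _ => c) * hecke N (c * t) * heckeRect N 0 1 fun _ _ => t := by
  induction N with
  | zero => simp [heckeRect, heckeRow, hecke_mul_hecke, mul_comm]
  | succ N ih =>
    have h1 := (hecke_comm_heckeMon (S := {i | i < N}) (k := N + 1) (by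
      intro l hl; simp only [Set.mem_ofPred_eq] at hl; right; omega) t
      (heckeRow_mem_of 0 N (fun _ => c) (by
        intro i _ hi; simp only [Set.mem_ofPred_eq]; omega))).eq
    have h2 := (hecke_comm_heckeMon (S := {i | i + 1 < N + 1}) (k := N + 1) (by
      intro l hl; simp only [Set.mem_ofPred_eq] at hl; right; omega) c
      (heckeMon_mono (T := {i | i + 1 < N + 1}) (by
        intro i hi; simp only [Set.mem_ofPred_eq] at hi ⊢; omega)
        (heckeRect_mem N 0 1 fun _ _ => t))).eq
    have h3 := hecke_braid N t c
    calc _ = hecke (N + 1) t * (heckeRect (N + 1) 0 1 (fun _ _ => t) *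
          heckeRow 0 (N + 1) (fun _ => c)) * hecke (N + 1) c := by
          rw [heckeRect_one_succ (N + 1), heckeRow]; simp only [mul_assoc, zero_add]
      _ = (hecke (N + 1) t * heckeRow 0 N (fun _ => c)) * hecke N (c * t) *
          (heckeRect N 0 1 (fun _ _ => t) * hecke (N + 1) c) := by
        rw [ih]; simp only [mul_assoc]
      _ = heckeRow 0 N (fun _ => c) * (hecke (N + 1) t * hecke N (t * c) * hecke (N + 1) c) *
          heckeRect N 0 1 (fun _ _ => t) := by
        rw [h1, ← h2, mul_comm c t]; simp only [mul_assoc]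
      _ = _ := by
        rw [h3, heckeRect_one_succ N, heckeRow, mul_comm c t]; simp only [mul_assoc, zero_add]

/-- Inductive step of the Cauchy identity: a row in `b_0` alone crosses a product in `x` alone,
diagonal by diagonal, and picks up the `x`-variables. -/
theorem fkProd_one_mul_heckeRow (N : ℕ) (x : ℕ → R) (c : R) :
    fkProd (N + 1) x 1 * heckeRow 0 N (fun _ => c) =
      heckeRow 0 N (fun k => c * x (k + 1)) * fkProd N (fun k => x (k + 1)) 1 := by
  have hcol : ∀ N (x : ℕ → R), fkProd (N + 1) x 1 =
      fkProd N x 1 * heckeRect N 0 1 fun _ _ => x N := by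
    intro N x
    rw [fkProd, heckeTrap_succ_zero, fkProd,
      heckeRect_const (t := x N) (fun l k h => by simp [h])]
  induction N with
  | zero => simp [fkProd, heckeTrap, heckeRow]
  | succ N ih =>
    have h := (hecke_comm_heckeMon (S := {i | i + 1 < N}) (k := N) (by
      intro l hl; simp only [Set.mem_ofPred_eq] at hl; right; omega) (c * x (N + 1))
      (fkProd_mem N (fun k => x (k + 1)) 1)).eq
    calc _ = fkProd (N + 1) x 1 * (heckeRect (N + 1) 0 1 (fun _ _ => x (N + 1)) *
          heckeRow 0 (N + 1) (fun _ => c)) := by rw [hcol (N + 1)]; simp only [mul_assoc]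
      _ = fkProd (N + 1) x 1 * heckeRow 0 N (fun _ => c) * hecke N (c * x (N + 1)) *
          heckeRect N 0 1 (fun _ _ => x (N + 1)) := by
        rw [heckeRect_mul_heckeRow]; simp only [mul_assoc]
      _ = heckeRow 0 N (fun k => c * x (k + 1)) * (hecke N (c * x (N + 1)) *
          fkProd N (fun k => x (k + 1)) 1) * heckeRect N 0 1 (fun _ _ => x (N + 1)) := by
        rw [ih, h]; simp only [mul_assoc]
      _ = _ := by rw [hcol N, heckeRow]; simp only [mul_assoc, zero_add]

theorem fkProd_cauchy (N : ℕ) (x b : ℕ → R) : fkProd N x b = fkProd N x 1 * fkProd N 1 b := by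
  induction N generalizing x b with
  | zero => simp [fkProd, heckeTrap]
  | succ N ih =>
    have h : fkProd (N + 1) 1 b = heckeRow 0 N (fun _ => b 0) * fkProd N 1 fun l => b (l + 1) := by
      rw [fkProd_succ]
      congr 1
      exact heckeRow_congr _ _ fun k _ => by simp
    rw [h, ← mul_assoc, fkProd_one_mul_heckeRow, fkProd_succ, ih, mul_assoc]

/-- Trailing variables `1` do not contribute. -/
theorem fkProd_one_add (N M : ℕ) {x : ℕ → R} (hx : ∀ k, N ≤ k → x k = 1) :
    fkProd (N + M) x 1 = fkProd N x 1 := by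
  induction M with
  | zero => rfl
  | succ M ih =>
    rw [← add_assoc, fkProd, heckeTrap_succ_zero, heckeRect_const (t := 1)
      (fun l k h => by simp [hx (l + k + 1) (by omega)]), ← fkProd, ih]
    have : ∀ K, heckeRect K 0 1 (fun _ _ => (1 : R)) = 1 := by
      intro K
      induction K with
      | zero => rfl
      | succ K ih => rw [heckeRect_one_succ, ih, hecke_one, one_mul]
    rw [this, mul_one]

/-! ### Restriction to a shifted copy of the symmetric group -/

/-- The permutation `1^m × σ`. -/
def permShift (m : ℕ) : Perm ℕ →* Perm ℕ where
  toFun σ :=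
    { toFun := fun p => if p < m then p else σ (p - m) + m
      invFun := fun p => if p < m then p else σ⁻¹ (p - m) + m
      left_inv := fun p => by dsimp only; split_ifs <;> first | omega | simp; omega
      right_inv := fun p => by dsimp only; split_ifs <;> first | omega | simp; omega }
  map_one' := by ext p; simp; intro h; omega
  map_mul' σ τ := by
    ext p
    simp only [coe_fn_mk, Perm.mul_apply]
    split_ifs <;> first | omega | simp

theorem permShift_apply (m : ℕ) (σ : Perm ℕ) (p : ℕ) :
    permShift m σ p = if p < m then p else σ (p - m) + m := rfl

theorem permShift_inv_apply (m : ℕ) (σ : Perm ℕ) (p : ℕ) :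
    (permShift m σ)⁻¹ p = if p < m then p else σ⁻¹ (p - m) + m := rfl

theorem permShift_eq_one_iff (m : ℕ) (σ : Perm ℕ) : permShift m σ = 1 ↔ σ = 1 := by
  refine ⟨fun h => ?_, fun h => by rw [h, map_one]⟩
  ext p
  have := DFunLike.congr_fun h (p + m)
  simpa [permShift_apply] using this

theorem permShift_swap (m k : ℕ) : permShift m (swap k (k + 1)) = swap (k + m) (k + m + 1) := by
  ext p
  simp only [permShift_apply, swap_apply_def]
  grind

theorem permShift_mem_permBelow (m J : ℕ) (σ : Perm ℕ) :
    permShift m σ ∈ permBelow (J + m) ↔ σ ∈ permBelow J := by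
  simp only [mem_permBelow, permShift_apply]
  constructor
  · intro h p hp
    have := h (p + m) (by omega)
    simpa using this
  · intro h p hp
    rw [if_neg (by omega), h _ (by omega)]
    omega

/-- The inverse of `1^m × y` ascends at every `k < m`, so the factor does not change the value
there. -/
theorem hecke_shift_of_lt {m k : ℕ} (hk : k < m) (t : R) (f : Perm ℕ → R) :
    (fun y => hecke k t f (permShift m y)) = fun y => f (permShift m y) := by
  ext y
  rw [hecke_apply, if_pos]
  simp only [permShift_inv_apply]
  split_ifs <;> omega

theorem hecke_shift (m k : ℕ) (t : R) (f : Perm ℕ → R) :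
    (fun y => hecke (m + k) t f (permShift m y)) =
      hecke k t fun y => f (permShift m y) := by
  ext y
  have h1 : ¬ m + k < m := by omega
  have h2 : ¬ m + k + 1 < m := by omega
  have h3 : m + k + 1 - m = k + 1 := by omega
  simp only [hecke_apply, permShift_inv_apply, map_mul, permShift_swap, h1, h2, if_false, h3,
    Nat.add_sub_cancel_left, Nat.add_lt_add_iff_right]
  rw [Nat.add_comm m k]

theorem heckeRow_shift (m N : ℕ) (τ : ℕ → R) (f : Perm ℕ → R) :
    (fun y => heckeRow 0 (m + N) τ f (permShift m y)) =
      heckeRow 0 N (fun k => τ (m + k)) fun y => f (permShift m y) := by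
  induction N generalizing f with
  | zero =>
    have : ∀ K ≤ m, ∀ f : Perm ℕ → R, (fun y => heckeRow 0 K τ f (permShift m y)) =
        fun y => f (permShift m y) := by
      intro K
      induction K with
      | zero => intro _ f; rfl
      | succ K ih =>
        intro hK f
        simp only [heckeRow, Module.End.mul_apply]
        rw [ih (by omega), hecke_shift_of_lt (by omega)]
    rw [add_zero, this m le_rfl]
    rfl
  | succ N ih =>
    simp only [← add_assoc, heckeRow_succ, Module.End.mul_apply]
    rw [ih, zero_add, zero_add, hecke_shift]

/-- On the permutations `1^m × y` each of the first `N` rows loses its first `m` factors, and the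
last `m` rows, whose indices are all below `m`, disappear. -/
theorem heckeTrap_shift (m N : ℕ) (τ : ℕ → ℕ → R) (f : Perm ℕ → R) :
    (fun y => heckeTrap (N + m) 0 τ f (permShift m y)) =
      heckeTrap N 0 (fun l k => τ l (m + k)) fun y => f (permShift m y) := by
  induction N generalizing τ with
  | zero =>
    ext y
    refine heckeMon_mul_apply (heckeTrap_mem _ _ _) f ?_
    intro k hk
    simp only [Set.mem_ofPred_eq] at hk
    simp only [permShift_inv_apply]
    split_ifs <;> omega
  | succ N ih =>
    rw [show N + 1 + m = N + m + 1 by omega]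
    simp only [heckeTrap, Module.End.mul_apply, add_zero]
    rw [Nat.add_comm N m, heckeRow_shift, Nat.add_comm m N, ih]

end Products

section Lead

open Equiv

variable {R : Type*} [CommRing R]

/-! ### Leading coefficients -/

/-- The number of inversions `p < q < N` of `w` with `M ≤ q`. -/
def invFrom (M N : ℕ) (w : Perm ℕ) : ℕ :=
  ((Finset.range N ×ˢ Finset.range N).filter fun p => p.1 < p.2 ∧ M ≤ p.2 ∧ w p.2 < w p.1).card

/-- Exchanging the values `k` and `k + 1` can destroy only the inversion formed by these two values.
-/
theorem mem_inv_swap (k : ℕ) (w : Perm ℕ) {p q : ℕ} (hpq : p ≠ q) (h : w q < w p)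
    (hne : ¬ (w p = k + 1 ∧ w q = k)) :
    (swap k (k + 1) * w) q < (swap k (k + 1) * w) p := by
  have := w.injective.ne hpq
  simp only [Perm.mul_apply, swap_apply_def]
  grind

theorem invFrom_le_swap_succ (M N k : ℕ) (w : Perm ℕ) :
    invFrom M N w ≤ invFrom M N (swap k (k + 1) * w) + 1 := by
  unfold invFrom
  refine (Finset.card_le_card (t := insert (w⁻¹ (k + 1), w⁻¹ k) _) ?_).trans
    (Finset.card_insert_le _ _)
  rintro ⟨p, q⟩ h
  simp only [Finset.mem_filter, Finset.mem_insert, Prod.mk.injEq] at h ⊢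
  by_cases hne : w p = k + 1 ∧ w q = k
  · left
    rw [← hne.1, ← hne.2]
    simp
  · exact Or.inr ⟨h.1, h.2.1, h.2.2.1, mem_inv_swap k w (by omega) h.2.2.2 hne⟩

theorem invFrom_le_swap (M N k : ℕ) (w : Perm ℕ) (hw : w⁻¹ k < w⁻¹ (k + 1)) :
    invFrom M N w ≤ invFrom M N (swap k (k + 1) * w) := by
  unfold invFrom
  refine Finset.card_le_card ?_
  rintro ⟨p, q⟩ h
  simp only [Finset.mem_filter] at h ⊢
  refine ⟨h.1, h.2.1, h.2.2.1, mem_inv_swap k w (by omega) h.2.2.2 ?_⟩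
  rintro ⟨h1, h2⟩
  rw [← h1, ← h2] at hw
  simp at hw
  omega

/-- On the permutations with the largest possible value of `φ`, the operator `X` acts as
left translation by `x`, with the factor `c`. -/
def HasLead (φ : Perm ℕ → ℕ) (X : Module.End R (Perm ℕ → R)) (d : ℕ) (x : Perm ℕ) (c : R) : Prop :=
  (∀ w, φ w ≤ φ (x⁻¹ * w) + d) ∧ ∀ D f, (∀ w, D < φ w → f w = 0) →
    ∀ w, D + d ≤ φ w → X f w = c * f (x⁻¹ * w)

theorem HasLead.one (φ : Perm ℕ → ℕ) : HasLead φ (1 : Module.End R (Perm ℕ → R)) 0 1 1 :=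
  ⟨fun w => by simp, fun D f _ w _ => by simp⟩

/-- Leading terms multiply as for a filtered algebra: `Y` raises the bound on the support by at most
`d'`, so `X` sees only the top layer of `Y f`. -/
theorem HasLead.mul {φ : Perm ℕ → ℕ} {X Y : Module.End R (Perm ℕ → R)} {d d' : ℕ}
    {x y : Perm ℕ} {c c' : R} (hX : HasLead φ X d x c) (hY : HasLead φ Y d' y c') :
    HasLead φ (X * Y) (d + d') (x * y) (c * c') := by
  refine ⟨fun w => ?_, fun D f hf w hw => ?_⟩
  · have h1 := hX.1 w
    have h2 := hY.1 (x⁻¹ * w)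
    rw [mul_inv_rev, mul_assoc]
    omega
  · have h1 := hX.1 w
    rw [Module.End.mul_apply, hX.2 (D + d') (Y f) _ w (by omega), hY.2 D f hf _ (by omega),
      mul_inv_rev, mul_assoc, mul_assoc]
    intro v hv
    have h2 := hY.1 v
    rw [hY.2 D f hf v (by omega), hf _ (by omega), mul_zero]

/-- Left multiplication by `s_k` adds at most one inversion. Above the bound `D` the term `t f(w)`
vanishes, and only `(1 - t) f(s_k w)` can survive. -/
theorem HasLead.hecke (M N k : ℕ) (t : R) :
    HasLead (invFrom M N) (hecke k t) 1 (swap k (k + 1)) (1 - t) := by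
  refine ⟨fun w => by simpa using invFrom_le_swap_succ M N k w, fun D f hf w hw => ?_⟩
  rw [hecke_apply, hf w (by omega), swap_inv]
  split_ifs with h
  · rw [hf _ (by have := invFrom_le_swap M N k w h; omega), mul_zero]
  · ring

theorem blockSwap_apply (c u v p : ℕ) : blockSwap c u v p = if c ≤ p ∧ p < c + u then p + v
    else if c + u ≤ p ∧ p < c + u + v then p - u else p := rfl

theorem blockSwap_inv (c u v : ℕ) : (blockSwap c u v)⁻¹ = blockSwap c v u := rfl

theorem HasLead.heckeRow (M N c K : ℕ) (τ : ℕ → R) :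
    HasLead (invFrom M N) (heckeRow c K τ) K (blockSwap c K 1)
      (∏ k ∈ Finset.range K, (1 - τ k)) := by
  induction K with
  | zero =>
    have h : blockSwap c 0 1 = 1 := by
      ext p; simp only [blockSwap_apply, Perm.one_apply]; grind
    rw [h]
    exact HasLead.one _
  | succ K ih =>
    have h : blockSwap c (K + 1) 1 = blockSwap c K 1 * swap (c + K) (c + K + 1) := by
      ext p; simp only [blockSwap_apply, Perm.mul_apply, swap_apply_def]; grind
    rw [h, Finset.prod_range_succ]
    exact ih.mul (HasLead.hecke M N _ _)

theorem HasLead.heckeRect (M N e K L : ℕ) (τ : ℕ → ℕ → R) :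
    HasLead (invFrom M N) (heckeRect e K L τ) (e * L) (blockSwap K L e)
      (∏ l ∈ Finset.range e, ∏ k ∈ Finset.range L, (1 - τ l (e - 1 - l + K + k))) := by
  induction e generalizing τ with
  | zero =>
    have h : blockSwap K L 0 = 1 := by
      ext p; simp only [blockSwap_apply, Perm.one_apply]; grind
    rw [h, zero_mul]
    exact HasLead.one _
  | succ e ih =>
    have h : blockSwap K L (e + 1) = blockSwap (e + K) L 1 * blockSwap K L e := by
      ext p; simp only [blockSwap_apply, Perm.mul_apply]; grind
    have := (HasLead.heckeRow M N (e + K) L fun k => τ 0 (e + K + k)).mul (ih fun l => τ (l + 1))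
    rw [h, Finset.prod_range_succ', Nat.succ_mul, Nat.add_comm (e * L)]
    refine (congrArg (HasLead _ _ _ _) ?_).mpr this
    rw [mul_comm]
    congr 1
    refine Finset.prod_congr rfl fun l hl => Finset.prod_congr rfl fun k _ => ?_
    rw [show e + 1 - 1 - (l + 1) = e - 1 - l by omega]

theorem longestPerm_apply (N p : ℕ) : longestPerm N p = if p < N then N - 1 - p else p := rfl

theorem longestPerm_inv (N : ℕ) : (longestPerm N)⁻¹ = longestPerm N := rfl

theorem longestPerm_mul_self (N : ℕ) : longestPerm N * longestPerm N = 1 := by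
  nth_rewrite 1 [← longestPerm_inv]
  exact inv_mul_cancel _

theorem longestPerm_mem (N : ℕ) : longestPerm N ∈ permBelow N := fun p hp => by
  rw [longestPerm_apply, if_neg (by omega)]

theorem HasLead.heckeTrap (M N e : ℕ) (τ : ℕ → ℕ → R) :
    HasLead (invFrom M N) (heckeTrap e 0 τ) (∑ l ∈ Finset.range e, l) (longestPerm e)
      (∏ l ∈ Finset.range e, ∏ k ∈ Finset.range (e - 1 - l), (1 - τ l k)) := by
  induction e generalizing τ with
  | zero =>
    have h : longestPerm 0 = 1 := by
      ext p; simp [longestPerm_apply]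
    rw [h]
    exact HasLead.one _
  | succ e ih =>
    have h : longestPerm (e + 1) = blockSwap 0 e 1 * longestPerm e := by
      ext p; simp only [blockSwap_apply, Perm.mul_apply, longestPerm_apply]; grind
    have := (HasLead.heckeRow M N 0 e (τ 0)).mul (ih fun l => τ (l + 1))
    rw [h, Finset.prod_range_succ', Finset.sum_range_succ, Nat.add_comm _ e]
    refine (congrArg (HasLead _ _ _ _) ?_).mpr this
    rw [mul_comm]
    congr 1
    refine Finset.prod_congr rfl fun l hl => ?_
    rw [show e + 1 - 1 - (l + 1) = e - 1 - l by omega]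

theorem invFrom_one (M N : ℕ) : invFrom M N 1 = 0 := by
  rw [invFrom, Finset.card_eq_zero, Finset.filter_eq_empty_iff]
  rintro ⟨p, q⟩ _
  simp only [Perm.one_apply]
  omega

theorem invFrom_longestPerm (N : ℕ) : invFrom 0 N (longestPerm N) = ∑ l ∈ Finset.range N, l := by
  rw [invFrom, Finset.card_filter, Finset.sum_product_right]
  refine Finset.sum_congr rfl fun q hq => ?_
  rw [← Finset.card_filter]
  have : (Finset.range N).filter (fun p => p < q ∧ 0 ≤ q ∧ longestPerm N q < longestPerm N p) =
      Finset.range q := by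
    ext p
    rw [Finset.mem_filter, Finset.mem_range, Finset.mem_range, longestPerm_apply,
      longestPerm_apply]
    rw [Finset.mem_range] at hq
    split_ifs <;> omega
  rw [this, Finset.card_range]

theorem deltaOne_one : deltaOne R 1 = 1 := by simp [deltaOne]

theorem deltaOne_of_ne {w : Perm ℕ} (hw : w ≠ 1) : deltaOne R w = 0 := by simp [deltaOne, hw]

/-- The triangle has exactly as many factors as the longest permutation has inversions, so its
coefficient there is the leading one, `∏ (1 - τ)`. -/
theorem fkProd_longestPerm (N : ℕ) (x b : ℕ → R) :
    fkProd N x b (deltaOne R) (longestPerm N) =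
      ∏ l ∈ Finset.range N, ∏ k ∈ Finset.range (N - 1 - l), (1 - b l * x (l + k + 1)) := by
  have h := (HasLead.heckeTrap 0 N N fun l k => b l * x (l + k + 1)).2 0 (deltaOne R)
    (fun w hw => deltaOne_of_ne (by rintro rfl; simp [invFrom_one] at hw))
    (longestPerm N) (by rw [invFrom_longestPerm, zero_add])
  rw [fkProd, h, inv_mul_cancel, deltaOne_one, mul_one]

/-! ### Naturality -/

variable {S : Type*} [CommRing S]

theorem map_heckeRow (φ : R →+* S) (c N : ℕ) (τ : ℕ → R) {f : Perm ℕ → R} {g : Perm ℕ → S}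
    (h : ∀ w, φ (f w) = g w) (w : Perm ℕ) :
    φ (heckeRow c N τ f w) = heckeRow c N (fun k => φ (τ k)) g w := by
  induction N generalizing f g w with
  | zero => exact h w
  | succ N ih =>
    simp only [heckeRow_succ, Module.End.mul_apply]
    refine ih (fun v => ?_) w
    simp only [hecke_apply]
    split_ifs <;> simp [h]

theorem map_heckeTrap (φ : R →+* S) (e M : ℕ) (τ : ℕ → ℕ → R) {f : Perm ℕ → R} {g : Perm ℕ → S}
    (h : ∀ w, φ (f w) = g w) (w : Perm ℕ) :
    φ (heckeTrap e M τ f w) = heckeTrap e M (fun l k => φ (τ l k)) g w := by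
  induction e generalizing τ w with
  | zero => exact h w
  | succ e ih =>
    simp only [heckeTrap, Module.End.mul_apply]
    exact map_heckeRow φ _ _ _ (fun v => ih _ v) w

theorem map_fkProd (φ : R →+* S) (N : ℕ) (x b : ℕ → R) {f : Perm ℕ → R} {g : Perm ℕ → S}
    (h : ∀ w, φ (f w) = g w) (w : Perm ℕ) :
    φ (fkProd N x b f w) = fkProd N (fun k => φ (x k)) (fun l => φ (b l)) g w := by
  rw [fkProd, map_heckeTrap φ _ _ _ h, fkProd]
  simp only [map_mul]

theorem map_deltaOne (φ : R →+* S) (w : Perm ℕ) : φ (deltaOne R w) = deltaOne S w := by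
  by_cases h : w = 1
  · subst h; simp [deltaOne_one]
  · simp [deltaOne_of_ne h]

/-! ### Comparison with the recursive definition -/

/-- The sequence `a_0⁻¹, …, a_{N-1}⁻¹, 1, 1, …`. -/
noncomputable def aSeq (N q : ℕ) : GRing (Fin N) (Fin N) :=
  if h : q < N then aInv ⟨q, h⟩ else 1

/-- The sequence `b_0, …, b_{N-1}, 1, 1, …`. -/
noncomputable def bSeq (N p : ℕ) : GRing (Fin N) (Fin N) :=
  if h : p < N then bVar ⟨p, h⟩ else 1

theorem eq_longestPerm_of_antitone {N : ℕ} {w : Perm ℕ} (hw : w ∈ permBelow N)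
    (h : ∀ i, i < N - 1 → w (i + 1) < w i) : w = longestPerm N := by
  have up : ∀ p, p < N → w p + p ≤ N - 1 := by
    intro p
    induction p with
    | zero => intro hp; have := permBelow_lt hw hp; omega
    | succ p ih => intro hp; have := ih (by omega); have := h p (by omega); omega
  have down : ∀ d, ∀ p, p + d + 1 = N → d ≤ w p := by
    intro d
    induction d with
    | zero => intros; omega
    | succ d ih =>
      intro p hp
      have := ih (p + 1) (by omega)
      have := h p (by omega)
      omega
  ext p
  rw [longestPerm_apply]
  split_ifs with hp
  · have := up p hp
    have := down (N - 1 - p) p (by omega)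
    omega
  · exact hw p (by omega)

theorem swap_mul_longestPerm {N i : ℕ} (hi : i + 1 < N) :
    longestPerm N * swap i (i + 1) = swap (N - 2 - i) (N - 2 - i + 1) * longestPerm N := by
  rw [Equiv.mul_swap_eq_swap_mul]
  congr 1
  rw [longestPerm_apply, longestPerm_apply, if_pos (by omega), if_pos (by omega), swap_comm]
  congr 1 <;> omega

theorem swapA_aSeq {N i j : ℕ} (hi : i < N) (hj : j < N) (q : ℕ) :
    swapA ⟨i, hi⟩ ⟨j, hj⟩ (aSeq N q) = aSeq N (swap i j q) := by
  unfold aSeq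
  by_cases hq : q < N
  · have hq' : swap i j q < N := by
      rw [swap_apply_def]; split_ifs <;> omega
    rw [dif_pos hq, dif_pos hq', swapA, aInv, MvPolynomial.rename_X, aInv, Sum.map_inl]
    congr 2
    ext
    simp only [swap_apply_def, Fin.ext_iff]
    split_ifs <;> rfl
  · rw [dif_neg hq, swap_apply_of_ne_of_ne (by omega) (by omega), dif_neg hq, map_one]

theorem swapA_bSeq {N : ℕ} (i j : Fin N) (p : ℕ) : swapA i j (bSeq N p) = bSeq N p := by
  unfold bSeq
  split_ifs
  · simp [swapA, bVar]
  · exact map_one _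

/-- The coefficients of `fkProd` obey the defining recursion, by the exchange relation in `x`, and
have the right value at the longest permutation. Inverting and conjugating by `w₀` turns right
multiplication by `s_i` into left multiplication by `s_{N-2-i}`, and for this reason the variables
`a` enter in reversed order. -/
theorem grothendieck_eq_fkProd (N : ℕ) (w : Perm ℕ) (hw : w ∈ permBelow N) :
    grothendieck N w = fkProd N (fun k => aSeq N (N - 1 - k)) (bSeq N) (deltaOne _)
      (longestPerm N * w⁻¹ * longestPerm N) := by
  fun_induction grothendieck N w with
  | case1 w h hi ih =>
    set i := Nat.find h with hidef
    have hasc : w i < w (i + 1) := (Nat.find_spec h).2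
    have hw' : w * swap i (i + 1) ∈ permBelow N := mul_mem hw (swap_mem_permBelow hi)
    set k := N - 2 - i with hk
    set z := longestPerm N * w⁻¹ * longestPerm N with hz
    have hv : longestPerm N * (w * swap i (i + 1))⁻¹ * longestPerm N = swap k (k + 1) * z := by
      rw [mul_inv_rev, swap_inv, ← mul_assoc, swap_mul_longestPerm hi]
      simp only [hz, mul_assoc, hk]
    have hzk : z⁻¹ k < z⁻¹ (k + 1) := by
      have e : z⁻¹ = longestPerm N * w * longestPerm N := by
        simp only [hz, mul_inv_rev, longestPerm_inv, inv_inv, mul_assoc]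
      have h1 : longestPerm N k = i + 1 := by rw [longestPerm_apply, if_pos (by omega)]; omega
      have h2 : longestPerm N (k + 1) = i := by rw [longestPerm_apply, if_pos (by omega)]; omega
      have h3 := permBelow_lt hw hi
      rw [e, Perm.mul_apply, Perm.mul_apply, Perm.mul_apply, Perm.mul_apply, h1, h2,
        longestPerm_apply, longestPerm_apply, if_pos (by omega), if_pos (by omega)]
      omega
    specialize ih hw'
    rw [hv] at ih
    rw [ih]
    set x : ℕ → GRing (Fin N) (Fin N) := fun k => aSeq N (N - 1 - k) with hx
    have hxk : x k = aInv ⟨i + 1, hi⟩ := by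
      simp only [hx, aSeq]
      rw [dif_pos (by omega)]
      congr 2; omega
    have hxk1 : x (k + 1) = aInv ⟨i, Nat.lt_of_succ_lt hi⟩ := by
      simp only [hx, aSeq]
      rw [dif_pos (by omega)]
      congr 2; omega
    have hsw : swapA ⟨i, Nat.lt_of_succ_lt hi⟩ ⟨i + 1, hi⟩
        (fkProd N x (bSeq N) (deltaOne _) (swap k (k + 1) * z)) =
        fkProd N (fun j => x (swap k (k + 1) j)) (bSeq N) (deltaOne _) (swap k (k + 1) * z) := by
      have := map_fkProd (swapA ⟨i, Nat.lt_of_succ_lt hi⟩ ⟨i + 1, hi⟩ :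
        GRing (Fin N) (Fin N) →ₐ[ℤ] GRing (Fin N) (Fin N)).toRingHom N x (bSeq N)
        (map_deltaOne _) (swap k (k + 1) * z)
      refine Eq.trans this ?_
      refine congrArg (fun X : Module.End (GRing (Fin N) (Fin N)) _ => X (deltaOne _) _)
        (fkProd_congr N (fun j _ hj => ?_) fun l _ => swapA_bSeq _ _ l)
      refine (swapA_aSeq _ _ _).trans ?_
      congr 1
      simp only [swap_apply_def]
      split_ifs <;> omega
    -- The exchange relation is evaluated at `s_k z`. Its inverse descends at `k`, so the
    -- coefficients at both `s_k z` and `z` appear.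
    have hrel := congrArg (fun X => X (deltaOne _) (swap k (k + 1) * z))
      (hecke₂_mul_fkProd (N := N) (k := k) (by omega) x (bSeq N))
    simp only [Module.End.mul_apply, hecke₂_apply, swap_mul_inv_left, swap_mul_inv_right,
      swap_mul_swap_cancel, LinearMap.smul_apply, Pi.smul_apply, smul_eq_mul] at hrel
    rw [if_neg (by omega), ← hsw, hxk, hxk1] at hrel
    have hspec := isobaric_spec (⟨i, Nat.lt_of_succ_lt hi⟩ : Fin N) ⟨i + 1, hi⟩
      (fkProd N x (bSeq N) (deltaOne _) (swap k (k + 1) * z))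
    have hne : (aInv ⟨i + 1, hi⟩ - aInv ⟨i, Nat.lt_of_succ_lt hi⟩ : GRing (Fin N) (Fin N)) ≠ 0 := by
      rw [sub_ne_zero, aInv, aInv]
      intro h
      simpa using MvPolynomial.X_injective h
    refine mul_left_cancel₀ hne (hspec.trans ?_)
    rw [← hrel]
    ring
  | case2 w h =>
    push Not at h
    have hwl : w = longestPerm N := eq_longestPerm_of_antitone hw fun i hi =>
      lt_of_le_of_ne (h i hi) (w.injective.ne (by omega))
    rw [hwl, longestPerm_inv, longestPerm_mul_self, one_mul, fkProd_longestPerm,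
      Finset.prod_range]
    refine Finset.prod_congr rfl fun p _ => ?_
    have h1 : ∀ q : Fin N, (if (p : ℕ) + (q : ℕ) + 1 < N then
        1 - bVar p * aInv q else (1 : GRing (Fin N) (Fin N))) =
        (fun q : ℕ => if q < N - 1 - p then 1 - bSeq N p * aSeq N q else 1) (q : ℕ) := by
      intro q
      have hq := q.2
      have hp := p.2
      simp only [aSeq, bSeq, hq, hp, dif_pos, Fin.eta]
      exact if_congr (by omega) rfl rfl
    rw [Finset.prod_congr rfl fun q _ => h1 q, ← Finset.prod_range
        (fun q : ℕ => if q < N - 1 - p then 1 - bSeq N p * aSeq N q else 1), Finset.prod_ite,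
      Finset.prod_const_one, mul_one]
    have h2 : (Finset.range N).filter (fun q => q < N - 1 - p) = Finset.range (N - 1 - p) := by
      ext q
      simp only [Finset.mem_filter, Finset.mem_range]
      omega
    rw [h2, ← Finset.prod_range_reflect]
    refine Finset.prod_congr rfl fun k hk => ?_
    rw [Finset.mem_range] at hk
    rw [show N - 1 - p - 1 - k = N - 1 - (p + k + 1) by omega]

end Lead

section Riffle

open Equiv

/-! ### Riffle permutations -/

/-- The product of the block transpositions of a row of a double sequence of ranks, where `s` and
`t` are two consecutive rows. -/
def rifflePerm (n : ℕ) (s t : ℕ → ℕ) : Perm ℕ :=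
  ((List.range n).map fun j =>
    blockSwap (s (j + 1)) (t (j + 1) - s (j + 1)) (s j - s (j + 1))).prod

theorem rifflePerm_succ (n : ℕ) (s t : ℕ → ℕ) : rifflePerm (n + 1) s t =
    rifflePerm n s t * blockSwap (s (n + 1)) (t (n + 1) - s (n + 1)) (s n - s (n + 1)) := by
  simp [rifflePerm, List.range_succ]

/-- Two consecutive rows of a double sequence of ranks. -/
structure IsRankRows (s t : ℕ → ℕ) : Prop where
  left : ∀ j, s (j + 1) ≤ s j
  left' : ∀ j, t (j + 1) ≤ t j
  right : ∀ j, s j ≤ t j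
  convex : ∀ j, s j + t (j + 1) ≤ t j + s (j + 1)

variable {s t : ℕ → ℕ}

theorem blockSwap_mem (c u v : ℕ) : blockSwap c u v ∈ permBelow (c + u + v) := fun p hp => by
  rw [blockSwap_apply, if_neg (by omega), if_neg (by omega)]

theorem IsRankRows.blockSwap_mem (h : IsRankRows s t) (j : ℕ) :
    blockSwap (s (j + 1)) (t (j + 1) - s (j + 1)) (s j - s (j + 1)) ∈ permBelow (t j) := by
  refine permBelow_mono ?_ (_root_.blockSwap_mem _ _ _)
  have := h.left j
  have := h.right (j + 1)
  have := h.convex j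
  omega

theorem IsRankRows.antitone (h : IsRankRows s t) : Antitone s := antitone_nat_of_succ_le h.left

theorem IsRankRows.antitone' (h : IsRankRows s t) : Antitone t := antitone_nat_of_succ_le h.left'

theorem rifflePerm_mem (h : IsRankRows s t) (n : ℕ) : rifflePerm n s t ∈ permBelow (t 0) := by
  induction n with
  | zero => exact one_mem _
  | succ n ih =>
    rw [rifflePerm_succ]
    exact mul_mem ih (permBelow_mono (h.antitone' (Nat.zero_le _)) (h.blockSwap_mem n))

theorem rifflePerm_of_lt (h : IsRankRows s t) {n p : ℕ} (hp : p < s n) :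
    rifflePerm n s t p = p := by
  induction n with
  | zero => rfl
  | succ n ih =>
    rw [rifflePerm_succ, Perm.mul_apply, blockSwap_apply, if_neg (by omega), if_neg (by omega),
      ih (hp.trans_le (h.left n))]

theorem rifflePerm_of_mid (h : IsRankRows s t) {n u : ℕ} (h1 : s n ≤ u) (h2 : u < t n) :
    rifflePerm n s t u + s n = u + s 0 := by
  induction n generalizing u with
  | zero => rfl
  | succ n ih =>
    have := h.left n
    have := h.right (n + 1)
    have := h.convex n
    rw [rifflePerm_succ, Perm.mul_apply, blockSwap_apply, if_pos (by omega)]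
    have := ih (u := u + (s n - s (n + 1))) (by omega) (by omega)
    omega

/-- The permutation unshuffles: the positions split into segments `[t_{l+1}, t_l)`, and the first
`s_l - s_{l+1}` entries of each segment are sent, in order, into `[0, s_0)`, the others to values
from `s_0` on. Convexity of the ranks makes the first part fit into the segment. -/
theorem rifflePerm_apply (h : IsRankRows s t) {n l i : ℕ} (hl : l < n)
    (hi : t (l + 1) + i < t l) :
    (i < s l - s (l + 1) → rifflePerm n s t (t (l + 1) + i) = s (l + 1) + i) ∧
    (s l - s (l + 1) ≤ i → rifflePerm n s t (t (l + 1) + i) + s l = t (l + 1) + i + s 0) := by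
  induction n with
  | zero => omega
  | succ n ih =>
    rw [rifflePerm_succ, Perm.mul_apply]
    rcases Nat.lt_succ_iff_lt_or_eq.1 hl with hl | rfl
    · rw [h.blockSwap_mem n _ ((h.antitone' hl).trans (by simp))]
      exact ih hl
    · have h1 := h.left l
      have h2 := h.right (l + 1)
      rw [blockSwap_apply, if_neg (by omega)]
      constructor
      · intro hi'
        rw [if_pos (by omega), rifflePerm_of_lt h (by omega)]
        omega
      · intro hi'
        rw [if_neg (by omega), rifflePerm_of_mid h (by omega) hi]

/-- Only the monotonicity is needed later. The first two clauses locate the preimages relative to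
the next block swap and carry the induction. -/
theorem rifflePerm_inv_lower (h : IsRankRows s t) (n : ℕ) :
    (∀ p < s n, (rifflePerm n s t)⁻¹ p = p) ∧
    (∀ p, s n ≤ p → p < s 0 → t n ≤ (rifflePerm n s t)⁻¹ p) ∧
    ∀ p q, p < q → q < s 0 → (rifflePerm n s t)⁻¹ p < (rifflePerm n s t)⁻¹ q := by
  induction n with
  | zero => exact ⟨fun p _ => rfl, fun p h1 h2 => by omega, fun p q h _ => h⟩
  | succ n ih =>
    obtain ⟨ih1, ih2, ih3⟩ := ih
    have h1 := h.left n
    have h2 := h.right (n + 1)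
    have h3 := h.convex n
    have h4 := h.left' n
    have h5 := h.antitone (Nat.zero_le n)
    simp only [rifflePerm_succ, mul_inv_rev, Perm.mul_apply, blockSwap_inv, blockSwap_apply]
    refine ⟨fun p hp => ?_, fun p hp hp' => ?_, fun p q hpq hq => ?_⟩
    · rw [ih1 p (by omega), if_neg (by omega), if_neg (by omega)]
    · by_cases hpn : p < s n
      · rw [ih1 p hpn, if_pos (by omega)]; omega
      · have := ih2 p (by omega) hp'
        rw [if_neg (by omega), if_neg (by omega)]; omega
    · have := ih3 p q hpq hq
      by_cases hpn : p < s n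
      · rw [ih1 p hpn] at *
        by_cases hqn : q < s n
        · rw [ih1 q hqn] at *
          split_ifs <;> omega
        · have := ih2 q (by omega) hq
          split_ifs <;> omega
      · have := ih2 p (by omega) (by omega)
        have := ih2 q (by omega) (by omega)
        split_ifs <;> omega

theorem rifflePerm_inv_upper (h : IsRankRows s t) (n : ℕ) :
    (∀ i < t n - s n, (rifflePerm n s t)⁻¹ (s 0 + i) = s n + i) ∧
    (∀ i, t n - s n ≤ i → s 0 + i < t 0 → t n ≤ (rifflePerm n s t)⁻¹ (s 0 + i)) ∧
    ∀ i j, i < j → s 0 + j < t 0 →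
      (rifflePerm n s t)⁻¹ (s 0 + i) < (rifflePerm n s t)⁻¹ (s 0 + j) := by
  induction n with
  | zero =>
    exact ⟨fun p _ => rfl, fun p h1 h2 => by omega, fun p q h _ => Nat.add_lt_add_left h _⟩
  | succ n ih =>
    obtain ⟨ih1, ih2, ih3⟩ := ih
    have h1 := h.left n
    have h2 := h.right (n + 1)
    have h3 := h.convex n
    have h4 := h.left' n
    have h5 := h.right n
    simp only [rifflePerm_succ, mul_inv_rev, Perm.mul_apply, blockSwap_inv, blockSwap_apply]
    refine ⟨fun p hp => ?_, fun p hp hp' => ?_, fun p q hpq hq => ?_⟩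
    · rw [ih1 p (by omega), if_neg (by omega), if_pos (by omega)]; omega
    · by_cases hpn : p < t n - s n
      · rw [ih1 p hpn, if_neg (by omega), if_neg (by omega)]; omega
      · have := ih2 p (by omega) hp'
        rw [if_neg (by omega), if_neg (by omega)]; omega
    · have := ih3 p q hpq hq
      by_cases hpn : p < t n - s n
      · rw [ih1 p hpn] at *
        by_cases hqn : q < t n - s n
        · rw [ih1 q hqn] at *
          split_ifs <;> omega
        · have := ih2 q (by omega) hq
          split_ifs <;> omega
      · have := ih2 p (by omega) (by omega)
        have := ih2 q (by omega) (by omega)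
        split_ifs <;> omega

/-! ### Recursion for the Zelevinsky permutation -/

/-- The rank conditions of the sequence without its first bundle. -/
def tailRank (r : ℕ → ℕ → ℕ) : ℕ → ℕ → ℕ := fun i j => r (i + 1) (j + 1)

theorem IsRankConditions.tail {n : ℕ} {r : ℕ → ℕ → ℕ} (hr : IsRankConditions (n + 1) r) :
    IsRankConditions n (tailRank r) where
  le_left i j h1 h2 := by
    have := hr.le_left (i + 1) (j + 1) (by omega) (by omega)
    rwa [show j + 1 - 1 = j - 1 + 1 by omega] at this
  le_right i j h1 h2 := hr.le_right (i + 1) (j + 1) (by omega) (by omega)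
  convex i j h1 h2 h3 := by
    have := hr.convex (i + 1) (j + 1) (by omega) (by omega) (by omega)
    rwa [show i + 1 - 1 = i - 1 + 1 by omega] at this

theorem IsRankConditions.mono {n : ℕ} {r : ℕ → ℕ → ℕ} (hr : IsRankConditions n r)
    {i i' j j' : ℕ} (hi : i' ≤ i) (hij : i ≤ j) (hj : j ≤ j') (hn : j' ≤ n) :
    r i' j' ≤ r i j := by
  have h1 : ∀ d, j + d ≤ n → r i' (j + d) ≤ r i' j := by
    intro d
    induction d with
    | zero => intro _; exact le_rfl
    | succ d ih =>
      intro hd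
      exact (hr.le_left i' (j + (d + 1)) (by omega) hd).trans (ih (by omega))
  have h2 : ∀ d, i' + d ≤ j → r i' j ≤ r (i' + d) j := by
    intro d
    induction d with
    | zero => intro _; exact le_rfl
    | succ d ih =>
      intro hd
      exact (ih (by omega)).trans (hr.le_right (i' + d) j (by omega) (by omega))
  have h3 := h1 (j' - j) (by omega)
  have h4 := h2 (i - i') (by omega)
  rw [show j + (j' - j) = j' by omega] at h3
  rw [show i' + (i - i') = i by omega] at h4
  exact h3.trans h4

/-- The first row of ranks, extended by zero. -/
def firstRow (n : ℕ) (r : ℕ → ℕ → ℕ) (j : ℕ) : ℕ := if j ≤ n then r 0 j else 0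

/-- The second row of ranks, extended by zero on the right. -/
def secondRow (n : ℕ) (r : ℕ → ℕ → ℕ) : ℕ → ℕ
  | 0 => r 0 0 + r 1 1
  | j + 1 => firstRow n (tailRank r) j

theorem IsRankConditions.isRankRows {n : ℕ} {r : ℕ → ℕ → ℕ} (hr : IsRankConditions (n + 1) r) :
    IsRankRows (firstRow (n + 1) r) (secondRow n r) where
  left j := by
    unfold firstRow
    split_ifs
    · exact hr.le_left 0 (j + 1) (by omega) (by omega)
    · omega
    · exact Nat.zero_le _
    · exact le_rfl
  left' j := by
    rcases j with - | j
    · simp [secondRow, firstRow, tailRank]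
    · simp only [secondRow, firstRow]
      split_ifs
      · exact hr.tail.le_left 0 (j + 1) (by omega) (by omega)
      · omega
      · exact Nat.zero_le _
      · exact le_rfl
  right j := by
    rcases j with - | j
    · simp [secondRow, firstRow]
    · simp only [secondRow, firstRow, tailRank]
      split_ifs
      · exact hr.le_right 0 (j + 1) (by omega) (by omega)
      · omega
      · omega
      · exact le_rfl
  convex j := by
    rcases j with - | j
    · simp only [secondRow, firstRow, tailRank, zero_add]
      split_ifs <;> omega
    · simp only [secondRow, firstRow, tailRank]
      by_cases h : j + 1 + 1 ≤ n + 1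
      · have := hr.convex 1 (j + 1) (by omega) (by omega) (by omega)
        simp only [Nat.sub_self] at this
        rw [if_pos (by omega), if_pos (by omega), if_pos (by omega), if_pos (by omega)]
        omega
      · by_cases h' : j ≤ n
        · have := hr.le_right 0 (j + 1) (by omega) (by omega)
          rw [if_pos (by omega), if_neg (by omega), if_pos (by omega), if_neg (by omega)]
          omega
        · rw [if_neg (by omega), if_neg (by omega), if_neg (by omega), if_neg (by omega)]

/-- The first factor in the recursion for the Zelevinsky permutation. -/
def headPerm (n : ℕ) (r : ℕ → ℕ → ℕ) : Perm ℕ :=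
  ((List.range n).map fun j => gridPerm r 0 (j + 1)).prod

theorem gridPerm_zero (r : ℕ → ℕ → ℕ) (j : ℕ) : gridPerm r 0 (j + 1) =
    blockSwap (r 0 (j + 1)) (r 1 (j + 1) - r 0 (j + 1)) (r 0 j - r 0 (j + 1)) := by
  unfold gridPerm
  rcases j with - | j <;> simp [extRank]

theorem headPerm_eq_rifflePerm (n : ℕ) (r : ℕ → ℕ → ℕ) :
    headPerm (n + 1) r = rifflePerm (n + 2) (firstRow (n + 1) r) (secondRow n r) := by
  -- Extending the rows by zero adds one block swap with an empty block. It is trivial, but makes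
  -- the segments cover all positions down to `0`.
  have h : blockSwap (firstRow (n + 1) r (n + 1 + 1)) (secondRow n r (n + 1 + 1) -
      firstRow (n + 1) r (n + 1 + 1))
      (firstRow (n + 1) r (n + 1) - firstRow (n + 1) r (n + 1 + 1)) = 1 := by
    ext p
    simp only [blockSwap_apply, firstRow, secondRow, Perm.one_apply]
    split_ifs <;> omega
  rw [rifflePerm_succ, h, mul_one, headPerm, rifflePerm]
  congr 1
  refine List.map_congr_left fun j hj => ?_
  rw [List.mem_range] at hj
  rw [gridPerm_zero]
  simp only [firstRow, secondRow, tailRank]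
  rw [if_pos (by omega), if_pos (by omega), if_pos (by omega), zero_add]

theorem headPerm_mem {n : ℕ} {r : ℕ → ℕ → ℕ} (hr : IsRankConditions (n + 1) r) :
    headPerm (n + 1) r ∈ permBelow (r 0 0 + r 1 1) := by
  rw [headPerm_eq_rifflePerm]
  exact rifflePerm_mem hr.isRankRows _

theorem extRank_tailRank (r : ℕ → ℕ → ℕ) (i j : ℕ) :
    extRank (tailRank r) i j = extRank r (i + 1) (j + 1) := by
  unfold extRank tailRank
  simp only [Nat.add_lt_add_iff_right]
  split_ifs
  · rfl
  · rw [← Finset.Ico_add_one_right_eq_Icc, ← Finset.Ico_add_one_right_eq_Icc,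
      Finset.sum_Ico_add' (fun k => r k k)]

theorem gridPerm_tailRank (r : ℕ → ℕ → ℕ) (i j : ℕ) :
    gridPerm (tailRank r) i (j + 1) = gridPerm r (i + 1) (j + 1 + 1) := by
  simp [gridPerm, extRank_tailRank]

/-- The sum `e_2 + ⋯ + e_{n+1}`. -/
def restDim (n : ℕ) (r : ℕ → ℕ → ℕ) : ℕ := ∑ k ∈ Finset.range n, r (k + 2) (k + 2)

theorem totalDim_succ (n : ℕ) (r : ℕ → ℕ → ℕ) :
    totalDim (n + 1) r = r 0 0 + totalDim n (tailRank r) := by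
  simp [totalDim, Fin.sum_univ_succ, tailRank]

theorem totalDim_tailRank (n : ℕ) (r : ℕ → ℕ → ℕ) :
    totalDim n (tailRank r) = r 1 1 + restDim n r := by
  rw [totalDim, Fin.sum_univ_succ, restDim, ← Fin.sum_univ_eq_sum_range fun k => r (k + 2) (k + 2)]
  simp [tailRank]

theorem gridPerm_one (r : ℕ → ℕ → ℕ) (i : ℕ) : gridPerm r (i + 1) 1 =
    blockSwap (r 1 1 + restDim i r) (r (i + 2) (i + 2)) (r 0 0) := by
  have h1 : extRank r (i + 1) 1 = r 1 1 + restDim i r := by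
    rw [extRank, if_neg (by omega), restDim]
    induction i with
    | zero => simp
    | succ i ih => rw [Finset.sum_Icc_succ_top (by omega), ih, Finset.sum_range_succ, add_assoc]
  have h2 : extRank r (i + 1 + 1) 1 = extRank r (i + 1) 1 + r (i + 2) (i + 2) := by
    rw [extRank, extRank, if_neg (by omega), if_neg (by omega), Finset.sum_Icc_succ_top (by omega)]
  have h3 : extRank r (i + 1) 0 = r 0 0 + extRank r (i + 1) 1 := by
    rw [extRank, extRank, if_neg (by omega), if_neg (by omega), ← Finset.Ico_add_one_right_eq_Icc,
      ← Finset.Ico_add_one_right_eq_Icc, Finset.sum_eq_sum_Ico_succ_bot (by omega)]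
  rw [gridPerm, Nat.sub_self, h2, h3, h1]
  congr 1 <;> omega

/-- In the column `j = 1` the ranks with `i ≥ 1` are plain sums of dimensions, so the block of size
`e_0` passes the blocks `e_2, e_3, …` one at a time. -/
theorem prod_gridPerm_one (n : ℕ) (r : ℕ → ℕ → ℕ) :
    ((List.range n).map fun i => gridPerm r (i + 1) 1).prod =
      blockSwap (r 1 1) (restDim n r) (r 0 0) := by
  induction n with
  | zero =>
    ext p
    simp only [restDim, List.range_zero, List.map_nil, List.prod_nil, blockSwap_apply,
      Finset.range_zero, Finset.sum_empty, Perm.one_apply]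
    split_ifs <;> omega
  | succ n ih =>
    have h : restDim (n + 1) r = restDim n r + r (n + 2) (n + 2) := by
      rw [restDim, Finset.sum_range_succ, restDim]
    rw [List.range_succ, List.map_append, List.prod_append, ih, List.map_singleton,
      List.prod_singleton, gridPerm_one, h]
    ext p
    simp only [blockSwap_apply, Perm.mul_apply]
    grind

theorem commute_of_mem_permBelow {d : ℕ} {σ τ : Perm ℕ} (hσ : σ ∈ permBelow d)
    (hτ : ∀ p < d, τ p = p) : Commute σ τ := by
  ext p
  rw [Perm.mul_apply, Perm.mul_apply]
  by_cases hp : p < d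
  · rw [hτ p hp, hτ _ (permBelow_lt hσ hp)]
  · have : d ≤ τ p := by
      by_contra h
      push Not at h
      exact hp (by rwa [τ.injective (hτ _ h)] at h)
    rw [hσ p (by omega), hσ _ this]

theorem prod_map_mul_of_commute {G : Type*} [Monoid G] (a c : ℕ → G) (n : ℕ)
    (h : ∀ i j, i < j → j < n → Commute (a j) (c i)) :
    ((List.range n).map fun j => a j * c j).prod =
      ((List.range n).map a).prod * ((List.range n).map c).prod := by
  induction n with
  | zero => simp
  | succ n ih =>
    have hc : Commute (a n) ((List.range n).map c).prod := by
      refine Commute.list_prod_right _ _ fun x hx => ?_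
      obtain ⟨i, hi, rfl⟩ := List.mem_map.1 hx
      exact h i n (List.mem_range.1 hi) (by omega)
    simp only [List.range_succ, List.map_append, List.prod_append, List.map_singleton,
      List.prod_singleton]
    rw [ih fun i j hi hj => h i j hi (by omega)]
    simp only [mul_assoc]
    rw [← mul_assoc (a n), hc.eq, mul_assoc]

/-- The first permutation moves only positions below `r_{1j}` and the second only positions from
`r_{1j}` on. -/
theorem gridPerm_comm {n : ℕ} {r : ℕ → ℕ → ℕ} (hr : IsRankConditions (n + 1) r) {i j k : ℕ}
    (hij : i < j) (hj : j < n + 1) :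
    Commute (gridPerm r 0 (j + 1)) (gridPerm r (k + 1) (i + 1)) := by
  refine commute_of_mem_permBelow (d := r 1 j) ?_ fun p hp => ?_
  · rw [gridPerm_zero]
    refine permBelow_mono ?_ (blockSwap_mem _ _ _)
    have h1 := hr.convex 1 j (by omega) (by omega) (by omega)
    have h2 := hr.le_left 0 (j + 1) (by omega) (by omega)
    have h3 := hr.le_right 0 (j + 1) (by omega) (by omega)
    simp only [Nat.sub_self, Nat.add_sub_cancel, zero_add] at h1 h2 h3
    omega
  · have : r 1 j ≤ extRank r (k + 1) (i + 1) := by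
      unfold extRank
      split_ifs with h
      · exact hr.mono (by omega) (by omega) (by omega) (by omega)
      · refine le_trans ?_ (Finset.single_le_sum (f := fun k => r k k) (fun _ _ => Nat.zero_le _)
          (Finset.mem_Icc.2 ⟨le_rfl, by omega⟩))
        exact hr.mono (by omega) le_rfl (by omega) (by omega)
    rw [gridPerm, blockSwap_apply, if_neg (by omega), if_neg (by omega)]

/-- The factors `W_{0j}` can all be moved to the front by `gridPerm_comm`. Of the rest, the column
`j = 1` is one block swap, and the columns `j ≥ 2` are the permutation of the tail. -/
theorem conjZelevinsky_succ {n : ℕ} {r : ℕ → ℕ → ℕ} (hr : IsRankConditions (n + 1) r) :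
    conjZelevinsky (n + 1) r = headPerm (n + 1) r *
      (blockSwap (r 1 1) (restDim n r) (r 0 0) * conjZelevinsky n (tailRank r)) := by
  have h : ∀ j, ((List.range (n + 1)).map fun i => gridPerm r i (j + 1)).prod =
      gridPerm r 0 (j + 1) * ((List.range n).map fun i => gridPerm r (i + 1) (j + 1)).prod := by
    intro j
    rw [List.range_succ_eq_map, List.map_cons, List.prod_cons, List.map_map]
    rfl
  rw [conjZelevinsky]
  simp only [h]
  rw [prod_map_mul_of_commute, headPerm]
  · congr 1
    rw [List.range_succ_eq_map, List.map_cons, List.prod_cons, List.map_map, prod_gridPerm_one,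
      conjZelevinsky]
    simp only [gridPerm_tailRank]
    rfl
  · intro i j hij hj
    refine Commute.list_prod_right _ _ fun x hx => ?_
    obtain ⟨k, hk, rfl⟩ := List.mem_map.1 hx
    exact gridPerm_comm hr hij hj

theorem conjZelevinsky_zero (r : ℕ → ℕ → ℕ) : conjZelevinsky 0 r = 1 := rfl

theorem conjZelevinsky_mem {n : ℕ} {r : ℕ → ℕ → ℕ} (hr : IsRankConditions n r) :
    conjZelevinsky n r ∈ permBelow (totalDim n r) := by
  induction n generalizing r with
  | zero => exact one_mem _
  | succ n ih =>
    rw [conjZelevinsky_succ hr, totalDim_succ, totalDim_tailRank]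
    refine mul_mem (permBelow_mono (by omega) (headPerm_mem hr))
      (mul_mem (permBelow_mono (by omega) (blockSwap_mem _ _ _))
        (permBelow_mono ?_ (ih hr.tail)))
    rw [totalDim_tailRank]
    omega

/-! ### Ascents of the Zelevinsky permutation -/

theorem headPerm_inv_lower {n : ℕ} {r : ℕ → ℕ → ℕ} (hr : IsRankConditions (n + 1) r) {p q : ℕ}
    (hpq : p < q) (hq : q < r 0 0) : (headPerm (n + 1) r)⁻¹ p < (headPerm (n + 1) r)⁻¹ q := by
  rw [headPerm_eq_rifflePerm]
  exact (rifflePerm_inv_lower hr.isRankRows _).2.2 p q hpq (by simpa [firstRow] using hq)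

theorem headPerm_inv_upper {n : ℕ} {r : ℕ → ℕ → ℕ} (hr : IsRankConditions (n + 1) r) {p q : ℕ}
    (hp : r 0 0 ≤ p) (hpq : p < q) (hq : q < r 0 0 + r 1 1) :
    (headPerm (n + 1) r)⁻¹ p < (headPerm (n + 1) r)⁻¹ q := by
  have h := (rifflePerm_inv_upper hr.isRankRows (n + 2)).2.2 (p - r 0 0) (q - r 0 0) (by omega)
    (by simp only [firstRow, secondRow, Nat.zero_le, if_true]; omega)
  have h0 : firstRow (n + 1) r 0 = r 0 0 := by simp [firstRow]
  rwa [h0, show r 0 0 + (p - r 0 0) = p by omega, show r 0 0 + (q - r 0 0) = q by omega,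
    ← headPerm_eq_rifflePerm] at h

/-- This makes the product of the last two factors in `conjZelevinsky_succ` the minimal
representative of its coset modulo permutations of the first `e_0 + e_1` values, as
`heckeMon_apply_coset` requires. -/
theorem strictMonoOn_tail_inv {n : ℕ} {r : ℕ → ℕ → ℕ} (hr : IsRankConditions (n + 1) r)
    (h : StrictMonoOn ((conjZelevinsky n (tailRank r))⁻¹ : Perm ℕ) (Set.Iio (r 1 1))) :
    StrictMonoOn ((blockSwap (r 1 1) (restDim n r) (r 0 0) *
      conjZelevinsky n (tailRank r))⁻¹ : Perm ℕ) (Set.Iio (r 0 0 + r 1 1)) := by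
  have hz := inv_mem (conjZelevinsky_mem hr.tail)
  rw [totalDim_tailRank] at hz
  have h1 : ∀ p < r 1 1, (blockSwap (r 1 1) (restDim n r) (r 0 0) *
      conjZelevinsky n (tailRank r))⁻¹ p = (conjZelevinsky n (tailRank r))⁻¹ p := by
    intro p hp
    rw [mul_inv_rev, Perm.mul_apply, blockSwap_inv, blockSwap_apply, if_neg (by omega),
      if_neg (by omega)]
  have h2 : ∀ p, r 1 1 ≤ p → p < r 0 0 + r 1 1 → (blockSwap (r 1 1) (restDim n r) (r 0 0) *
      conjZelevinsky n (tailRank r))⁻¹ p = p + restDim n r := by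
    intro p hp hp'
    rw [mul_inv_rev, Perm.mul_apply, blockSwap_inv, blockSwap_apply, if_pos (by omega),
      hz _ (by omega)]
  intro p hp q hq hpq
  simp only [Set.mem_Iio] at hp hq
  by_cases hq1 : q < r 1 1
  · rw [h1 p (by omega), h1 q hq1]
    exact h (by simp only [Set.mem_Iio]; omega) hq1 hpq
  · rw [h2 q (by omega) hq]
    by_cases hp1 : p < r 1 1
    · rw [h1 p hp1]
      have := permBelow_lt hz (p := p) (by omega)
      omega
    · rw [h2 p (by omega) hp]
      omega

theorem conjZelevinsky_inv_first {n : ℕ} {r : ℕ → ℕ → ℕ} (hr : IsRankConditions n r) :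
    StrictMonoOn ((conjZelevinsky n r)⁻¹ : Perm ℕ) (Set.Iio (r 0 0)) := by
  induction n generalizing r with
  | zero => intro p _ q _ h; exact h
  | succ n ih =>
    intro p hp q hq hpq
    simp only [Set.mem_Iio] at hp hq
    rw [conjZelevinsky_succ hr, mul_inv_rev, Perm.mul_apply, Perm.mul_apply]
    have hmem := inv_mem (headPerm_mem hr)
    exact strictMonoOn_tail_inv hr (ih hr.tail) (permBelow_lt hmem (by omega))
      (permBelow_lt hmem (by omega)) (headPerm_inv_lower hr hpq hq)

/-- The sum `e_0 + ⋯ + e_{l-1}`. -/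
def startDim (r : ℕ → ℕ → ℕ) (l : ℕ) : ℕ := ∑ i ∈ Finset.range l, r i i

theorem startDim_zero (r : ℕ → ℕ → ℕ) : startDim r 0 = 0 := rfl

theorem startDim_succ (r : ℕ → ℕ → ℕ) (l : ℕ) :
    startDim r (l + 1) = startDim r l + r l l := Finset.sum_range_succ _ _

theorem startDim_succ' (r : ℕ → ℕ → ℕ) (l : ℕ) :
    startDim r (l + 1) = r 0 0 + startDim (tailRank r) l := by
  rw [startDim, Finset.sum_range_succ', add_comm]
  rfl

theorem startDim_le_totalDim (r : ℕ → ℕ → ℕ) {n l : ℕ} (hl : l ≤ n + 1) :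
    startDim r l ≤ totalDim n r := by
  rw [totalDim, Fin.sum_univ_eq_sum_range (fun i => r i i), startDim]
  exact Finset.sum_le_sum_of_subset (Finset.range_mono hl)

/-- These ascents of `z(r)⁻¹` give the symmetry in the variables `x` of each block. -/
theorem conjZelevinsky_inv_ascent {n : ℕ} {r : ℕ → ℕ → ℕ} (hr : IsRankConditions n r) {l k : ℕ}
    (hl : l ≤ n) (h1 : startDim r l ≤ k) (h2 : k + 1 < startDim r (l + 1)) :
    (conjZelevinsky n r)⁻¹ k < (conjZelevinsky n r)⁻¹ (k + 1) := by
  induction n generalizing r l k with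
  | zero => exact Nat.lt_succ_self k
  | succ n ih =>
    have hmem := inv_mem (headPerm_mem hr)
    have hmono := strictMonoOn_tail_inv hr (conjZelevinsky_inv_first hr.tail)
    rcases l with - | l
    · rw [startDim_succ, startDim_zero, zero_add] at h2
      exact conjZelevinsky_inv_first hr (by simp only [Set.mem_Iio]; omega)
        (by simp only [Set.mem_Iio]; omega) (Nat.lt_succ_self k)
    · rw [startDim_succ'] at h1 h2
      rw [conjZelevinsky_succ hr, mul_inv_rev, Perm.mul_apply, Perm.mul_apply]
      rcases l with - | l
      · rw [startDim_zero] at h1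
        rw [startDim_succ', startDim_zero] at h2
        simp only [tailRank, zero_add, add_zero] at h2
        exact hmono (permBelow_lt hmem (by omega)) (permBelow_lt hmem (by omega))
          (headPerm_inv_upper hr (by omega) (Nat.lt_succ_self k) (by omega))
      · have h3 : r 1 1 ≤ startDim (tailRank r) (l + 1) := by
          rw [startDim_succ']
          exact Nat.le_add_right _ _
        have h4 := startDim_le_totalDim (tailRank r) (n := n) (l := l + 1 + 1) (by omega)
        rw [totalDim_tailRank] at h4
        rw [hmem k (by omega), hmem (k + 1) (by omega), mul_inv_rev, Perm.mul_apply,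
          Perm.mul_apply, blockSwap_inv, blockSwap_apply, blockSwap_apply, if_neg (by omega),
          if_pos (by omega), if_neg (by omega), if_pos (by omega),
          show k + 1 - r 0 0 = k - r 0 0 + 1 by omega]
        exact ih hr.tail (l := l + 1) (by omega) (by omega) (by omega)

/-- The last clause, that `z(r)` increases on each block of positions (the blocks come in the order
`n, …, 0`), gives the symmetry in `b`. The first two clauses say which part of a block lands among
the first `e_0` values; the next head permutation acts on that information, so the induction needs
them. -/
theorem conjZelevinsky_block {n : ℕ} {r : ℕ → ℕ → ℕ} (hr : IsRankConditions n r) {l i : ℕ}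
    (hl : l ≤ n) (hi : i < r l l) :
    (i < firstRow n r l - firstRow n r (l + 1) → conjZelevinsky n r
      (totalDim n r - startDim r (l + 1) + i) = firstRow n r (l + 1) + i) ∧
    (firstRow n r l - firstRow n r (l + 1) ≤ i → r 0 0 ≤ conjZelevinsky n r
      (totalDim n r - startDim r (l + 1) + i)) ∧
    ∀ j < i, conjZelevinsky n r (totalDim n r - startDim r (l + 1) + j) <
      conjZelevinsky n r (totalDim n r - startDim r (l + 1) + i) := by
  induction n generalizing r l i with
  | zero =>
    obtain rfl : l = 0 := by omega
    have h : totalDim 0 r - startDim r (0 + 1) = 0 := by simp [totalDim, startDim]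
    rw [h]
    simp only [firstRow, conjZelevinsky_zero, Perm.one_apply]
    simp only [le_refl, if_true, zero_add, Nat.le_zero]
    refine ⟨fun _ => by simp, fun h => ?_, fun j hj => hj⟩
    simp at h
    omega
  | succ n ih =>
    have hrows := hr.isRankRows
    rw [conjZelevinsky_succ hr, headPerm_eq_rifflePerm]
    have hf0 : firstRow (n + 1) r 0 = r 0 0 := by simp [firstRow]
    have hs0 : secondRow n r 0 = r 0 0 + r 1 1 := rfl
    have hs1 : secondRow n r 1 = r 1 1 := by simp [secondRow, firstRow, tailRank]
    have hz := conjZelevinsky_mem hr.tail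
    simp only [Perm.mul_apply]
    rcases l with - | l
    · have hst : totalDim (n + 1) r - startDim r (0 + 1) = r 1 1 + restDim n r := by
        rw [totalDim_succ, startDim_succ', startDim_zero, totalDim_tailRank]
        omega
      rw [hst]
      have hz' : ∀ j < r 0 0, blockSwap (r 1 1) (restDim n r) (r 0 0)
          (conjZelevinsky n (tailRank r) (r 1 1 + restDim n r + j)) = r 1 1 + j := by
        intro j hj
        rw [hz _ (by rw [totalDim_tailRank]; omega), blockSwap_apply, if_neg (by omega),
          if_pos (by omega)]
        omega
      have hap := fun j (hj : j < r 0 0) => rifflePerm_apply hrows (n := n + 2) (l := 0) (i := j)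
        (by omega) (by rw [zero_add, hs0, hs1]; omega)
      simp only [zero_add, hs1, hf0] at hap ⊢
      have h1 := hrows.right 1
      have h2 := hrows.left 0
      rw [hs1] at h1
      simp only [zero_add, hf0] at h2
      refine ⟨fun h => ?_, fun h => ?_, fun j hj => ?_⟩
      · rw [hz' i hi, (hap i hi).1 h]
      · rw [hz' i hi]
        have := (hap i hi).2 h
        omega
      · rw [hz' i hi, hz' j (by omega)]
        have h3 := hap i hi
        have h4 := hap j (by omega)
        omega
    · have hst : totalDim (n + 1) r - startDim r (l + 1 + 1) =
          totalDim n (tailRank r) - startDim (tailRank r) (l + 1) := by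
        rw [totalDim_succ, startDim_succ']
        omega
      rw [hst]
      set P := totalDim n (tailRank r) - startDim (tailRank r) (l + 1) with hP
      have hle := startDim_le_totalDim (tailRank r) (n := n) (l := l + 1) (by omega)
      have hsd := startDim_succ (tailRank r) l
      have hPlt : ∀ j < r (l + 1) (l + 1), P + j < r 1 1 + restDim n r := by
        intro j hj
        rw [← totalDim_tailRank]
        simp only [tailRank] at hsd hle hP ⊢
        omega
      have hval : ∀ j < r (l + 1) (l + 1), conjZelevinsky n (tailRank r) (P + j) <
          r 1 1 + restDim n r := by
        intro j hj
        rw [← totalDim_tailRank]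
        exact permBelow_lt hz (by rw [totalDim_tailRank]; exact hPlt j hj)
      have hlow : ∀ u < r 1 1, blockSwap (r 1 1) (restDim n r) (r 0 0) u = u := by
        intro u hu
        rw [blockSwap_apply, if_neg (by omega), if_neg (by omega)]
      have hhigh : ∀ u, r 1 1 ≤ u → u < r 1 1 + restDim n r →
          rifflePerm (n + 2) (firstRow (n + 1) r) (secondRow n r)
            (blockSwap (r 1 1) (restDim n r) (r 0 0) u) = u + r 0 0 := by
        intro u hu hu'
        rw [blockSwap_apply, if_pos (by omega), rifflePerm_mem hrows _ _ (by rw [hs0]; omega)]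
      have hih := fun j (hj : j < r (l + 1) (l + 1)) => ih hr.tail (l := l) (i := j) (by omega) hj
      have hrow : ∀ j, firstRow n (tailRank r) j = secondRow n r (j + 1) := fun j => rfl
      have htr : tailRank r 0 0 = r 1 1 := rfl
      simp only [← hP, hrow, htr] at hih
      have hap := fun j (hj : secondRow n r (l + 1 + 1) + j < secondRow n r (l + 1)) =>
        rifflePerm_apply hrows (n := n + 2) (l := l + 1) (i := j) (by omega) hj
      rw [hf0] at hap
      have c1 := hrows.left' (l + 1)
      have c2 := hrows.left (l + 1)
      have c3 := hrows.right (l + 1)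
      have c4 := hrows.right (l + 1 + 1)
      have c5 := hrows.convex (l + 1)
      have c6 : secondRow n r (l + 1) ≤ r 1 1 := by
        rw [← hs1]; exact hrows.antitone' (by omega)
      have c7 : firstRow (n + 1) r (l + 1) ≤ r 0 0 := by
        rw [← hf0]; exact hrows.antitone (by omega)
      have key : ∀ j < r (l + 1) (l + 1),
          (j < secondRow n r (l + 1) - secondRow n r (l + 1 + 1) →
            rifflePerm (n + 2) (firstRow (n + 1) r) (secondRow n r)
              (blockSwap (r 1 1) (restDim n r) (r 0 0) (conjZelevinsky n (tailRank r) (P + j))) =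
            rifflePerm (n + 2) (firstRow (n + 1) r) (secondRow n r)
              (secondRow n r (l + 1 + 1) + j)) ∧
          (secondRow n r (l + 1) - secondRow n r (l + 1 + 1) ≤ j →
            r 1 1 ≤ conjZelevinsky n (tailRank r) (P + j) ∧
            rifflePerm (n + 2) (firstRow (n + 1) r) (secondRow n r)
              (blockSwap (r 1 1) (restDim n r) (r 0 0) (conjZelevinsky n (tailRank r) (P + j))) =
            conjZelevinsky n (tailRank r) (P + j) + r 0 0) := by
        intro j hj
        refine ⟨fun h => ?_, fun h => ?_⟩
        · rw [(hih j hj).1 h, hlow _ (by omega)]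
        · have := (hih j hj).2.1 h
          exact ⟨this, hhigh _ this (hval j hj)⟩
      refine ⟨fun h => ?_, fun h => ?_, fun j hj => ?_⟩
      · rw [(key i hi).1 (by omega), (hap i (by omega)).1 h]
      · by_cases h' : i < secondRow n r (l + 1) - secondRow n r (l + 1 + 1)
        · rw [(key i hi).1 h']
          have := (hap i (by omega)).2 h
          omega
        · rw [((key i hi).2 (by omega)).2]
          omega
      · have hj' : j < r (l + 1) (l + 1) := by omega
        by_cases h' : i < secondRow n r (l + 1) - secondRow n r (l + 1 + 1)
        · rw [(key i hi).1 h', (key j hj').1 (by omega)]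
          have a1 := hap i (by omega)
          have a2 := hap j (by omega)
          omega
        · obtain ⟨b1, b2⟩ := (key i hi).2 (by omega)
          rw [b2]
          by_cases h'' : j < secondRow n r (l + 1) - secondRow n r (l + 1 + 1)
          · rw [(key j hj').1 h'']
            have := permBelow_lt (rifflePerm_mem hrows (n + 2))
              (p := secondRow n r (l + 1 + 1) + j) (by rw [hs0]; omega)
            rw [hs0] at this
            omega
          · obtain ⟨b3, b4⟩ := (key j hj').2 (by omega)
            rw [b4]
            have := (hih i hi).2.2 j hj
            omega

end Riffle

section Ratio

open Equiv

variable {R : Type*} [CommRing R]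

/-! ### The recursion for the double quiver polynomial -/

/-- The concatenation of the blocks `x^0, …, x^n` of variables. -/
def flatten {A : Type*} : ℕ → (ℕ → ℕ → ℕ) → (ℕ → ℕ → A) → ℕ → A
  | 0, _, x, k => x 0 k
  | n + 1, r, x, k =>
    if k < r 0 0 then x 0 k else flatten n (tailRank r) (fun i => x (i + 1)) (k - r 0 0)

/-- The sequence with `y_0, …, y_{d-1}` in the positions `c, …, c + d - 1`, and `1` elsewhere. -/
def padded (c d : ℕ) (y : ℕ → R) (k : ℕ) : R := if c ≤ k ∧ k < c + d then y (k - c) else 1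

/-- The product of the factors `1 - b^i_p / a^j_q` with `i + 2 ≤ j`. -/
def homFactor : ℕ → (ℕ → ℕ → ℕ) → (ℕ → ℕ → R) → (ℕ → ℕ → R) → R
  | 0, _, _, _ => 1
  | n + 1, r, x, b =>
    (∏ l ∈ Finset.range (r 0 0), ∏ k ∈ Finset.range (restDim n r),
      (1 - b 0 l * flatten n (tailRank r) (fun i => x (i + 1)) (r 1 1 + k))) *
    homFactor n (tailRank r) (fun i => x (i + 1)) fun i => b (i + 1)

/-- The generating function, without the factors which do not contribute to the coefficient of the
Zelevinsky permutation. -/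
def coreProd : ℕ → (ℕ → ℕ → ℕ) → (ℕ → ℕ → R) → (ℕ → ℕ → R) → Module.End R (Perm ℕ → R)
  | 0, _, _, _ => 1
  | n + 1, r, x, b =>
    heckeTrap (r 0 0) (r 1 1) (fun l k => b 0 l * padded (r 0 0) (r 1 1) (x 1) (l + k + 1)) *
    (heckeRect (r 0 0) (r 1 1) (restDim n r)
      (fun l k => b 0 l * flatten (n + 1) r x (l + k + 1)) *
    (fkProd (r 1 1) (x 1) 1 *
      coreProd n (tailRank r) (fun i => x (i + 1)) fun i => b (i + 1)))

open Classical in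
/-- The value of this function at the identity is the double quiver polynomial of `r`. -/
noncomputable def quiverFun :
    ℕ → (ℕ → ℕ → ℕ) → (ℕ → ℕ → R) → (ℕ → ℕ → R) → Perm ℕ → R
  | 0, _, _, _, σ => deltaOne R σ
  | n + 1, r, x, b, σ =>
    fkProd (r 0 0 + r 1 1) (padded (r 0 0) (r 1 1) (x 1)) (padded 0 (r 0 0) (b 0))
      (fun y => if y ∈ permBelow (r 1 1) then
        quiverFun n (tailRank r) (fun i => x (i + 1)) (fun i => b (i + 1)) y else 0)
      (σ * headPerm (n + 1) r)

theorem fkProd_padded (c d : ℕ) (x b : ℕ → R) :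
    fkProd (c + d) (padded c d x) (padded 0 c b) =
      heckeTrap c d (fun l k => b l * padded c d x (l + k + 1)) * fkProd d x 1 := by
  rw [fkProd, heckeTrap_add]
  congr 1
  · refine heckeTrap_congr _ _ fun l k hl _ => ?_
    rw [padded, if_pos (by omega), Nat.sub_zero]
  · refine heckeTrap_congr _ _ fun l k _ hk => ?_
    rw [padded, padded, if_neg (by omega), if_pos (by omega), Pi.one_apply,
      show c + l + k + 1 - c = l + k + 1 by omega]

theorem flatten_of_lt {A : Type*} {n : ℕ} {r : ℕ → ℕ → ℕ} (x : ℕ → ℕ → A) {k : ℕ} (hk : k < r 0 0) :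
    flatten n r x k = x 0 k := by
  cases n with
  | zero => rfl
  | succ n => rw [flatten, if_pos hk]

theorem flatten_add {A : Type*} {n : ℕ} {r : ℕ → ℕ → ℕ} (x : ℕ → ℕ → A) (k : ℕ) :
    flatten (n + 1) r x (r 0 0 + k) = flatten n (tailRank r) (fun i => x (i + 1)) k := by
  rw [flatten, if_neg (by omega), Nat.add_sub_cancel_left]

/-- The first `e_0` rows are cut into the triangle of block `0`, the part over block `1`, and the
rectangle over the blocks `≥ 2`. The Cauchy identity splits off the `x^0`-part of the triangle; its
`b^0`-part rejoins the part over block `1` to form the trapezoid with padded variables. -/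
theorem fkProd_flatten_succ (n : ℕ) (r : ℕ → ℕ → ℕ) (x b : ℕ → ℕ → R) :
    fkProd (totalDim (n + 1) r) (flatten (n + 1) r x) (flatten (n + 1) r b) =
      fkProd (r 0 0) (x 0) 1 *
      (heckeTrap (r 0 0) (r 1 1) (fun l k => b 0 l * padded (r 0 0) (r 1 1) (x 1) (l + k + 1)) *
      (heckeRect (r 0 0) (r 1 1) (restDim n r)
        (fun l k => b 0 l * flatten (n + 1) r x (l + k + 1)) *
      fkProd (totalDim n (tailRank r)) (flatten n (tailRank r) fun i => x (i + 1))
        (flatten n (tailRank r) fun i => b (i + 1)))) := by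
  have h1 : fkProd (r 0 0) (x 0) (b 0) =
      heckeTrap (r 0 0) 0 fun l k => b 0 l * flatten (n + 1) r x (l + k + 1) :=
    heckeTrap_congr _ _ fun l k _ hk => by rw [flatten_of_lt x (by omega)]
  have h2 : fkProd (r 0 0) 1 (b 0) =
      heckeTrap (r 0 0) 0 fun l k => b 0 l * padded (r 0 0) (r 1 1) (x 1) (l + k + 1) :=
    heckeTrap_congr _ _ fun l k _ hk => by rw [padded, if_neg (by omega), Pi.one_apply]
  have h3 : heckeRect (r 0 0) 0 (r 1 1) (fun l k => b 0 l * flatten (n + 1) r x (l + k + 1)) =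
      heckeRect (r 0 0) 0 (r 1 1)
        fun l k => b 0 l * padded (r 0 0) (r 1 1) (x 1) (l + k + 1) :=
    heckeRect_congr _ _ _ fun l k _ hk hk' => by
      obtain ⟨i, hi⟩ : ∃ i, l + k + 1 = r 0 0 + i := ⟨l + k + 1 - r 0 0, by omega⟩
      rw [padded, if_pos (by omega), hi, flatten_add,
        flatten_of_lt (r := tailRank r) _ (by simp only [tailRank, zero_add]; omega),
        Nat.add_sub_cancel_left]
  have h4 := heckeTrap_split (r 0 0) 0 (r 1 1)
    fun l k => b 0 l * flatten (n + 1) r x (l + k + 1)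
  have h5 := heckeTrap_split (r 0 0) 0 (r 1 1)
    fun l k => b 0 l * padded (r 0 0) (r 1 1) (x 1) (l + k + 1)
  rw [← h1, fkProd_cauchy, zero_add, h3] at h4
  rw [← h2, zero_add] at h5
  rw [totalDim_succ, fkProd, heckeTrap_add, totalDim_tailRank,
    heckeTrap_congr (τ' := fun l k => b 0 l * flatten (n + 1) r x (l + k + 1)) _ _
      (fun l k hl _ => by rw [flatten_of_lt b hl]), heckeTrap_split, h4, h5]
  simp only [mul_assoc]
  congr 4
  refine heckeTrap_congr _ _ fun l k _ _ => ?_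
  rw [flatten_add, show r 0 0 + l + k + 1 = r 0 0 + (l + k + 1) by omega, flatten_add]

theorem fkProd_flatten (n : ℕ) (r : ℕ → ℕ → ℕ) (x b : ℕ → ℕ → R) :
    fkProd (totalDim n r) (flatten n r x) (flatten n r b) =
      fkProd (r 0 0) (x 0) 1 * coreProd n r x b * fkProd (r n n) 1 (b n) := by
  induction n generalizing r x b with
  | zero =>
    rw [show totalDim 0 r = r 0 0 by simp [totalDim], coreProd, mul_one]
    exact fkProd_cauchy _ _ _
  | succ n ih =>
    rw [fkProd_flatten_succ, ih, coreProd]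
    simp only [mul_assoc]
    rfl

theorem coreProd_mem (n : ℕ) (r : ℕ → ℕ → ℕ) (x b : ℕ → ℕ → R) :
    coreProd n r x b ∈ heckeMon R {k | k + 1 < totalDim n r} := by
  induction n generalizing r x b with
  | zero => exact one_mem _
  | succ n ih =>
    have h1 := totalDim_succ n r
    have h2 := totalDim_tailRank n r
    refine mul_mem (heckeMon_mono ?_ (heckeTrap_mem _ _ _))
      (mul_mem (heckeMon_mono ?_ (heckeRect_mem _ _ _ _))
        (mul_mem (heckeMon_mono ?_ (fkProd_mem _ _ _)) (heckeMon_mono ?_ (ih _ _ _)))) <;>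
    · intro k hk
      simp only [Set.mem_ofPred_eq] at hk ⊢
      omega

theorem invFrom_of_mem {M N : ℕ} {w : Perm ℕ} (hw : w ∈ permBelow M) : invFrom M N w = 0 := by
  rw [invFrom, Finset.card_eq_zero, Finset.filter_eq_empty_iff]
  rintro ⟨p, q⟩ _ ⟨h1, h2, h3⟩
  dsimp only at h1 h2 h3
  rw [hw q h2] at h3
  by_cases hp : p < M
  · have := permBelow_lt hw hp
    omega
  · rw [hw p (by omega)] at h3
    omega

/-- The `M` largest values must stand before position `d + M`, and each forms an inversion with each
of the last `e` positions. -/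
theorem le_invFrom {e d M : ℕ} {w : Perm ℕ} (hw : w ∈ permBelow (e + (d + M)))
    (h : ∀ p, d + M ≤ p → p < e + (d + M) → w p < e + d) :
    e * M ≤ invFrom (d + M) (e + (d + M)) w := by
  have hinv := inv_mem hw
  have h1 : ∀ v < M, w⁻¹ (e + d + v) < d + M := by
    intro v hv
    have h2 := permBelow_lt hinv (p := e + d + v) (by omega)
    by_contra h3
    have := h _ (not_lt.1 h3) h2
    simp at this
  calc e * M = (Finset.range e ×ˢ Finset.range M).card := by simp
    _ ≤ _ := by
      unfold invFrom
      refine Finset.card_le_card_of_injOn (fun p => (w⁻¹ (e + d + p.2), d + M + p.1)) ?_ ?_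
      · rintro ⟨q, v⟩ hqv
        simp only [Finset.coe_product, Finset.coe_range, Set.mem_prod, Set.mem_Iio] at hqv
        have h2 := h1 v hqv.2
        have h3 := h (d + M + q) (by omega) (by omega)
        simp only [Finset.coe_filter, Finset.mem_product, Finset.mem_range, Set.mem_ofPred_eq]
        refine ⟨⟨by omega, by omega⟩, by omega, by omega, ?_⟩
        rw [show w (w⁻¹ (e + d + v)) = e + d + v by simp]
        omega
      · rintro ⟨q, v⟩ _ ⟨q', v'⟩ _ heq
        simp only [Prod.mk.injEq] at heq
        have := w⁻¹.injective heq.1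
        ext <;> simp only <;> omega

theorem conj_blockSwap_mem {e d M : ℕ} {y : Perm ℕ} (hy : y ∈ permBelow (e + d))
    (h : (blockSwap d M e)⁻¹ * (y * blockSwap d M e) ∈ permBelow (d + M)) : y ∈ permBelow d := by
  intro p hp
  by_cases hp' : p < e + d
  · have h1 := h (p + M) (by omega)
    have h2 : blockSwap d M e (p + M) = p := by
      rw [blockSwap_apply, if_neg (by omega), if_pos (by omega)]; omega
    rw [Perm.mul_apply, Perm.mul_apply, h2, Perm.inv_eq_iff_eq, h2] at h1
    exact h1
  · exact hy p (by omega)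

/-- The heart of the double ratio formula. The rectangle can reach the block swap `V` only by its
leading term, which has coefficient `c`; the trapezoid and `A` then act inside a coset as the single
product `fkProd_padded`, which is the recursion step of `quiverFun`. -/
theorem coreProd_apply {n : ℕ} {r : ℕ → ℕ → ℕ} (hr : IsRankConditions n r) (x b : ℕ → ℕ → R)
    {σ : Perm ℕ} (hσ : σ ∈ permBelow (r 0 0)) :
    coreProd n r x b (deltaOne R) (σ * conjZelevinsky n r) =
      homFactor n r x b * quiverFun n r x b σ := by
  classical
  induction n generalizing r x b σ with
  | zero => simp [coreProd, homFactor, quiverFun, conjZelevinsky_zero]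
  | succ n ih =>
    set e := r 0 0
    set d := r 1 1
    set M := restDim n r
    set V := blockSwap d M e with hV
    set z := conjZelevinsky n (tailRank r) with hz
    set F := coreProd n (tailRank r) (fun i => x (i + 1)) (fun i => b (i + 1)) (deltaOne R) with hF
    set A := fkProd d (x 1) (1 : ℕ → R) with hA
    set c := ∏ l ∈ Finset.range e, ∏ k ∈ Finset.range M,
      (1 - b 0 l * flatten n (tailRank r) (fun i => x (i + 1)) (d + k)) with hc
    set h : Perm ℕ → R := fun y => if y ∈ permBelow d then F (y * z) else 0 with hh
    have hE : totalDim n (tailRank r) = d + M := totalDim_tailRank n r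
    have hzmem : z ∈ permBelow (d + M) := hE ▸ conjZelevinsky_mem hr.tail
    have hAmem : A ∈ heckeMon R {k | k + 1 < d} := fkProd_mem _ _ _
    have hsupp : ∀ w ∉ permBelow (d + M), (A * coreProd n (tailRank r) (fun i => x (i + 1))
        fun i => b (i + 1)) (deltaOne R) w = 0 := by
      refine heckeMon_support (mul_mem (heckeMon_mono ?_ hAmem) ?_) (deltaOne_support _)
      · intro k hk
        simp only [Set.mem_ofPred_eq] at hk ⊢
        omega
      · rw [← hE]
        exact coreProd_mem _ _ _ _
    -- Functions supported on permutations of the first `d + M` points have level `0` for `invFrom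
    -- (d + M)`, and the rectangle raises the level by at most `e * M`.
    have hlead := (HasLead.heckeRect (d + M) (e + (d + M)) e d M fun l k =>
      b 0 l * flatten (n + 1) r x (l + k + 1)).2 0 ((A * coreProd n (tailRank r)
        (fun i => x (i + 1)) fun i => b (i + 1)) (deltaOne R)) (fun w hw => hsupp w fun hw' => by
          rw [invFrom_of_mem hw'] at hw; omega)
    have hcoef : (∏ l ∈ Finset.range e, ∏ k ∈ Finset.range M,
        (1 - b 0 l * flatten (n + 1) r x (l + (e - 1 - l + d + k) + 1))) = c := by
      refine Finset.prod_congr rfl fun l hl => Finset.prod_congr rfl fun k _ => ?_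
      rw [Finset.mem_range] at hl
      rw [show l + (e - 1 - l + d + k) + 1 = e + (d + k) by omega, flatten_add]
    rw [hcoef, zero_add] at hlead
    have hrect : ∀ y ∈ permBelow (e + d), heckeRect e d M (fun l k =>
        b 0 l * flatten (n + 1) r x (l + k + 1)) ((A * coreProd n (tailRank r)
        (fun i => x (i + 1)) fun i => b (i + 1)) (deltaOne R)) (y * (V * z)) = (c • A h) y := by
      intro y hy
      have hw : y * (V * z) ∈ permBelow (e + (d + M)) :=
        mul_mem (permBelow_mono (by omega) hy) (mul_mem
          (permBelow_mono (by omega) (blockSwap_mem _ _ _)) (permBelow_mono (by omega) hzmem))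
      rw [hlead _ (le_invFrom hw ?_)]
      · rw [Pi.smul_apply, smul_eq_mul]
        congr 1
        -- If `y` permutes the first `d` points it commutes with `V`, which cancels. Otherwise `V⁻¹
        -- y V z` leaves the support and both sides vanish.
        by_cases hyd : y ∈ permBelow d
        · have hcomm : Commute y V := commute_of_mem_permBelow hyd fun p hp => by
            rw [hV, blockSwap_apply, if_neg (by omega), if_neg (by omega)]
          rw [← mul_assoc y, hcomm.eq, mul_assoc V, inv_mul_cancel_left, Module.End.mul_apply]
          refine heckeMon_apply_coset hAmem (conjZelevinsky_inv_first hr.tail) (fun y hy => ?_) y hyd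
          simp only [hh, hF, if_pos hy]
          rfl
        · rw [hsupp, heckeMon_support hAmem (f := h) (fun y hy => if_neg hy) y hyd]
          intro hmem
          refine hyd (conj_blockSwap_mem hy (M := M) ?_)
          have := mul_mem hmem (inv_mem hzmem)
          simpa only [hV, mul_assoc, mul_inv_cancel, mul_one] using this
      · intro p hp hp'
        rw [Perm.mul_apply, Perm.mul_apply, hzmem p hp, hV, blockSwap_apply, if_neg (by omega),
          if_pos (by omega)]
        exact permBelow_lt hy (by omega)
    have hmono := strictMonoOn_tail_inv hr (conjZelevinsky_inv_first hr.tail)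
    have hπ : σ * headPerm (n + 1) r ∈ permBelow (e + d) :=
      mul_mem (permBelow_mono (by omega) hσ) (headPerm_mem hr)
    have hmain := heckeMon_apply_coset (heckeTrap_mem e d fun l k =>
      b 0 l * padded e d (x 1) (l + k + 1)) hmono hrect _ hπ
    have hh' : h = homFactor n (tailRank r) (fun i => x (i + 1)) (fun i => b (i + 1)) • fun y =>
        if y ∈ permBelow d then quiverFun n (tailRank r) (fun i => x (i + 1))
          (fun i => b (i + 1)) y else 0 := by
      ext y
      simp only [hh, Pi.smul_apply, smul_eq_mul]
      split_ifs with hy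
      · exact ih hr.tail _ _ hy
      · rw [mul_zero]
    rw [conjZelevinsky_succ hr, ← mul_assoc, coreProd, Module.End.mul_apply, Module.End.mul_apply]
    refine hmain.trans ?_
    rw [map_smul, hh', map_smul, map_smul, ← Module.End.mul_apply, hA, ← fkProd_padded, homFactor,
      quiverFun]
    simp only [Pi.smul_apply, smul_eq_mul, mul_assoc]
    rfl

/-- The two outer factors of `fkProd_flatten` are invisible at `z(r)`, since `z(r)⁻¹` increases on
the first `e_0` values and `z(r)` on the first `e_n` positions. -/
theorem fkProd_flatten_apply {n : ℕ} {r : ℕ → ℕ → ℕ} (hr : IsRankConditions n r)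
    (x b : ℕ → ℕ → R) :
    fkProd (totalDim n r) (flatten n r x) (flatten n r b) (deltaOne R) (conjZelevinsky n r) =
      homFactor n r x b * quiverFun n r x b 1 := by
  have hz : ∀ k ∈ {k | k + 1 < r n n}, conjZelevinsky n r k < conjZelevinsky n r (k + 1) := by
    intro k hk
    have := (conjZelevinsky_block hr le_rfl hk).2.2 k (Nat.lt_succ_self k)
    have h0 : totalDim n r - startDim r (n + 1) = 0 := by
      rw [totalDim, Fin.sum_univ_eq_sum_range (fun i => r i i), startDim, Nat.sub_self]
    rwa [h0, zero_add, zero_add] at this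
  have hz' : ∀ k ∈ {k | k + 1 < r 0 0},
      (conjZelevinsky n r)⁻¹ k < (conjZelevinsky n r)⁻¹ (k + 1) := by
    intro k hk
    simp only [Set.mem_ofPred_eq] at hk
    exact conjZelevinsky_inv_first hr (by simp only [Set.mem_Iio]; omega) hk (Nat.lt_succ_self k)
  rw [fkProd_flatten, mul_heckeMon_deltaOne_apply (S := {k | k + 1 < r n n}) (T := Set.univ) _
    (fkProd_mem _ _ _) hz, Module.End.mul_apply, heckeMon_mul_apply (fkProd_mem _ _ _) _ hz']
  · have := coreProd_apply hr x b (one_mem _)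
    rwa [one_mul] at this
  · exact mul_mem (heckeMon_mono (Set.subset_univ _) (fkProd_mem _ _ _))
      (heckeMon_mono (Set.subset_univ _) (coreProd_mem _ _ _ _))

/-! ### Properties of the quiver function -/

/-- Every block swap in a head permutation has an empty block, so all of them are trivial. This is
the case of the maximal rank conditions, where a minimum over an interval is attained away from at
least one end. -/
theorem quiverFun_one {n : ℕ} {r : ℕ → ℕ → ℕ}
    (h : ∀ i j, i < j → j ≤ n → r i j = r (i + 1) j ∨ r i j = r i (j - 1)) (x b : ℕ → ℕ → R) :
    quiverFun n r x b 1 = 1 := by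
  induction n generalizing r x b with
  | zero => exact deltaOne_one
  | succ n ih =>
    have hπ : headPerm (n + 1) r = 1 := by
      refine List.prod_eq_one fun w hw => ?_
      obtain ⟨j, hj, rfl⟩ := List.mem_map.1 hw
      rw [List.mem_range] at hj
      rw [gridPerm_zero]
      ext p
      rw [blockSwap_apply, Perm.one_apply]
      have := h 0 (j + 1) (by omega) (by omega)
      simp only [zero_add, Nat.add_sub_cancel] at this
      split_ifs <;> omega
    rw [quiverFun, hπ, mul_one, heckeMon_mul_apply (fkProd_mem _ _ _) _
      (fun k _ => Nat.lt_succ_self k), if_pos (one_mem _)]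
    refine ih (fun i j hij hj => ?_) _ _
    have := h (i + 1) (j + 1) (by omega) (by omega)
    rwa [show j + 1 - 1 = j - 1 + 1 by omega] at this

variable {S : Type*} [CommRing S]

theorem map_quiverFun (φ : R →+* S) (n : ℕ) (r : ℕ → ℕ → ℕ) (x b : ℕ → ℕ → R) (σ : Perm ℕ) :
    φ (quiverFun n r x b σ) =
      quiverFun n r (fun i j => φ (x i j)) (fun i j => φ (b i j)) σ := by
  classical
  induction n generalizing r x b σ with
  | zero => exact map_deltaOne φ σ
  | succ n ih =>
    have hp : ∀ c d (y : ℕ → R), (fun k => φ (padded c d y k)) = padded c d fun j => φ (y j) := by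
      intro c d y
      ext k
      unfold padded
      split_ifs <;> simp
    simp only [quiverFun]
    rw [map_fkProd φ _ _ _ (g := fun y => if y ∈ permBelow (r 1 1) then quiverFun n (tailRank r)
      (fun i j => φ (x (i + 1) j)) (fun i j => φ (b (i + 1) j)) y else 0), hp, hp]
    intro w
    split_ifs
    · exact ih _ _ _ _
    · exact map_zero φ

theorem flatten_congr {A : Type*} {n : ℕ} {r : ℕ → ℕ → ℕ} {x y : ℕ → ℕ → A}
    (h : ∀ i ≤ n, ∀ j < r i i, x i j = y i j) {k : ℕ} (hk : k < totalDim n r) :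
    flatten n r x k = flatten n r y k := by
  induction n generalizing r x y k with
  | zero => exact h 0 le_rfl k (by simpa [totalDim] using hk)
  | succ n ih =>
    rw [totalDim_succ] at hk
    rw [flatten, flatten]
    split_ifs with h'
    · exact h 0 (by omega) k h'
    · exact ih (fun i hi j hj => h (i + 1) (by omega) j hj) (by omega)

theorem quiverFun_congr {n : ℕ} {r : ℕ → ℕ → ℕ} {x y b c : ℕ → ℕ → R}
    (hx : ∀ i ≤ n, ∀ j < r i i, x i j = y i j) (hb : ∀ i ≤ n, ∀ j < r i i, b i j = c i j)
    (σ : Perm ℕ) : quiverFun n r x b σ = quiverFun n r y c σ := by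
  induction n generalizing r x y b c σ with
  | zero => rfl
  | succ n ih =>
    have h1 : padded (r 0 0) (r 1 1) (x 1) = padded (r 0 0) (r 1 1) (y 1) := by
      ext k
      unfold padded
      split_ifs with h
      · exact hx 1 (by omega) _ (by omega)
      · rfl
    have h2 : padded 0 (r 0 0) (b 0) = padded 0 (r 0 0) (c 0) := by
      ext k
      unfold padded
      split_ifs with h
      · exact hb 0 (by omega) _ (by omega)
      · rfl
    have h3 : quiverFun n (tailRank r) (fun i => x (i + 1)) (fun i => b (i + 1)) =
        quiverFun n (tailRank r) (fun i => y (i + 1)) (fun i => c (i + 1)) := by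
      ext τ
      exact ih (fun i hi j hj => hx (i + 1) (by omega) j hj)
        (fun i hi j hj => hb (i + 1) (by omega) j hj) τ
    simp only [quiverFun, h1, h2, h3]

/-! ### Rank stability of the quiver function -/

theorem permShift_blockSwap (m c u v : ℕ) :
    permShift m (blockSwap c u v) = blockSwap (c + m) u v := by
  ext p
  simp only [permShift_apply, blockSwap_apply]
  grind

theorem headPerm_addRank (n : ℕ) (r : ℕ → ℕ → ℕ) (m : ℕ) :
    headPerm n (addRank r m) = permShift m (headPerm n r) := by
  rw [headPerm, headPerm, map_list_prod, List.map_map]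
  congr 1
  refine List.map_congr_left fun j _ => ?_
  simp only [Function.comp_apply, gridPerm_zero, permShift_blockSwap, addRank,
    Nat.add_sub_add_right]

/-- The Cauchy identity allows the variables to be treated separately. In the `x`-part the shift
removes `m` leading positions and the trailing ones drop out; in the `b`-part the `m` leading rows
have parameter `1` and are trivial. -/
theorem fkProd_padded_shift (c d m : ℕ) {x y b b' : ℕ → R} (hx : ∀ j < d, y j = x j)
    (hx' : ∀ j, d ≤ j → y j = 1) (hb : ∀ j < m, b' j = 1) (hb' : ∀ j, b' (m + j) = b j)
    (f : Perm ℕ → R) :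
    (fun w => fkProd (c + m + (d + m)) (padded (c + m) (d + m) y) (padded 0 (c + m) b') f
      (permShift m w)) =
    fkProd (c + d) (padded c d x) (padded 0 c b) fun w => f (permShift m w) := by
  have h1 : ∀ f : Perm ℕ → R, (fun w => fkProd (c + m + (d + m)) (padded (c + m) (d + m) y) 1 f
      (permShift m w)) = fkProd (c + d) (padded c d x) 1 fun w => f (permShift m w) := by
    intro f
    rw [← fkProd_one_add (c + d) m (x := padded c d x) (fun k hk => by
      rw [padded, if_neg (by omega)]), fkProd, show c + m + (d + m) = c + d + m + m by omega,
      heckeTrap_shift]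
    refine congrArg (fun X : Module.End R _ => X _) (heckeTrap_congr _ _ fun l k _ hk => ?_)
    simp only [Pi.one_apply, one_mul, padded]
    by_cases h : l + k + 1 < c
    · rw [if_neg (by omega), if_neg (by omega)]
    · by_cases h' : l + k + 1 < c + d
      · rw [if_pos (by omega), if_pos (by omega), hx _ (by omega)]
        congr 1
        omega
      · rw [if_neg (c := c ≤ l + k + 1 ∧ _) (by omega), if_pos (by omega), hx' _ (by omega)]
  have h2 : (fun w => fkProd (c + m + (d + m)) 1 (padded 0 (c + m) b') f (permShift m w)) =
      fkProd (c + d) 1 (padded 0 c b) fun w => f (permShift m w) := by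
    rw [fkProd, show c + m + (d + m) = m + (c + d + m) by omega, heckeTrap_add,
      heckeTrap_eq_one m _ (fun l k hl _ => by
        rw [padded, if_pos (by omega), Nat.sub_zero, hb l hl, Pi.one_apply, one_mul]), one_mul,
      heckeTrap_shift]
    refine congrArg (fun X : Module.End R _ => X _) (heckeTrap_congr _ _ fun l k _ hk => ?_)
    simp only [Pi.one_apply, mul_one, padded, Nat.sub_zero, hb']
    exact if_congr (by omega) rfl rfl
  rw [fkProd_cauchy, fkProd_cauchy (c + d)]
  simp only [Module.End.mul_apply]
  rw [h1, h2]

theorem quiverFun_addRank (n : ℕ) (r : ℕ → ℕ → ℕ) (m : ℕ) {x y b b' : ℕ → ℕ → R}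
    (hx : ∀ i, ∀ j < r i i, y i j = x i j) (hx' : ∀ i j, r i i ≤ j → y i j = 1)
    (hb : ∀ i, ∀ j < m, b' i j = 1) (hb' : ∀ i j, b' i (m + j) = b i j) (σ : Perm ℕ) :
    quiverFun n (addRank r m) y b' (permShift m σ) = quiverFun n r x b σ := by
  classical
  induction n generalizing r x y b b' σ with
  | zero =>
    simp only [quiverFun]
    by_cases h : σ = 1
    · rw [h, map_one]
    · rw [deltaOne_of_ne h, deltaOne_of_ne (by rwa [Ne, permShift_eq_one_iff])]
  | succ n ih =>
    have ht : tailRank (addRank r m) = addRank (tailRank r) m := rfl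
    have h := ih (tailRank r) (x := fun i => x (i + 1)) (y := fun i => y (i + 1))
      (b := fun i => b (i + 1)) (b' := fun i => b' (i + 1)) (fun i => hx (i + 1))
      (fun i => hx' (i + 1)) (fun i => hb (i + 1)) fun i => hb' (i + 1)
    simp only [quiverFun]
    rw [headPerm_addRank, ← map_mul]
    refine (congrFun (fkProd_padded_shift (r 0 0) (r 1 1) m (hx 1) (hx' 1) (hb 0) (hb' 0) _)
      (σ * headPerm (n + 1) r)).trans ?_
    refine congrArg (fun f => fkProd _ _ _ f (σ * headPerm (n + 1) r)) (funext fun w => ?_)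
    exact if_congr (permShift_mem_permBelow m (r 1 1) w) (h w) rfl

end Ratio

section Symmetry

open Equiv

variable {R : Type*} [CommRing R]

/-! ### Symmetry in the variables of a block -/

/-- A block swap is a product of adjacent transpositions inside its range, so invariance need only
be checked on these. -/
theorem blockSwap_induction {P : Perm ℕ → Prop} (c u v : ℕ) (one : P 1)
    (mul : ∀ σ τ, P σ → P τ → P (σ * τ))
    (swap : ∀ p, c ≤ p → p + 1 < c + u + v → P (swap p (p + 1))) : P (blockSwap c u v) := by
  have row : ∀ K a, c ≤ a → a + K < c + u + v → P (blockSwap a K 1) := by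
    intro K
    induction K with
    | zero =>
      intro a _ _
      rwa [show blockSwap a 0 1 = 1 by ext p; simp only [blockSwap_apply, Perm.one_apply]; grind]
    | succ K ih =>
      intro a h1 h2
      rw [show blockSwap a (K + 1) 1 = blockSwap a K 1 * Equiv.swap (a + K) (a + K + 1) by
        ext p; simp only [blockSwap_apply, Perm.mul_apply, swap_apply_def]; grind]
      exact mul _ _ (ih a h1 (by omega)) (swap _ (by omega) (by omega))
  have rect : ∀ e ≤ v, P (blockSwap c u e) := by
    intro e
    induction e with
    | zero =>
      intro _
      rwa [show blockSwap c u 0 = 1 by ext p; simp only [blockSwap_apply, Perm.one_apply]; grind]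
    | succ e ih =>
      intro h
      rw [show blockSwap c u (e + 1) = blockSwap (e + c) u 1 * blockSwap c u e by
        ext p; simp only [blockSwap_apply, Perm.mul_apply]; grind]
      exact mul _ _ (row u _ (by omega) (by omega)) (ih (by omega))
  exact rect v le_rfl

/-- At an ascent the exchange relation reads `x_{p+1} F = x_{p+1} F'`, with `F'` the coefficient
after the exchange; cancelling `x_{p+1}` is what requires a domain and non-zero variables. -/
theorem fkProd_blockSwap_left [IsDomain R] {N c u v : ℕ} (hN : c + u + v ≤ N) {z : Perm ℕ}
    (hz : ∀ p, c ≤ p → p + 1 < c + u + v → z⁻¹ p < z⁻¹ (p + 1)) (b : ℕ → R) :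
    ∀ x : ℕ → R, (∀ i, x i ≠ 0) → fkProd N (fun i => x (blockSwap c u v i)) b (deltaOne R) z =
      fkProd N x b (deltaOne R) z := by
  refine blockSwap_induction (P := fun τ => ∀ x : ℕ → R, (∀ i, x i ≠ 0) →
    fkProd N (fun i => x (τ i)) b (deltaOne R) z = fkProd N x b (deltaOne R) z) c u v
    (fun _ _ => rfl) (fun σ τ hσ hτ x hx => ?_) fun p h1 h2 x hx => ?_
  · exact (hτ (fun i => x (σ i)) fun i => hx _).trans (hσ x hx)
  · have h := congrArg (fun X : Module.End R (Perm ℕ → R) => X (deltaOne R) z)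
      (hecke₂_mul_fkProd (N := N) (k := p) (by omega) x b)
    simp only [Module.End.mul_apply, hecke₂_apply, if_pos (hz p h1 h2), LinearMap.smul_apply,
      Pi.smul_apply, smul_eq_mul] at h
    exact (mul_left_cancel₀ (hx _) h).symm

theorem fkProd_blockSwap_right [IsDomain R] {N c u v : ℕ} (hN : c + u + v ≤ N) {z : Perm ℕ}
    (hz : ∀ p, c ≤ p → p + 1 < c + u + v → z (N - 2 - p) < z (N - 2 - p + 1)) (x : ℕ → R) :
    ∀ b : ℕ → R, (∀ i, b i ≠ 0) → fkProd N x (fun i => b (blockSwap c u v i)) (deltaOne R) z =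
      fkProd N x b (deltaOne R) z := by
  refine blockSwap_induction (P := fun τ => ∀ b : ℕ → R, (∀ i, b i ≠ 0) →
    fkProd N x (fun i => b (τ i)) (deltaOne R) z = fkProd N x b (deltaOne R) z) c u v
    (fun _ _ => rfl) (fun σ τ hσ hτ b hb => ?_) fun p h1 h2 b hb => ?_
  · exact (hτ (fun i => b (σ i)) fun i => hb _).trans (hσ b hb)
  · have h := congrArg (fun X : Module.End R (Perm ℕ → R) => X (deltaOne R) z)
      (fkProd_mul_hecke₂ (N := N) (p := p) (by omega) x b)
    simp only [mul_hecke₂_deltaOne_apply (fkProd_mem N x b) _ _ _ (hz p h1 h2),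
      LinearMap.smul_apply, Pi.smul_apply, smul_eq_mul] at h
    exact (mul_left_cancel₀ (hb _) h).symm

theorem flatten_startDim {A : Type*} {n : ℕ} {r : ℕ → ℕ → ℕ} (x : ℕ → ℕ → A) {i j : ℕ}
    (hi : i ≤ n) (hj : j < r i i) : flatten n r x (startDim r i + j) = x i j := by
  induction n generalizing r x i with
  | zero =>
    obtain rfl : i = 0 := by omega
    rw [startDim_zero, zero_add, flatten]
  | succ n ih =>
    rcases i with - | i
    · rw [startDim_zero, zero_add, flatten_of_lt x hj]
    · rw [startDim_succ', add_assoc, flatten_add]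
      exact ih (r := tailRank r) _ (by omega) hj

theorem exists_startDim {n : ℕ} {r : ℕ → ℕ → ℕ} {k : ℕ} (hk : k < totalDim n r) :
    ∃ i ≤ n, ∃ j < r i i, k = startDim r i + j := by
  induction n generalizing r k with
  | zero =>
    exact ⟨0, le_rfl, k, by simpa [totalDim] using hk, by rw [startDim_zero, zero_add]⟩
  | succ n ih =>
    rw [totalDim_succ] at hk
    by_cases h : k < r 0 0
    · exact ⟨0, by omega, k, h, by rw [startDim_zero, zero_add]⟩
    · obtain ⟨i, hi, j, hj, hij⟩ := ih (r := tailRank r) (k := k - r 0 0) (by omega)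
      exact ⟨i + 1, by omega, j, hj, by rw [startDim_succ']; omega⟩

theorem startDim_mono (r : ℕ → ℕ → ℕ) {i j : ℕ} (h : i ≤ j) : startDim r i ≤ startDim r j :=
  Finset.sum_le_sum_of_subset (Finset.range_mono h)

theorem flatten_blockSwap {A : Type*} {n t u v : ℕ} {r : ℕ → ℕ → ℕ} {x y : ℕ → ℕ → A}
    (ht : t ≤ n) (huv : u + v = r t t) (hne : ∀ i, i ≠ t → y i = x i)
    (heq : ∀ j, y t j = x t (blockSwap 0 u v j)) {k : ℕ} (hk : k < totalDim n r) :
    flatten n r y k = flatten n r x (blockSwap (startDim r t) u v k) := by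
  obtain ⟨i, hi, j, hj, rfl⟩ := exists_startDim hk
  rw [flatten_startDim y hi hj]
  rcases lt_trichotomy i t with h | rfl | h
  · have h1 := startDim_mono r (Nat.succ_le_of_lt h)
    rw [Nat.succ_eq_add_one, startDim_succ] at h1
    rw [blockSwap_apply, if_neg (by omega), if_neg (by omega), flatten_startDim x hi hj,
      hne i h.ne]
  · have h1 : blockSwap (startDim r i) u v (startDim r i + j) =
        startDim r i + blockSwap 0 u v j := by
      simp only [blockSwap_apply]
      split_ifs <;> omega
    rw [h1, flatten_startDim x hi, heq]
    have := permBelow_lt (blockSwap_mem 0 u v) (p := j) (by omega)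
    omega
  · have h1 := startDim_mono r (Nat.succ_le_of_lt h)
    rw [Nat.succ_eq_add_one, startDim_succ] at h1
    rw [blockSwap_apply, if_neg (by omega), if_neg (by omega), flatten_startDim x hi hj,
      hne i h.ne']

theorem flatten_ne_zero {n : ℕ} {r : ℕ → ℕ → ℕ} {x : ℕ → ℕ → R} (hx : ∀ i j, x i j ≠ 0) (k : ℕ) :
    flatten n r x k ≠ 0 := by
  induction n generalizing r x k with
  | zero => exact hx 0 k
  | succ n ih =>
    rw [flatten]
    split_ifs
    · exact hx _ _
    · exact ih (fun i j => hx _ _) _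

theorem apply_flatten_blockSwap {n : ℕ} {r : ℕ → ℕ → ℕ} {Φ : (ℕ → R) → R}
    (hcongr : ∀ x y : ℕ → R, (∀ k < totalDim n r, x k = y k) → Φ x = Φ y) {u v : ℕ → ℕ}
    (huv : ∀ i ≤ n, u i + v i = r i i)
    (hΦ : ∀ t ≤ n, ∀ x : ℕ → R, (∀ k, x k ≠ 0) →
      Φ (fun k => x (blockSwap (startDim r t) (u t) (v t) k)) = Φ x)
    {x : ℕ → ℕ → R} (hx : ∀ i j, x i j ≠ 0) :
    Φ (flatten n r fun i j => x i (blockSwap 0 (u i) (v i) j)) = Φ (flatten n r x) := by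
  have key : ∀ t ≤ n + 1, Φ (flatten n r fun i j =>
      if i < t then x i (blockSwap 0 (u i) (v i) j) else x i j) = Φ (flatten n r x) := by
    intro t
    induction t with
    | zero => intro _; rfl
    | succ t ih =>
      intro ht
      have h1 := hΦ t (by omega) (flatten n r fun i j =>
        if i < t then x i (blockSwap 0 (u i) (v i) j) else x i j)
        (flatten_ne_zero fun i j => by split_ifs <;> exact hx _ _)
      refine (hcongr _ _ fun k hk => ?_).trans (h1.trans (ih (by omega)))
      refine flatten_blockSwap (by omega) (huv t (by omega)) (fun i hi => ?_) (fun j => ?_) hk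
      · ext j
        exact if_congr (by omega) rfl rfl
      · rw [if_pos (by omega), if_neg (by omega)]
  rw [← key (n + 1) le_rfl]
  refine hcongr _ _ fun k hk => flatten_congr (fun i hi j _ => ?_) hk
  rw [if_pos (by omega)]

theorem fkProd_flatten_blockSwap [IsDomain R] {n : ℕ} {r : ℕ → ℕ → ℕ} (hr : IsRankConditions n r)
    {u v u' v' : ℕ → ℕ} (h : ∀ i ≤ n, u i + v i = r i i) (h' : ∀ i ≤ n, u' i + v' i = r i i)
    {x b : ℕ → ℕ → R} (hx : ∀ i j, x i j ≠ 0) (hb : ∀ i j, b i j ≠ 0) :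
    fkProd (totalDim n r) (flatten n r fun i j => x i (blockSwap 0 (u i) (v i) j))
      (flatten n r fun i j => b i (blockSwap 0 (u' i) (v' i) j)) (deltaOne R)
      (conjZelevinsky n r) =
    fkProd (totalDim n r) (flatten n r x) (flatten n r b) (deltaOne R) (conjZelevinsky n r) := by
  have hle := fun t (ht : t ≤ n) => startDim_le_totalDim r (n := n) (l := t + 1) (by omega)
  refine (apply_flatten_blockSwap (Φ := fun y => fkProd (totalDim n r) y _ (deltaOne R)
    (conjZelevinsky n r)) (fun x y hxy => ?_) h (fun t ht y hy => ?_) hx).trans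
    (apply_flatten_blockSwap (Φ := fun y => fkProd (totalDim n r) _ y (deltaOne R)
    (conjZelevinsky n r)) (fun x y hxy => ?_) h' (fun t ht y hy => ?_) hb)
  · rw [fkProd_congr _ (fun k _ hk => hxy k hk) fun _ _ => rfl]
  · have h1 := hle t ht
    have h2 := h t ht
    have h3 := startDim_succ r t
    exact fkProd_blockSwap_left (by omega) (fun p hp hp' =>
      conjZelevinsky_inv_ascent hr ht hp (by omega)) _ y hy
  · rw [fkProd_congr _ (fun _ _ _ => rfl) fun l hl => hxy l (by omega)]
  · have h1 := hle t ht
    have h2 := h' t ht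
    have h3 := startDim_succ r t
    refine fkProd_blockSwap_right (by omega) (fun p hp hp' => ?_) _ y hy
    obtain ⟨j, hj⟩ : ∃ j, totalDim n r - 2 - p = totalDim n r - startDim r (t + 1) + j :=
      ⟨startDim r (t + 1) - 2 - p, by omega⟩
    rw [hj, add_assoc]
    exact (conjZelevinsky_block hr ht (i := j + 1) (by omega)).2.2 j (Nat.lt_succ_self j)

/-! ### The maximal rank conditions -/

theorem maxRank_le (r : ℕ → ℕ → ℕ) {i j k : ℕ} (hi : i ≤ k) (hj : k ≤ j) :
    maxRank r i j ≤ r k k :=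
  Nat.sInf_le ⟨k, ⟨hi, hj⟩, rfl⟩

theorem exists_maxRank_eq (r : ℕ → ℕ → ℕ) {i j : ℕ} (h : i ≤ j) :
    ∃ k, i ≤ k ∧ k ≤ j ∧ maxRank r i j = r k k := by
  obtain ⟨k, hk, hk'⟩ := Nat.sInf_mem (s := (fun k => r k k) '' Set.Icc i j)
    ⟨r i i, i, ⟨le_rfl, h⟩, rfl⟩
  exact ⟨k, hk.1, hk.2, hk'.symm⟩

theorem maxRank_self (r : ℕ → ℕ → ℕ) (i : ℕ) : maxRank r i i = r i i := by
  obtain ⟨k, h1, h2, h3⟩ := exists_maxRank_eq r (le_refl i)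
  rw [h3, le_antisymm h2 h1]

theorem maxRank_mono (r : ℕ → ℕ → ℕ) {i i' j j' : ℕ} (hi : i' ≤ i) (hij : i ≤ j) (hj : j ≤ j') :
    maxRank r i' j' ≤ maxRank r i j := by
  obtain ⟨k, h1, h2, h3⟩ := exists_maxRank_eq r hij
  rw [h3]
  exact maxRank_le r (by omega) (by omega)

theorem isRankConditions_maxRank (n : ℕ) (r : ℕ → ℕ → ℕ) : IsRankConditions n (maxRank r) where
  le_left i j h _ := maxRank_mono r le_rfl (by omega) (by omega)
  le_right i j h _ := maxRank_mono r (by omega) (by omega) le_rfl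
  convex i j h1 h2 _ := by
    obtain ⟨k, h3, h4, h5⟩ := exists_maxRank_eq r (i := i - 1) (j := j + 1) (by omega)
    rw [h5]
    by_cases h : k ≤ j
    · have := maxRank_le r (j := j) h3 h
      have := maxRank_mono r (le_refl i) h2 (Nat.le_succ j)
      simp only [Nat.succ_eq_add_one] at this
      omega
    · have := maxRank_le r (i := i) (k := k) (j := j + 1) (by omega) h4
      have := maxRank_mono r (i' := i - 1) (i := i) (by omega) h2 (le_refl j)
      omega

theorem maxRank_eq_or (r : ℕ → ℕ → ℕ) {i j : ℕ} (h : i < j) :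
    maxRank r i j = maxRank r (i + 1) j ∨ maxRank r i j = maxRank r i (j - 1) := by
  obtain ⟨k, h1, h2, h3⟩ := exists_maxRank_eq r h.le
  by_cases hk : k = j
  · left
    refine le_antisymm (maxRank_mono r (by omega) (by omega) le_rfl) ?_
    rw [h3]
    exact maxRank_le r (by omega) h2
  · right
    refine le_antisymm (maxRank_mono r le_rfl (by omega) (by omega)) ?_
    rw [h3]
    exact maxRank_le r h1 (by omega)

theorem flatten_rank_congr {A : Type*} {n : ℕ} {r r' : ℕ → ℕ → ℕ} (h : ∀ i, r i i = r' i i)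
    (x : ℕ → ℕ → A) (k : ℕ) : flatten n r x k = flatten n r' x k := by
  induction n generalizing r r' x k with
  | zero => rfl
  | succ n ih => rw [flatten, flatten, h 0, ih (r := tailRank r) (r' := tailRank r') fun i => h (i + 1)]

theorem homFactor_rank_congr {n : ℕ} {r r' : ℕ → ℕ → ℕ} (h : ∀ i, r i i = r' i i)
    (x b : ℕ → ℕ → R) : homFactor n r x b = homFactor n r' x b := by
  induction n generalizing r r' x b with
  | zero => rfl
  | succ n ih =>
    have h1 : restDim n r = restDim n r' := by simp only [restDim, h]
    have h2 : ∀ k, flatten n (tailRank r) (fun i => x (i + 1)) k =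
        flatten n (tailRank r') (fun i => x (i + 1)) k :=
      flatten_rank_congr (fun i => h (i + 1)) _
    rw [homFactor, homFactor, ih (r := tailRank r) (r' := tailRank r') fun i => h (i + 1), h1, h 0, h 1]
    simp only [h2]

theorem totalDim_rank_congr {n : ℕ} {r r' : ℕ → ℕ → ℕ} (h : ∀ i, r i i = r' i i) :
    totalDim n r = totalDim n r' := by
  simp only [totalDim, h]

theorem fkProd_flatten_maxRank_apply (n : ℕ) (r : ℕ → ℕ → ℕ) (x b : ℕ → ℕ → R) :
    fkProd (totalDim n r) (flatten n r x) (flatten n r b) (deltaOne R)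
      (conjZelevinsky n (maxRank r)) = homFactor n r x b := by
  have h := fkProd_flatten_apply (isRankConditions_maxRank n r) x b
  rw [quiverFun_one (fun i j hij _ => maxRank_eq_or r hij), mul_one,
    homFactor_rank_congr (maxRank_self r), totalDim_rank_congr (maxRank_self r)] at h
  rw [← h]
  simp only [funext (flatten_rank_congr (n := n) (maxRank_self r) x),
    funext (flatten_rank_congr (n := n) (maxRank_self r) b)]

theorem homFactor_of_eq_zero {n : ℕ} {r : ℕ → ℕ → ℕ} {x b : ℕ → ℕ → R}
    (hb : ∀ i ≤ n, ∀ j < r i i, b i j = 0) : homFactor n r x b = 1 := by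
  induction n generalizing r x b with
  | zero => rfl
  | succ n ih =>
    rw [homFactor, ih fun i hi j hj => hb (i + 1) (by omega) j hj, mul_one]
    refine Finset.prod_eq_one fun l hl => Finset.prod_eq_one fun k _ => ?_
    rw [hb 0 (by omega) l (Finset.mem_range.1 hl), zero_mul, sub_zero]

variable {S : Type*} [CommRing S]

theorem map_flatten (φ : R →+* S) (n : ℕ) (r : ℕ → ℕ → ℕ) (x : ℕ → ℕ → R) (k : ℕ) :
    φ (flatten n r x k) = flatten n r (fun i j => φ (x i j)) k := by
  induction n generalizing r x k with
  | zero => rfl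
  | succ n ih =>
    rw [flatten, flatten]
    split_ifs
    · rfl
    · exact ih _ _ _

theorem map_homFactor (φ : R →+* S) (n : ℕ) (r : ℕ → ℕ → ℕ) (x b : ℕ → ℕ → R) :
    φ (homFactor n r x b) = homFactor n r (fun i j => φ (x i j)) fun i j => φ (b i j) := by
  induction n generalizing r x b with
  | zero => exact map_one φ
  | succ n ih =>
    rw [homFactor, homFactor, map_mul, ih]
    simp only [map_prod, map_sub, map_one, map_mul, map_flatten]

/-- For generic variables both `homFactor` and its product with `quiverFun` are coefficients at
permutations with ascents in every block, hence symmetric, and `homFactor` cancels. The general case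
follows by specialization. -/
theorem quiverFun_blockSwap {n : ℕ} {r : ℕ → ℕ → ℕ} (hr : IsRankConditions n r)
    {u v u' v' : ℕ → ℕ} (h : ∀ i ≤ n, u i + v i = r i i) (h' : ∀ i ≤ n, u' i + v' i = r i i)
    (x b : ℕ → ℕ → R) :
    quiverFun n r (fun i j => x i (blockSwap 0 (u i) (v i) j))
      (fun i j => b i (blockSwap 0 (u' i) (v' i) j)) 1 = quiverFun n r x b 1 := by
  set X : ℕ → ℕ → MvPolynomial ((ℕ × ℕ) ⊕ (ℕ × ℕ)) ℤ := fun i j =>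
    MvPolynomial.X (Sum.inl (i, j)) with hX
  set B : ℕ → ℕ → MvPolynomial ((ℕ × ℕ) ⊕ (ℕ × ℕ)) ℤ := fun i j =>
    MvPolynomial.X (Sum.inr (i, j)) with hB
  set X' : ℕ → ℕ → MvPolynomial ((ℕ × ℕ) ⊕ (ℕ × ℕ)) ℤ := fun i j =>
    X i (blockSwap 0 (u i) (v i) j) with hX'
  set B' : ℕ → ℕ → MvPolynomial ((ℕ × ℕ) ⊕ (ℕ × ℕ)) ℤ := fun i j =>
    B i (blockSwap 0 (u' i) (v' i) j) with hB'
  have hX0 : ∀ i j, X i j ≠ 0 := fun i j => MvPolynomial.X_ne_zero _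
  have hB0 : ∀ i j, B i j ≠ 0 := fun i j => MvPolynomial.X_ne_zero _
  have h1 : homFactor n r X' B' = homFactor n r X B := by
    have := fkProd_flatten_blockSwap (isRankConditions_maxRank n r) (u := u) (v := v) (u' := u')
      (v' := v') (by simpa only [maxRank_self] using h) (by simpa only [maxRank_self] using h')
      hX0 hB0
    rwa [fkProd_flatten_apply (isRankConditions_maxRank n r),
      fkProd_flatten_apply (isRankConditions_maxRank n r),
      quiverFun_one (fun i j hij _ => maxRank_eq_or r hij),
      quiverFun_one (fun i j hij _ => maxRank_eq_or r hij), mul_one, mul_one,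
      homFactor_rank_congr (maxRank_self r), homFactor_rank_congr (maxRank_self r)] at this
  have h2 : homFactor n r X B ≠ 0 := by
    -- Constant terms are compared: with all `b` equal to `0` the product is `1`.
    intro h0
    have := map_homFactor (MvPolynomial.constantCoeff (R := ℤ)) n r X B
    rw [h0, homFactor_of_eq_zero (fun i _ j _ => by simp [hB])] at this
    simp at this
  have h3 : quiverFun n r X' B' 1 = quiverFun n r X B 1 := by
    have := fkProd_flatten_blockSwap hr h h' hX0 hB0
    rw [fkProd_flatten_apply hr, fkProd_flatten_apply hr] at this
    change homFactor n r X' B' * quiverFun n r X' B' 1 = _ at this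
    rw [h1] at this
    exact mul_left_cancel₀ h2 this
  set φ : MvPolynomial ((ℕ × ℕ) ⊕ (ℕ × ℕ)) ℤ →+* R := (MvPolynomial.aeval
    (Sum.elim (fun p => x p.1 p.2) fun p => b p.1 p.2)).toRingHom with hφ
  have h4 := congrArg φ h3
  rw [map_quiverFun, map_quiverFun] at h4
  simpa [hφ, hX', hB', hX, hB] using h4

end Symmetry

section Final

open Equiv

/-! ### The double ratio formula in block variables -/

theorem blockVar_ext {n : ℕ} {r : ℕ → ℕ → ℕ} {s t : BlockVar n r} (h₁ : s.1 = t.1)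
    (h₂ : (s.2 : ℕ) = t.2) : s = t := by
  obtain ⟨i, j⟩ := s
  obtain ⟨i', j'⟩ := t
  obtain rfl : i = i' := h₁
  congr 1
  exact Fin.ext h₂

/-- The variables `(a^i_j)⁻¹`, where the order within each block is reversed. -/
noncomputable def blockX (n : ℕ) (r : ℕ → ℕ → ℕ) (i j : ℕ) : GRing (BlockVar n r) (BlockVar n r) :=
  if h : i < n + 1 ∧ j < r i i then aInv ⟨⟨i, h.1⟩, ⟨r i i - 1 - j, by
    show r i i - 1 - j < r i i
    omega⟩⟩ else 1

/-- The variables `b^i_j`. -/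
noncomputable def blockB (n : ℕ) (r : ℕ → ℕ → ℕ) (i j : ℕ) : GRing (BlockVar n r) (BlockVar n r) :=
  if h : i < n + 1 ∧ j < r i i then bVar ⟨⟨i, h.1⟩, ⟨j, h.2⟩⟩ else 1

theorem totalDim_eq_startDim (n : ℕ) (r : ℕ → ℕ → ℕ) : totalDim n r = startDim r (n + 1) := by
  rw [totalDim, Fin.sum_univ_eq_sum_range (fun i => r i i), startDim]

theorem blockSeq_eq {n : ℕ} {r : ℕ → ℕ → ℕ} {i j : ℕ} (hi : i < n + 1) (hj : j < r i i)
    (h : startDim r i + j < totalDim n r) :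
    blockSeq n r ⟨startDim r i + j, h⟩ = ⟨⟨i, hi⟩, ⟨j, hj⟩⟩ := by
  refine (Equiv.symm_apply_eq _).2 (Fin.ext ?_)
  rw [finSigmaFinEquiv_apply]
  simp [startDim, Finset.sum_range]

/-- The reversal `k ↦ N - 1 - k` undoes the reversed block order of `ă`, but leaves the order inside
each block reversed. -/
theorem blockSeqRev_eq {n : ℕ} {r : ℕ → ℕ → ℕ} {i j : ℕ} (hi : i < n + 1) (hj : j < r i i)
    (h : totalDim n r - 1 - (startDim r i + j) < totalDim n r) :
    blockSeqRev n r ⟨totalDim n r - 1 - (startDim r i + j), h⟩ =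
      ⟨⟨i, hi⟩, ⟨r i i - 1 - j, by show r i i - 1 - j < r i i; omega⟩⟩ := by
  have hrev : (⟨n - i, by omega⟩ : Fin (n + 1)).rev = ⟨i, hi⟩ := by
    ext
    simp only [Fin.val_rev]
    omega
  have hs : finSigmaFinEquiv.symm (Fin.cast (totalDim_rev n r)
      ⟨totalDim n r - 1 - (startDim r i + j), h⟩) =
      (⟨⟨n - i, by omega⟩, ⟨r i i - 1 - j, by rw [hrev]; show r i i - 1 - j < r i i; omega⟩⟩ :
        Σ i : Fin (n + 1), Fin (r i.rev i.rev)) := by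
    rw [Equiv.symm_apply_eq]
    ext
    rw [finSigmaFinEquiv_apply]
    have hsum : ∀ d, d ≤ n + 1 → ∑ k : Fin d, r (n - k) (n - k) + startDim r (n + 1 - d) =
        totalDim n r := by
      intro d
      induction d with
      | zero => intro _; simp [totalDim_eq_startDim]
      | succ d ih =>
        intro hd
        rw [← ih (by omega), Fin.sum_univ_castSucc, show n + 1 - d = n + 1 - (d + 1) + 1 by omega,
          startDim_succ, show n + 1 - (d + 1) = n - d by omega]
        simp only [Fin.val_castSucc, Fin.val_last]
        omega
    have h1 := hsum (n - i) (by omega)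
    rw [show n + 1 - (n - i) = i + 1 by omega, startDim_succ] at h1
    have h2 : ∀ k : Fin (n - i), ((Fin.castLE (show n - i ≤ n + 1 by omega) k).rev : ℕ) = n - k := by
      intro k
      simp only [Fin.val_rev, Fin.val_castLE]
      omega
    simp only [Fin.val_cast]
    simp only [h2]
    omega
  refine blockVar_ext ?_ ?_
  · simp only [blockSeqRev, hs]
    exact hrev
  · exact congrArg (fun s : Σ i : Fin (n + 1), Fin (r i.rev i.rev) => (s.2 : ℕ)) hs

theorem blockGrothendieck_eq {n : ℕ} {r : ℕ → ℕ → ℕ} {z : Perm ℕ} (hz : z ∈ permBelow (totalDim n r)) :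
    blockGrothendieck n r (longestPerm (totalDim n r) * z⁻¹ * longestPerm (totalDim n r)) =
      fkProd (totalDim n r) (flatten n r (blockX n r)) (flatten n r (blockB n r)) (deltaOne _) z := by
  set N := totalDim n r with hN
  have hw : longestPerm N * z⁻¹ * longestPerm N ∈ permBelow N :=
    mul_mem (mul_mem (longestPerm_mem N) (inv_mem hz)) (longestPerm_mem N)
  have hzw : longestPerm N * (longestPerm N * z⁻¹ * longestPerm N)⁻¹ * longestPerm N = z := by
    simp only [mul_inv_rev, inv_inv, longestPerm_inv, mul_assoc, longestPerm_mul_self, mul_one]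
    rw [← mul_assoc, longestPerm_mul_self, one_mul]
  rw [blockGrothendieck, grothendieck_eq_fkProd N _ hw, hzw]
  refine (map_fkProd (MvPolynomial.rename (R := ℤ)
    (Sum.map (blockSeqRev n r) (blockSeq n r))).toRingHom N _ _ (map_deltaOne _) z).trans ?_
  refine congrArg (fun X : Module.End (GRing (BlockVar n r) (BlockVar n r)) _ => X (deltaOne _) z)
    (fkProd_congr N (fun k _ hk => ?_) fun l hl => ?_)
  · obtain ⟨i, hi, j, hj, rfl⟩ := exists_startDim hk
    rw [flatten_startDim _ hi hj, blockX, dif_pos ⟨by omega, hj⟩, aSeq, dif_pos (by omega)]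
    simp only [aInv, AlgHom.toRingHom_eq_coe, RingHom.coe_coe, MvPolynomial.rename_X, Sum.map_inl]
    rw [blockSeqRev_eq (by omega) hj]
  · obtain ⟨i, hi, j, hj, rfl⟩ := exists_startDim (show l < totalDim n r by omega)
    rw [flatten_startDim _ hi hj, blockB, dif_pos ⟨by omega, hj⟩, bSeq, dif_pos (by omega)]
    simp only [bVar, AlgHom.toRingHom_eq_coe, RingHom.coe_coe, MvPolynomial.rename_X, Sum.map_inr]
    rw [blockSeq_eq (by omega) hj]

theorem ratioDen_eq (n : ℕ) (r : ℕ → ℕ → ℕ) :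
    ratioDen n r = homFactor n r (blockX n r) (blockB n r) := by
  have hN := totalDim_rank_congr (n := n) (maxRank_self r)
  rw [ratioDen, zelevinsky, hN, blockGrothendieck_eq, fkProd_flatten_maxRank_apply]
  rw [← hN]
  exact conjZelevinsky_mem (isRankConditions_maxRank n r)

theorem ratioDen_ne_zero (n : ℕ) (r : ℕ → ℕ → ℕ) : ratioDen n r ≠ 0 := by
  rw [ratioDen_eq]
  intro h0
  have := map_homFactor (MvPolynomial.constantCoeff (R := ℤ)) n r (blockX n r) (blockB n r)
  rw [h0, homFactor_of_eq_zero (fun i hi j hj => by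
    simp [blockB, Nat.lt_succ_of_le hi, hj, bVar])] at this
  simp at this

/-- Since `homFactor` sees only the dimension vector, it is the same for `r` and for `r^e`, where it
is the whole coefficient. -/
theorem ratioNum_eq {n : ℕ} {r : ℕ → ℕ → ℕ} (hr : IsRankConditions n r) :
    ratioNum n r = ratioDen n r * quiverFun n r (blockX n r) (blockB n r) 1 := by
  rw [ratioNum, zelevinsky, blockGrothendieck_eq (conjZelevinsky_mem hr), fkProd_flatten_apply hr,
    ratioDen_eq]

theorem doubleQuiver_eq {n : ℕ} {r : ℕ → ℕ → ℕ} (hr : IsRankConditions n r) :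
    doubleQuiver n r = quiverFun n r (blockX n r) (blockB n r) 1 := by
  have h := exactQuot_spec (Dvd.intro _ (ratioNum_eq hr).symm)
  rw [ratioNum_eq hr] at h
  rw [doubleQuiver, ratioNum_eq hr]
  exact mul_left_cancel₀ (ratioDen_ne_zero n r) h

/-! ### Specialization of the padded variables to one -/

theorem IsRankConditions.addRank {n : ℕ} {r : ℕ → ℕ → ℕ} (hr : IsRankConditions n r) (m : ℕ) :
    IsRankConditions n (addRank r m) where
  le_left i j h1 h2 := Nat.add_le_add_right (hr.le_left i j h1 h2) m
  le_right i j h1 h2 := Nat.add_le_add_right (hr.le_right i j h1 h2) m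
  convex i j h1 h2 h3 := by
    have := hr.convex i j h1 h2 h3
    simp only [_root_.addRank]
    omega

/-- The ones come first here because `blockX` reverses each block. -/
theorem specOnes_blockX {n : ℕ} {r : ℕ → ℕ → ℕ} {m i j : ℕ} (hi : i ≤ n) (hj : j < r i i + m) :
    specOnes n r m (blockX n (addRank r m) i j) =
      if j < m then 1 else blockX n r i (j - m) := by
  have hj' : j < addRank r m i i := hj
  rw [blockX, dif_pos ⟨by omega, hj'⟩, aInv, specOnes, MvPolynomial.aeval_X, Sum.elim_inl, padOnes]
  split_ifs with h
  · have : (⟨addRank r m i i - 1 - j, by simp only [addRank]; omega⟩ : Fin (r i i + m)) =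
        Fin.natAdd (r i i) ⟨m - 1 - j, by omega⟩ := by
      ext
      simp only [addRank, Fin.val_natAdd]
      omega
    exact (congrArg _ this).trans (Fin.append_right _ _ _)
  · have : (⟨addRank r m i i - 1 - j, by simp only [addRank]; omega⟩ : Fin (r i i + m)) =
        Fin.castAdd m ⟨r i i - 1 - (j - m), by omega⟩ := by
      ext
      simp only [addRank, Fin.val_castAdd]
      omega
    rw [blockX, dif_pos ⟨by omega, by omega⟩]
    exact (congrArg _ this).trans (Fin.append_left _ _ _)

theorem specOnes_blockB {n : ℕ} {r : ℕ → ℕ → ℕ} {m i j : ℕ} (hi : i ≤ n) (hj : j < r i i + m) :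
    specOnes n r m (blockB n (addRank r m) i j) =
      if j < r i i then blockB n r i j else 1 := by
  have hj' : j < addRank r m i i := hj
  rw [blockB, dif_pos ⟨by omega, hj'⟩, bVar, specOnes, MvPolynomial.aeval_X, Sum.elim_inr, padOnes]
  split_ifs with h
  · rw [blockB, dif_pos ⟨by omega, h⟩]
    exact Fin.append_left _ _ (⟨j, h⟩ : Fin (r i i))
  · have : (⟨j, hj⟩ : Fin (r i i + m)) = Fin.natAdd (r i i) ⟨j - r i i, by omega⟩ := by
      ext
      simp only [Fin.val_natAdd]
      omega
    exact (congrArg _ this).trans (Fin.append_right _ _ _)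

theorem specOnes_doubleQuiver {n : ℕ} {r : ℕ → ℕ → ℕ} (hr : IsRankConditions n r) (m : ℕ) :
    specOnes n r m (doubleQuiver n (addRank r m)) = doubleQuiver n r := by
  rw [doubleQuiver_eq (hr.addRank m), doubleQuiver_eq hr]
  refine (map_quiverFun (specOnes n r m).toRingHom n (addRank r m) _ _ 1).trans ?_
  -- After the specialization the ones stand first in each `x`-block and last in each `b`-block. The
  -- two block swaps bring them to the ends required by `quiverFun_addRank`.
  rw [← quiverFun_blockSwap (hr.addRank m) (u := fun i => r i i) (v := fun _ => m)
    (u' := fun _ => m) (v' := fun i => r i i) (fun _ _ => rfl) fun i _ => Nat.add_comm _ _]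
  have h := quiverFun_addRank n r m (x := blockX n r) (b := blockB n r)
    (y := fun i j => if j < r i i then blockX n r i j else 1)
    (b' := fun i j => if j < m then 1 else blockB n r i (j - m)) (fun i j hj => if_pos hj)
    (fun i j hj => if_neg (by omega)) (fun i j hj => if_pos hj)
    (fun i j => by rw [if_neg (by omega), Nat.add_sub_cancel_left]) 1
  rw [map_one] at h
  rw [← h]
  refine quiverFun_congr (fun i hi j hj => ?_) (fun i hi j hj => ?_) 1
  · simp only [addRank] at hj
    refine (specOnes_blockX hi ?_).trans ?_
    · have := permBelow_lt (blockSwap_mem 0 (r i i) m) (p := j) (by omega)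
      omega
    · rw [blockSwap_apply]
      split_ifs <;> first | omega | rfl | (congr 1; omega)
  · simp only [addRank] at hj
    refine (specOnes_blockB hi ?_).trans ?_
    · have := permBelow_lt (blockSwap_mem 0 m (r i i)) (p := j) (by omega)
      omega
    · rw [blockSwap_apply]
      split_ifs <;> first | omega | rfl

end Final

theorem theoremT (n : ℕ) (r : ℕ → ℕ → ℕ) (hr : IsRankConditions n r) (m : ℕ) :
    (ratioDen n r ≠ 0 ∧ ratioDen n r ∣ ratioNum n r) ∧
    (ratioDen n (addRank r m) ≠ 0 ∧ ratioDen n (addRank r m) ∣ ratioNum n (addRank r m)) ∧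
    specOnes n r m (doubleQuiver n (addRank r m)) = doubleQuiver n r :=
  ⟨⟨ratioDen_ne_zero n r, Dvd.intro _ (ratioNum_eq hr).symm⟩,
    ⟨ratioDen_ne_zero n _, Dvd.intro _ (ratioNum_eq (hr.addRank m)).symm⟩,
    specOnes_doubleQuiver hr m⟩
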